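/- Fix a relational vocabulary with disjoint sets of extensional and intensional predicates, a countably infinite set of variables and an infinite set $\mathsf{C}$ of constants. A \emph{program} $P$ is a finite set of rules $\forall \vec X\,\forall \vec Y\,\bigwedge_{i=1}^n P_i(\vec X_i,\vec Y_i)\to\exists\vec Z\,P(\vec Y,\vec Z)$ whose head predicate is intensional and whose body atoms are either all extensional (the rule is then called extensional) or all intensional. A \emph{base instance} $B$ is a finite set of facts over extensional predicates and constants. A \emph{model} of $(P,B)$ is a set of facts (possibly with nulls) that contains $B$ and satisfies all rules of $P$. For a Boolean conjunctive query (BCQ) $Q$ (a finite conjunction of atoms over constants and existential variables), $I\models Q$ means that $Q$ has a homomorphism into the instance $I$, and $(P,B)\models Q$ means that $M\models Q$ for each model $M$ of $(P,B)$. For instances, $I\models J$ means that there is a homomorphism from $J$ into $I$ that fixes the constants. The (equivalent) chase is the sequence of instances with $Ch^0(P,B)=B$ whose $(i+1)$-st element is $Ch^i(P,B)$ together with the facts $h_s(\mathrm{head}(r))$, for all $r\in P$ and all homomorphisms $h$ from the body of $r$ into $Ch^i(P,B)$, where $h_s$ extends $h$ by mapping each existential variable $z$ of $r$ to the null $n_{r,h,z}$.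 The chase stops (the sequence stays constant) after the first round whose result is logically equivalent to the result of the previous round. The depth of a constant is $1$, and the depth of $n_{r,h,z}$ is one more than the maximal depth of the terms in the range of $h$. An \emph{execution graph} for $P$ is an acyclic digraph $G$ in which each node $v$ is labelled with a rule $r_v\in P$ and each edge $u\to_j v$ with a position $j$ of the body of $r_v$ whose predicate is the head predicate of $r_u$; nodes with an extensional rule have no incoming edge, and every other node $v$ has exactly one incoming edge $u_j\to_j v$ for each body position $j$. Here $v(B)$ is the set of the facts $h_s(\mathrm{head}(r_v))$ for all $h$ that map the body of $r_v$ into $B$ (if $r_v$ is extensional), respectively the $j$-th body atom of $r_v$ into $u_j(B)$ for all $j$ (otherwise), and $G(B)=B\cup\bigcup_v v(B)$. The program $P$ is \begin{itemize} \item FTG, if there is a finite execution graph $G$ for $P$ such that, for each base instance $B$ and each BCQ $Q$, $(P,B)\models Q$ iff $G(B)\models Q$; \item BDD, if there is a $k\ge 0$ such that $Ch^k(P,B)\models Ch^{k+1}(P,B)$ for each base instance $B$; \item TDB, if there is a $k\ge 0$ such that, for each base instance $B$ and each $i\ge 0$, all terms in $Ch^i(P,B)$ have depth at most $k$; \item FUS,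 if for each BCQ $Q$ there is a finite union $Q'$ of BCQs such that, for each base instance $B$, $(P,B)\models Q$ iff $B\models Q'$. \end{itemize} Theorem. For each program $P$: $P$ is FTG if and only if it is BDD; and $P$ is both TDB and FUS if and only if it is BDD. -/

import Mathlib

/-!
# Existential rules, the equivalent chase, and execution graphs
-/

universe u v

/-- A relational vocabulary: predicates with arities, and two disjoint sets of predicates, the
extensional and the intensional ones. -/
structure Signature where
  Pred : Type u
  arity : Pred → ℕ
  extensional : Set Pred
  intensional : Set Pred
  disjoint : Disjoint extensional intensional

/-- The countably infinite set of variables. -/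
abbrev Var : Type := ℕ

/-- An atom `p(t₁, …, tₙ)` whose terms are taken from `T`, where `n` is the arity of `p`. -/
structure PredAtom (S : Signature.{u}) (T : Type v) where
  pred : S.Pred
  args : Fin (S.arity pred) → T

namespace PredAtom

/-- Apply a term mapping to an atom. -/
def map {S : Signature.{u}} {T T' : Type*} (f : T → T') (A : PredAtom S T) : PredAtom S T' :=
  ⟨A.pred, fun i => f (A.args i)⟩

/-- The set of variables of an atom over variables. -/
def vars {S : Signature.{u}} (A : PredAtom S Var) : Finset Var :=
  Finset.univ.image A.args

end PredAtom

/-- An existential rule `∀ X Y, ⋀ᵢ Pᵢ(Xᵢ, Yᵢ) → ∃ Z, P(Y, Z)`. The head predicate is intensional;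
the body consists of extensional atoms only or of intensional atoms only. The existential variables
are exactly the head variables that do not occur in the body. -/
structure Rule (S : Signature.{u}) where
  body : List (PredAtom S Var)
  head : PredAtom S Var
  head_intensional : head.pred ∈ S.intensional
  body_uniform : (∀ A ∈ body, A.pred ∈ S.extensional) ∨ (∀ A ∈ body, A.pred ∈ S.intensional)

namespace Rule

variable {S : Signature.{u}}

/-- The (universally quantified) variables of the body. -/
def bodyVars (r : Rule S) : Finset Var :=
  r.body.foldr (fun A s => A.vars ∪ s) ∅

/-- A rule is extensional if its body has only extensional atoms. -/
def IsExtensional (r : Rule S) : Prop :=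
  ∀ A ∈ r.body, A.pred ∈ S.extensional

end Rule

/-- A program is a finite set of rules. -/
abbrev Program (S : Signature.{u}) := Finset (Rule S)

/-- Ground terms: constants from `C` and nulls. The null `null r h z` is the null `n_{r,h,z}`
that the application of the rule `r` under the trigger `h` (a map on the body variables of `r`)
introduces for the variable `z`. -/
inductive GTerm (S : Signature.{u}) (C : Type v) : Type (max u v)
  | const (c : C) : GTerm S C
  | null (r : Rule S) (h : {x : Var // x ∈ r.bodyVars} → GTerm S C) (z : Var) : GTerm S C

/-- The depth of a ground term: `1` for a constant, and one more than the maximal depth of the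
terms in the range of `h` for the null `n_{r,h,z}`. -/
def GTerm.depth {S : Signature.{u}} {C : Type v} : GTerm S C → ℕ
  | .const _ => 1
  | .null _ h _ => Finset.univ.sup (fun x => (h x).depth) + 1

/-- A fact is an atom of ground terms. -/
abbrev GroundFact (S : Signature.{u}) (C : Type v) := PredAtom S (GTerm S C)

/-- An instance is a set of facts. -/
abbrev Inst (S : Signature.{u}) (C : Type v) := Set (GroundFact S C)

section Semantics

variable {S : Signature.{u}} {C : Type v}

/-- A base instance: a finite set of facts with extensional predicates and constants only. -/
def IsBaseInstance (B : Inst S C) : Prop :=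
  B.Finite ∧ ∀ f ∈ B, f.pred ∈ S.extensional ∧ ∀ i, ∃ c : C, f.args i = GTerm.const c

/-- A homomorphism of instances: constants are fixed, nulls go to arbitrary ground terms, facts go
to facts. -/
def IsInstHom (σ : GTerm S C → GTerm S C) (I J : Inst S C) : Prop :=
  (∀ c : C, σ (GTerm.const c) = GTerm.const c) ∧ ∀ f ∈ I, f.map σ ∈ J

/-- Logical entailment `I ⊨ J` between instances (with nulls read existentially): there is a
homomorphism from `J` into `I`. -/
def Entails (I J : Inst S C) : Prop :=
  ∃ σ : GTerm S C → GTerm S C, IsInstHom σ J I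

/-- Logical equivalence of instances. -/
def LogEquiv (I J : Inst S C) : Prop :=
  Entails I J ∧ Entails J I

/-- The rule `r` holds in `I`: each homomorphism of the body into `I` can be modified on the
variables that do not occur in the body so as to map the head into `I`. -/
def Rule.HoldsIn (r : Rule S) (I : Inst S C) : Prop :=
  ∀ σ : Var → GTerm S C, (∀ A ∈ r.body, A.map σ ∈ I) →
    ∃ σ' : Var → GTerm S C, (∀ x ∈ r.bodyVars, σ' x = σ x) ∧ r.head.map σ' ∈ I

/-- `I` is a model of the knowledge base `(P, B)`. -/
def IsModel (P : Program S) (B I : Inst S C) : Prop :=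
  B ⊆ I ∧ ∀ r ∈ P, r.HoldsIn I

/-- A Boolean conjunctive query: a finite conjunction of atoms over constants (`Sum.inl`) and
existentially quantified variables (`Sum.inr`). -/
abbrev BCQ (S : Signature.{u}) (C : Type v) := List (PredAtom S (C ⊕ Var))

/-- `I ⊨ Q`: some assignment of the variables maps all atoms of `Q` into `I`. -/
def BCQ.TrueIn (Q : BCQ S C) (I : Inst S C) : Prop :=
  ∃ σ : Var → GTerm S C, ∀ A ∈ Q, A.map (Sum.elim GTerm.const σ) ∈ I

/-- `(P, B) ⊨ Q`: the query is true in every model of the knowledge base. -/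
def KBEntails (P : Program S) (B : Inst S C) (Q : BCQ S C) : Prop :=
  ∀ M : Inst S C, IsModel P B M → Q.TrueIn M

/-- The extension `h_s` of a map `h` on the body variables of `r`: every other variable `z`
goes to the null `n_{r,h,z}`. -/
def Rule.skolemExt (r : Rule S) (h : {x : Var // x ∈ r.bodyVars} → GTerm S C) (x : Var) :
    GTerm S C :=
  if hx : x ∈ r.bodyVars then h ⟨x, hx⟩ else GTerm.null r h x

/-- `h` is a trigger for `r` in `I`. (On body atoms `h_s` agrees with `h`.) -/
def Rule.IsTrigger (r : Rule S) (h : {x : Var // x ∈ r.bodyVars} → GTerm S C) (I : Inst S C) :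
    Prop :=
  ∀ A ∈ r.body, A.map (r.skolemExt h) ∈ I

/-- One chase round without any checks: add `h_s(head r)` for all rules `r` of the program and
all triggers `h`. -/
def chaseRound (P : Program S) (I : Inst S C) : Inst S C :=
  I ∪ {f | ∃ r ∈ P, ∃ h : {x : Var // x ∈ r.bodyVars} → GTerm S C,
    r.IsTrigger h I ∧ f = r.head.map (r.skolemExt h)}

open Classical in
/-- The instance after the `i`-th round of the equivalent chase: the rounds apply all triggers, and
the chase terminates at the first round whose result is logically equivalent to the result of the
previous round (the sequence is constant from there on). -/
noncomputable def chaseStep (P : Program S) (B : Inst S C) : ℕ → Inst S C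
  | 0 => B
  | 1 => chaseRound P B
  | (i + 2) =>
    if LogEquiv (chaseStep P B (i + 1)) (chaseStep P B i) then chaseStep P B (i + 1)
    else chaseRound P (chaseStep P B (i + 1))

end Semantics

/-- An execution graph for the program `P` on the node set `V`: an acyclic digraph whose nodes are
labelled with rules of `P` and whose edges `u →ⱼ v` are labelled with positions `j` of the body of
the rule of `v`. The head predicate of `u` is then the `j`-th body predicate of `v`. Nodes with an
extensional rule have no incoming edge; a node with an intensional rule has precisely one incoming
edge for each body position. -/
structure ExecutionGraph {S : Signature.{u}} (P : Program S) (V : Type) where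
  rule : V → Rule S
  rule_mem : ∀ v, rule v ∈ P
  edge : V → (v : V) → Fin (rule v).body.length → Prop
  edge_pred : ∀ u v j, edge u v j → ((rule v).body.get j).pred = (rule u).head.pred
  edge_unique : ∀ u u' v j, edge u v j → edge u' v j → u = u'
  edge_extensional : ∀ u v j, edge u v j → ¬ (rule v).IsExtensional
  edge_complete : ∀ v, ¬ (rule v).IsExtensional → ∀ j, ∃ u, edge u v j
  acyclic : ∀ v, ¬ Relation.TransGen (fun a b => ∃ j, edge a b j) v v

namespace ExecutionGraph

variable {S : Signature.{u}} {C : Type v} {P : Program S} {V : Type}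

/-- `G.NodeFact B v f` says that the fact `f` belongs to `v(B)`. For an extensional rule, the body
is matched in `B`; for an intensional rule, the `j`-th body atom is matched in `uⱼ(B)` where
`uⱼ →ⱼ v`. -/
inductive NodeFact (G : ExecutionGraph P V) (B : Inst S C) : V → GroundFact S C → Prop
  | extensional (v : V) (hv : (G.rule v).IsExtensional)
      (h : {x : Var // x ∈ (G.rule v).bodyVars} → GTerm S C)
      (hB : (G.rule v).IsTrigger h B) :
      NodeFact G B v ((G.rule v).head.map ((G.rule v).skolemExt h))
  | intensional (v : V) (hv : ¬ (G.rule v).IsExtensional)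
      (h : {x : Var // x ∈ (G.rule v).bodyVars} → GTerm S C)
      (parent : Fin (G.rule v).body.length → V)
      (hparent : ∀ j, G.edge (parent j) v j)
      (hfact : ∀ j, NodeFact G B (parent j)
        (((G.rule v).body.get j).map ((G.rule v).skolemExt h))) :
      NodeFact G B v ((G.rule v).head.map ((G.rule v).skolemExt h))

/-- The result `G(B) = B ∪ ⋃ᵥ v(B)` of reasoning along `G`. -/
def eval (G : ExecutionGraph P V) (B : Inst S C) : Inst S C :=
  B ∪ {f | ∃ v, G.NodeFact B v f}

/-- `G` is a trigger graph for `(P, B)`: it answers all Boolean conjunctive queries correctly. -/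
def IsTriggerGraphFor (G : ExecutionGraph P V) (B : Inst S C) : Prop :=
  ∀ Q : BCQ S C, KBEntails P B Q ↔ Q.TrueIn (G.eval B)

end ExecutionGraph

section Classes

variable {S : Signature.{u}}

/-- FTG: there is a finite execution graph that is a trigger graph for every base instance. -/
def IsFTG (C : Type v) (P : Program S) : Prop :=
  ∃ (V : Type) (_ : Finite V) (G : ExecutionGraph P V),
    ∀ B : Inst S C, IsBaseInstance B → G.IsTriggerGraphFor B

/-- BDD (bounded): for some `k`, which does not depend on the base instance, the `k`-th round of the
chase entails the next one. -/
def IsBDD (C : Type v) (P : Program S) : Prop :=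
  ∃ k : ℕ, ∀ B : Inst S C, IsBaseInstance B → Entails (chaseStep P B k) (chaseStep P B (k + 1))

/-- TDB (term-depth bounded): for some `k`, which does not depend on the base instance, all terms in
the chase have depth at most `k`. -/
def IsTDB (C : Type v) (P : Program S) : Prop :=
  ∃ k : ℕ, ∀ B : Inst S C, IsBaseInstance B → ∀ i : ℕ, ∀ f ∈ chaseStep P B i, ∀ j,
    (f.args j).depth ≤ k

/-- FUS (first-order rewritable): each Boolean conjunctive query has a rewriting into a finite union
of Boolean conjunctive queries over the base instance. -/
def IsFUS (C : Type v) (P : Program S) : Prop :=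
  ∀ Q : BCQ S C, ∃ Q' : List (BCQ S C), ∀ B : Inst S C, IsBaseInstance B →
    (KBEntails P B Q ↔ ∃ q ∈ Q', q.TrueIn B)

end Classes

universe w

section Terms

variable {S : Signature.{u}} {C : Type v}

theorem PredAtom.map_map {T T' T'' : Type*} (f : T → T') (g : T' → T'') (A : PredAtom S T) :
    (A.map f).map g = A.map (g ∘ f) := rfl

theorem PredAtom.map_congr {T T' : Type*} {f g : T → T'} {A : PredAtom S T}
    (h : ∀ i, f (A.args i) = g (A.args i)) : A.map f = A.map g := by
  cases A
  simp only [PredAtom.map, PredAtom.mk.injEq, heq_eq_eq, true_and]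
  exact funext h

theorem PredAtom.map_eq_self {T : Type*} {f : T → T} {A : PredAtom S T}
    (h : ∀ i, f (A.args i) = A.args i) : A.map f = A :=
  PredAtom.map_congr (g := id) h

theorem Rule.mem_bodyVars {r : Rule S} {x : Var} :
    x ∈ r.bodyVars ↔ ∃ A ∈ r.body, ∃ i, A.args i = x := by
  unfold Rule.bodyVars
  induction r.body with
  | nil => simp
  | cons A l ih =>
    rw [List.foldr_cons, Finset.mem_union, ih]
    simp [PredAtom.vars]

/-- The head fact that the trigger `h` of the rule `r` creates. -/
def Rule.headFact (r : Rule S) (h : {x : Var // x ∈ r.bodyVars} → GTerm S C) : GroundFact S C :=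
  r.head.map (r.skolemExt h)

theorem Rule.headFact_map {T : Type*} {r : Rule S}
    {h : {x : Var // x ∈ r.bodyVars} → GTerm S C} (g : GTerm S C → T) :
    (r.headFact h).map g = r.head.map (fun x => g (r.skolemExt h x)) := rfl

theorem Rule.skolemExt_of_mem {r : Rule S} {h : {x : Var // x ∈ r.bodyVars} → GTerm S C} {x : Var}
    (hx : x ∈ r.bodyVars) : r.skolemExt h x = h ⟨x, hx⟩ := dif_pos hx

theorem Rule.skolemExt_of_notMem {r : Rule S} {h : {x : Var // x ∈ r.bodyVars} → GTerm S C}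
    {x : Var} (hx : x ∉ r.bodyVars) : r.skolemExt h x = GTerm.null r h x := dif_neg hx

/-- Two atoms over the body variables have the same image under maps that agree there. -/
theorem Rule.map_body_congr {T : Type*} {r : Rule S} {f g : Var → T}
    (h : ∀ x ∈ r.bodyVars, f x = g x) {A : PredAtom S Var} (hA : A ∈ r.body) :
    A.map f = A.map g :=
  PredAtom.map_congr fun i => h _ (Rule.mem_bodyVars.2 ⟨A, hA, i, rfl⟩)

/-- The terms that occur in an instance. -/
def terms (I : Inst S C) : Set (GTerm S C) := {y | ∃ f ∈ I, ∃ i, f.args i = y}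

theorem terms_mono {I J : Inst S C} (h : I ⊆ J) : terms I ⊆ terms J :=
  fun _ ⟨f, hf, i, hi⟩ => ⟨f, h hf, i, hi⟩

theorem terms_map {C' : Type*} {I : Inst S C} {J : Inst S C'} {g : GTerm S C → GTerm S C'}
    (h : ∀ f ∈ I, f.map g ∈ J) {y : GTerm S C} (hy : y ∈ terms I) : g y ∈ terms J := by
  obtain ⟨f, hf, i, rfl⟩ := hy
  exact ⟨f.map g, h f hf, i, rfl⟩

theorem terms_finite {I : Inst S C} (h : I.Finite) : (terms I).Finite := by
  have : terms I = ⋃ f ∈ I, Set.range f.args := by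
    ext y; simp [terms]
  rw [this]
  exact h.biUnion fun f _ => Set.finite_range _

/-- Recursion on ground terms. -/
def GTerm.fold {T : Type*} (fc : C → T)
    (fn : (r : Rule S) → ({x : Var // x ∈ r.bodyVars} → GTerm S C) →
      ({x : Var // x ∈ r.bodyVars} → T) → Var → T) : GTerm S C → T
  | .const c => fc c
  | .null r h z => fn r h (fun x => (h x).fold fc fn) z

/-- Rename the constants of a term. -/
def GTerm.mapC {C' : Type*} (e : C → C') : GTerm S C → GTerm S C'
  | .const c => .const (e c)
  | .null r h z => .null r (fun x => (h x).mapC e) z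

theorem GTerm.mapC_mapC {C' C'' : Type*} (e : C → C') (e' : C' → C'') (y : GTerm S C) :
    (y.mapC e).mapC e' = y.mapC (e' ∘ e) := by
  induction y with
  | const c => rfl
  | null r h z ih => simp only [GTerm.mapC, ih]

theorem GTerm.mapC_id (y : GTerm S C) : y.mapC id = y := by
  induction y with
  | const c => rfl
  | null r h z ih => simp only [GTerm.mapC, ih]

theorem GTerm.depth_mapC {C' : Type*} (e : C → C') (y : GTerm S C) :
    (y.mapC e).depth = y.depth := by
  induction y with
  | const c => rfl
  | null r h z ih => simp only [GTerm.mapC, GTerm.depth, ih]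

theorem GTerm.depth_pos (y : GTerm S C) : 1 ≤ y.depth := by
  cases y <;> simp [GTerm.depth]

theorem GTerm.depth_lt_null {r : Rule S} (h : {x : Var // x ∈ r.bodyVars} → GTerm S C) (z : Var)
    (x : {x : Var // x ∈ r.bodyVars}) : (h x).depth < (GTerm.null r h z).depth := by
  rw [GTerm.depth]
  exact Nat.lt_succ_of_le (Finset.le_sup (f := fun x => (h x).depth) (Finset.mem_univ x))

theorem Rule.mapC_skolemExt {C' : Type*} (e : C → C') (r : Rule S)
    (h : {x : Var // x ∈ r.bodyVars} → GTerm S C) (x : Var) :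
    (r.skolemExt h x).mapC e = r.skolemExt (fun x => (h x).mapC e) x := by
  by_cases hx : x ∈ r.bodyVars
  · simp [Rule.skolemExt_of_mem hx]
  · simp [Rule.skolemExt_of_notMem hx, GTerm.mapC]

/-- A term mapping that fixes the constants. -/
def FixesConst (g : GTerm S C → GTerm S C) : Prop := ∀ c : C, g (.const c) = .const c

theorem FixesConst.comp {g g' : GTerm S C → GTerm S C} (h : FixesConst g) (h' : FixesConst g') :
    FixesConst (g ∘ g') := fun c => by simp [h' c, h c]

theorem FixesConst.id : FixesConst (id : GTerm S C → GTerm S C) := fun _ => rfl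

end Terms

section Oblivious

variable {S : Signature.{u}} {C : Type v}

/-- The instance after `t` rounds of the chase that never stops. -/
def ob (P : Program S) (B : Inst S C) : ℕ → Inst S C
  | 0 => B
  | t + 1 => chaseRound P (ob P B t)

/-- The union of the rounds of the chase that never stops. -/
def obLim (P : Program S) (B : Inst S C) : Inst S C := {f | ∃ t, f ∈ ob P B t}

variable {P : Program S} {B : Inst S C}

theorem Rule.IsTrigger.mono {r : Rule S} {h : {x : Var // x ∈ r.bodyVars} → GTerm S C}
    {I J : Inst S C} (hIJ : I ⊆ J) (ht : r.IsTrigger h I) : r.IsTrigger h J :=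
  fun A hA => hIJ (ht A hA)

theorem ob_subset_succ (t : ℕ) : ob P B t ⊆ ob P B (t + 1) := Set.subset_union_left

theorem ob_mono {t t' : ℕ} (h : t ≤ t') : ob P B t ⊆ ob P B t' :=
  monotone_nat_of_le_succ (f := ob P B) ob_subset_succ h

theorem ob_subset_obLim (t : ℕ) : ob P B t ⊆ obLim P B := fun _ h => ⟨t, h⟩

theorem base_subset_obLim : B ⊆ obLim P B := ob_subset_obLim 0

theorem mem_ob_succ {t : ℕ} {f : GroundFact S C} :
    f ∈ ob P B (t + 1) ↔ f ∈ ob P B t ∨ ∃ r ∈ P, ∃ h : {x : Var // x ∈ r.bodyVars} → GTerm S C,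
      r.IsTrigger h (ob P B t) ∧ f = r.headFact h := Iff.rfl

theorem headFact_mem_ob {t : ℕ} {r : Rule S} (hr : r ∈ P)
    {h : {x : Var // x ∈ r.bodyVars} → GTerm S C} (ht : r.IsTrigger h (ob P B t)) :
    r.headFact h ∈ ob P B (t + 1) := mem_ob_succ.2 (Or.inr ⟨r, hr, h, ht, rfl⟩)

/-- A fact is a fact of the base instance or created by a trigger in an earlier round. -/
theorem mem_ob_cases {t : ℕ} {f : GroundFact S C} (hf : f ∈ ob P B t) :
    f ∈ B ∨ ∃ t' < t, ∃ r ∈ P, ∃ h : {x : Var // x ∈ r.bodyVars} → GTerm S C,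
      r.IsTrigger h (ob P B t') ∧ f = r.headFact h := by
  induction t with
  | zero => exact Or.inl hf
  | succ t ih =>
    rcases mem_ob_succ.1 hf with hf | hf
    · rcases ih hf with h | ⟨t', ht', h⟩
      · exact Or.inl h
      · exact Or.inr ⟨t', by omega, h⟩
    · exact Or.inr ⟨t, by omega, hf⟩

/-- Finitely many facts of the limit occur in a common round. -/
theorem exists_ob_of_forall_obLim {ι : Type*} {s : Set ι} (hs : s.Finite) {F : ι → GroundFact S C}
    (h : ∀ i ∈ s, F i ∈ obLim P B) : ∃ t, ∀ i ∈ s, F i ∈ ob P B t := by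
  induction s, hs using Set.Finite.induction_on with
  | empty => exact ⟨0, by simp⟩
  | @insert a s _ _ ih =>
    obtain ⟨t, ht⟩ := ih fun i hi => h i (Set.mem_insert_of_mem _ hi)
    obtain ⟨t', ht'⟩ := h a (Set.mem_insert _ _)
    refine ⟨max t t', fun i hi => ?_⟩
    rcases hi with rfl | hi
    · exact ob_mono (le_max_right _ _) ht'
    · exact ob_mono (le_max_left _ _) (ht i hi)

theorem headFact_mem_obLim {r : Rule S} (hr : r ∈ P)
    {h : {x : Var // x ∈ r.bodyVars} → GTerm S C} (ht : r.IsTrigger h (obLim P B)) :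
    r.headFact h ∈ obLim P B := by
  obtain ⟨t, h'⟩ := _root_.exists_ob_of_forall_obLim (s := {A | A ∈ r.body})
    (F := fun A => A.map (r.skolemExt h)) r.body.finite_toSet ht
  exact ⟨t + 1, headFact_mem_ob hr h'⟩

theorem obLim_cases {f : GroundFact S C} (hf : f ∈ obLim P B) :
    f ∈ B ∨ ∃ r ∈ P, ∃ h : {x : Var // x ∈ r.bodyVars} → GTerm S C,
      r.IsTrigger h (obLim P B) ∧ f = r.headFact h := by
  obtain ⟨t, hf⟩ := hf
  rcases mem_ob_cases hf with h | ⟨t', _, r, hr, h, hh, e⟩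
  · exact Or.inl h
  · exact Or.inr ⟨r, hr, h, hh.mono (ob_subset_obLim _), e⟩

theorem Rule.IsTrigger.mem_terms {r : Rule S} {h : {x : Var // x ∈ r.bodyVars} → GTerm S C}
    {I : Inst S C} (ht : r.IsTrigger h I) (x : {x : Var // x ∈ r.bodyVars}) : h x ∈ terms I := by
  obtain ⟨A, hA, i, hi⟩ := Rule.mem_bodyVars.1 x.2
  refine ⟨_, ht A hA, i, ?_⟩
  change r.skolemExt h (A.args i) = _
  rw [hi, Rule.skolemExt_of_mem x.2]

/-- A null of the chase was created, together with its head fact, by a trigger in an earlier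
round. -/
theorem null_mem_terms_ob (hB : IsBaseInstance B) {t : ℕ} {r : Rule S}
    {h : {x : Var // x ∈ r.bodyVars} → GTerm S C} {z : Var}
    (hy : GTerm.null r h z ∈ terms (ob P B t)) :
    r ∈ P ∧ z ∉ r.bodyVars ∧ (∃ i, r.head.args i = z) ∧ ∃ t' < t, r.IsTrigger h (ob P B t') := by
  induction t with
  | zero =>
    obtain ⟨f, hf, i, hi⟩ := hy
    obtain ⟨c, hc⟩ := (hB.2 f hf).2 i
    rw [hc] at hi
    cases hi
  | succ t ih =>
    have key : GTerm.null r h z ∈ terms (ob P B t) →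
      r ∈ P ∧ z ∉ r.bodyVars ∧ (∃ i, r.head.args i = z) ∧
        ∃ t' < t + 1, r.IsTrigger h (ob P B t') := fun hy => by
      obtain ⟨h1, h2, h3, t', ht', h4⟩ := ih hy
      exact ⟨h1, h2, h3, t', by omega, h4⟩
    obtain ⟨f, hf, i, hi⟩ := hy
    rcases mem_ob_succ.1 hf with hf | ⟨r', hr', h', ht, rfl⟩
    · exact key ⟨f, hf, i, hi⟩
    · change r'.skolemExt h' (r'.head.args i) = _ at hi
      by_cases hx : r'.head.args i ∈ r'.bodyVars
      · rw [Rule.skolemExt_of_mem hx] at hi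
        exact key (hi ▸ ht.mem_terms _)
      · rw [Rule.skolemExt_of_notMem hx] at hi
        cases hi
        exact ⟨hr', hx, ⟨i, rfl⟩, t, by omega, ht⟩

theorem null_mem_terms_obLim (hB : IsBaseInstance B) {r : Rule S}
    {h : {x : Var // x ∈ r.bodyVars} → GTerm S C} {z : Var}
    (hy : GTerm.null r h z ∈ terms (obLim P B)) :
    r ∈ P ∧ z ∉ r.bodyVars ∧ (∃ i, r.head.args i = z) ∧ r.IsTrigger h (obLim P B) := by
  obtain ⟨f, ⟨t, hf⟩, i, hi⟩ := hy
  obtain ⟨h1, h2, h3, t', _, h4⟩ := null_mem_terms_ob hB (t := t) ⟨f, hf, i, hi⟩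
  exact ⟨h1, h2, h3, h4.mono (ob_subset_obLim _)⟩

theorem ob_pred (hB : IsBaseInstance B) {t : ℕ} {f : GroundFact S C} (hf : f ∈ ob P B t) :
    f ∈ B ∧ f.pred ∈ S.extensional ∨ f.pred ∈ S.intensional ∧ ∃ r ∈ P, r.head.pred = f.pred := by
  rcases mem_ob_cases hf with h | ⟨t', _, r, hr, h, _, rfl⟩
  · exact Or.inl ⟨h, (hB.2 f h).1⟩
  · exact Or.inr ⟨r.head_intensional, r, hr, rfl⟩

theorem extensional_mem_base (hB : IsBaseInstance B) {t : ℕ} {f : GroundFact S C}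
    (hf : f ∈ ob P B t) (hp : f.pred ∈ S.extensional) : f ∈ B := by
  rcases ob_pred hB hf with h | h
  · exact h.1
  · exact absurd hp fun hp => Set.disjoint_left.1 S.disjoint hp h.1

theorem chaseRound_mono {I J : Inst S C} (h : I ⊆ J) : chaseRound P I ⊆ chaseRound P J := by
  rintro f (hf | ⟨r, hr, t, ht, e⟩)
  · exact Or.inl (h hf)
  · exact Or.inr ⟨r, hr, t, ht.mono h, e⟩

theorem ob_mono_base {B' : Inst S C} (h : B ⊆ B') (t : ℕ) : ob P B t ⊆ ob P B' t := by
  induction t with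
  | zero => exact h
  | succ t ih => exact chaseRound_mono ih

theorem ob_finite (hB : B.Finite) (t : ℕ) : (ob P B t).Finite := by
  induction t with
  | zero => exact hB
  | succ t ih =>
    refine ih.union ?_
    have hfin : (⋃ r ∈ P, (fun h : {x : Var // x ∈ r.bodyVars} → GTerm S C => r.headFact h) ''
        {h | ∀ x, h x ∈ terms (ob P B t)}).Finite :=
      P.finite_toSet.biUnion fun r _ => (Set.Finite.pi' fun _ => terms_finite ih).image _
    refine hfin.subset ?_
    rintro f ⟨r, hr, h, ht, rfl⟩
    simp only [Set.mem_iUnion]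
    exact ⟨r, hr, h, fun x => ht.mem_terms x, rfl⟩

theorem headFact_mapC {C' : Type*} (e : C → C') (r : Rule S)
    (h : {x : Var // x ∈ r.bodyVars} → GTerm S C) :
    (r.headFact h).map (GTerm.mapC e) = r.headFact (fun x => (h x).mapC e) := by
  rw [Rule.headFact_map]
  exact PredAtom.map_congr fun i => Rule.mapC_skolemExt e r h (r.head.args i)

/-- Renaming constants maps the chase into the chase. -/
theorem ob_mapC {C' : Type*} (e : C → C') {B' : Inst S C'}
    (h : ∀ f ∈ B, f.map (GTerm.mapC e) ∈ B') {t : ℕ} {f : GroundFact S C} (hf : f ∈ ob P B t) :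
    f.map (GTerm.mapC e) ∈ ob P B' t := by
  induction t generalizing f with
  | zero => exact h f hf
  | succ t ih =>
    rcases mem_ob_succ.1 hf with hf | ⟨r, hr, h', ht, rfl⟩
    · exact ob_subset_succ t (ih hf)
    · rw [headFact_mapC]
      refine headFact_mem_ob hr fun A hA => ?_
      have := ih (ht A hA)
      rw [PredAtom.map_map] at this
      convert this using 1
      exact PredAtom.map_congr fun i => (Rule.mapC_skolemExt e r h' (A.args i)).symm

theorem obLim_mapC {C' : Type*} (e : C → C') {B' : Inst S C'}
    (h : ∀ f ∈ B, f.map (GTerm.mapC e) ∈ B') {f : GroundFact S C} (hf : f ∈ obLim P B) :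
    f.map (GTerm.mapC e) ∈ obLim P B' := by
  obtain ⟨t, ht⟩ := hf
  exact ⟨t, ob_mapC e h ht⟩

theorem depth_ob (hB : IsBaseInstance B) {t : ℕ} {y : GTerm S C} (hy : y ∈ terms (ob P B t)) :
    y.depth ≤ t + 1 := by
  induction y generalizing t with
  | const c => simp [GTerm.depth]
  | null r h z ih =>
    obtain ⟨_, _, _, t', ht', htr⟩ := null_mem_terms_ob hB hy
    have : Finset.univ.sup (fun x => (h x).depth) ≤ t' + 1 :=
      Finset.sup_le fun x _ => ih x (htr.mem_terms x)
    rw [GTerm.depth]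
    omega

/-- The limit of the chase maps into each model. -/
theorem exists_hom_of_isModel (hB : IsBaseInstance B) {M : Inst S C} (hM : IsModel P B M) :
    ∃ μ : GTerm S C → GTerm S C, FixesConst μ ∧ ∀ f ∈ obLim P B, f.map μ ∈ M := by
  classical
  let μ : GTerm S C → GTerm S C := GTerm.fold GTerm.const fun r h h' z =>
    if H : ∃ σ : Var → GTerm S C, (∀ x : {x : Var // x ∈ r.bodyVars}, σ x = h' x) ∧
      r.head.map σ ∈ M then H.choose z else .null r h z
  refine ⟨μ, fun c => rfl, ?_⟩
  rintro f ⟨t, hf⟩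
  induction t generalizing f with
  | zero =>
    have : f.map μ = f := PredAtom.map_eq_self fun i => by
      obtain ⟨c, hc⟩ := (hB.2 f hf).2 i
      rw [hc]; rfl
    rw [this]; exact hM.1 hf
  | succ t ih =>
    rcases mem_ob_succ.1 hf with hf | ⟨r, hr, h, ht, rfl⟩
    · exact ih f hf
    · have H : ∃ σ : Var → GTerm S C, (∀ x : {x : Var // x ∈ r.bodyVars}, σ x = μ (h x)) ∧
          r.head.map σ ∈ M := by
        obtain ⟨σ, h1, h2⟩ := hM.2 r hr (μ ∘ r.skolemExt h) fun A hA => ih _ (ht A hA)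
        exact ⟨σ, fun x => by rw [h1 x x.2, Function.comp, Rule.skolemExt_of_mem x.2], h2⟩
      have hμ : ∀ z, μ (.null r h z) = H.choose z := fun z => by
        simp only [μ, GTerm.fold]
        exact dif_pos H
      have : (r.headFact h).map μ = r.head.map H.choose := by
        rw [Rule.headFact_map]
        refine PredAtom.map_congr fun i => ?_
        by_cases hx : r.head.args i ∈ r.bodyVars
        · rw [Rule.skolemExt_of_mem hx]
          exact (H.choose_spec.1 ⟨_, hx⟩).symm
        · rw [Rule.skolemExt_of_notMem hx, hμ]
      rw [this]; exact H.choose_spec.2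

theorem obLim_isModel : IsModel P B (obLim P B) := by
  refine ⟨base_subset_obLim, fun r hr σ hσ => ?_⟩
  let h : {x : Var // x ∈ r.bodyVars} → GTerm S C := fun x => σ x
  have hs : ∀ x ∈ r.bodyVars, r.skolemExt h x = σ x := fun x hx => Rule.skolemExt_of_mem hx
  refine ⟨r.skolemExt h, hs, headFact_mem_obLim hr fun A hA => ?_⟩
  rw [Rule.map_body_congr hs hA]
  exact hσ A hA

end Oblivious

section Subterms

variable {S : Signature.{u}} {C : Type v}

/-- The subterms of a term, with the term itself first. -/
noncomputable def GTerm.subterms : GTerm S C → List (GTerm S C)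
  | .const c => [.const c]
  | .null r h z => .null r h z :: Finset.univ.toList.flatMap fun x => (h x).subterms

theorem GTerm.self_mem_subterms (y : GTerm S C) : y ∈ y.subterms := by
  cases y <;> simp [GTerm.subterms]

theorem GTerm.mem_subterms_const {c : C} {u : GTerm S C} :
    u ∈ (GTerm.const c : GTerm S C).subterms ↔ u = .const c := by
  simp [GTerm.subterms]

theorem GTerm.mem_subterms_null {r : Rule S} {h : {x : Var // x ∈ r.bodyVars} → GTerm S C}
    {z : Var} {u : GTerm S C} :
    u ∈ (GTerm.null r h z).subterms ↔ u = .null r h z ∨ ∃ x, u ∈ (h x).subterms := by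
  simp [GTerm.subterms]

theorem GTerm.subterms_trans {u w y : GTerm S C} (h : u ∈ w.subterms) (h' : w ∈ y.subterms) :
    u ∈ y.subterms := by
  induction y with
  | const c => rw [GTerm.mem_subterms_const] at h'; subst h'; exact h
  | null r g z ih =>
    rcases GTerm.mem_subterms_null.1 h' with rfl | ⟨x, hx⟩
    · exact h
    · exact GTerm.mem_subterms_null.2 (Or.inr ⟨x, ih x hx⟩)

theorem GTerm.depth_le_of_mem_subterms {u y : GTerm S C} (h : u ∈ y.subterms) :
    u.depth ≤ y.depth := by
  induction y with
  | const c => rw [GTerm.mem_subterms_const] at h; rw [h]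
  | null r g z ih =>
    rcases GTerm.mem_subterms_null.1 h with rfl | ⟨x, hx⟩
    · exact le_rfl
    · exact (ih x hx).trans (GTerm.depth_lt_null g z x).le

/-- A parent of a subterm is a subterm. -/
theorem GTerm.parent_mem_subterms {r : Rule S} {h : {x : Var // x ∈ r.bodyVars} → GTerm S C}
    {z : Var} {y : GTerm S C} (hy : GTerm.null r h z ∈ y.subterms)
    (x : {x : Var // x ∈ r.bodyVars}) : h x ∈ y.subterms :=
  GTerm.subterms_trans (GTerm.mem_subterms_null.2 (Or.inr ⟨x, GTerm.self_mem_subterms _⟩)) hy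

/-- The constants that occur in a term. -/
noncomputable def GTerm.consts (y : GTerm S C) : List C :=
  y.subterms.filterMap fun u => match u with
    | .const c => some c
    | .null _ _ _ => none

theorem GTerm.mem_consts {y : GTerm S C} {c : C} : c ∈ y.consts ↔ .const c ∈ y.subterms := by
  unfold GTerm.consts
  rw [List.mem_filterMap]
  constructor
  · rintro ⟨u, hu, e⟩
    cases u with
    | const c' => cases e; exact hu
    | null r h z => cases e
  · intro h
    exact ⟨_, h, rfl⟩

/-- The facts that create the nulls among the subterms of a term. -/
noncomputable def GTerm.creation (y : GTerm S C) : List (GroundFact S C) :=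
  y.subterms.filterMap fun u => match u with
    | .const _ => none
    | .null r h _ => some (r.headFact h)

theorem GTerm.headFact_mem_creation {r : Rule S} {h : {x : Var // x ∈ r.bodyVars} → GTerm S C}
    {z : Var} {y : GTerm S C} (hy : GTerm.null r h z ∈ y.subterms) :
    r.headFact h ∈ y.creation :=
  List.mem_filterMap.2 ⟨_, hy, rfl⟩

theorem GTerm.mem_creation {y : GTerm S C} {f : GroundFact S C} (hf : f ∈ y.creation) :
    ∃ r h z, GTerm.null r h z ∈ y.subterms ∧ f = r.headFact h := by
  obtain ⟨u, hu, e⟩ := List.mem_filterMap.1 hf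
  cases u with
  | const c => cases e
  | null r h z => cases e; exact ⟨r, h, z, hu, rfl⟩

theorem List.length_flatMap_le {α β : Type*} (l : List α) (g : α → List β) (b : ℕ)
    (h : ∀ a ∈ l, (g a).length ≤ b) : (l.flatMap g).length ≤ l.length * b := by
  induction l with
  | nil => simp
  | cons a l ih =>
    rw [List.flatMap_cons, List.length_append, List.length_cons, Nat.add_mul, Nat.one_mul]
    have := ih fun x hx => h x (List.mem_cons_of_mem _ hx)
    have := h a List.mem_cons_self
    omega

/-- A bound for the number of subterms of the terms of depth at most `k` in the chase. -/
def sizeBound (P : Program S) (k : ℕ) : ℕ := (P.sup (fun r => r.bodyVars.card) + 1) ^ k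

variable {P : Program S} {B : Inst S C}

theorem subterm_mem_terms (hB : IsBaseInstance B) {u y : GTerm S C}
    (hy : y ∈ terms (obLim P B)) (hu : u ∈ y.subterms) : u ∈ terms (obLim P B) := by
  induction y with
  | const c => rw [GTerm.mem_subterms_const] at hu; rwa [hu]
  | null r h z ih =>
    rcases GTerm.mem_subterms_null.1 hu with rfl | ⟨x, hx⟩
    · exact hy
    · exact ih x ((null_mem_terms_obLim hB hy).2.2.2.mem_terms x) hx

theorem creation_subset (hB : IsBaseInstance B) {y : GTerm S C} (hy : y ∈ terms (obLim P B))
    {f : GroundFact S C} (hf : f ∈ y.creation) : f ∈ obLim P B := by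
  obtain ⟨r, h, z, hu, rfl⟩ := GTerm.mem_creation hf
  obtain ⟨h1, _, _, h2⟩ := null_mem_terms_obLim hB (subterm_mem_terms hB hy hu)
  exact headFact_mem_obLim h1 h2

theorem length_subterms_le (hB : IsBaseInstance B) {y : GTerm S C} (hy : y ∈ terms (obLim P B))
    {k : ℕ} (hk : y.depth ≤ k) : y.subterms.length ≤ sizeBound P k := by
  induction y generalizing k with
  | const c =>
    simp only [GTerm.subterms, List.length_singleton]
    exact Nat.one_le_pow _ _ (Nat.succ_pos _)
  | null r h z ih =>
    obtain ⟨hr, _, _, ht⟩ := null_mem_terms_obLim hB hy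
    obtain ⟨k, rfl⟩ : ∃ k', k = k' + 1 := ⟨k - 1, by have := (GTerm.null r h z).depth_pos; omega⟩
    have h1 := List.length_flatMap_le (Finset.univ : Finset {x // x ∈ r.bodyVars}).toList
      (fun x => (h x).subterms) (sizeBound P k) fun x _ =>
        ih x (ht.mem_terms x) (by have := GTerm.depth_lt_null h z x; omega)
    have h2 : r.bodyVars.card ≤ P.sup (fun r => r.bodyVars.card) :=
      Finset.le_sup (f := fun r : Rule S => r.bodyVars.card) hr
    have h3 : 1 ≤ sizeBound P k := Nat.one_le_pow _ _ (Nat.succ_pos _)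
    simp only [GTerm.subterms, List.length_cons]
    simp only [Finset.length_toList, Finset.card_univ, Fintype.card_coe] at h1
    calc _ ≤ r.bodyVars.card * sizeBound P k + 1 := Nat.succ_le_succ h1
      _ ≤ P.sup (fun r => r.bodyVars.card) * sizeBound P k + sizeBound P k :=
        Nat.add_le_add (Nat.mul_le_mul_right _ h2) h3
      _ = sizeBound P (k + 1) := by rw [sizeBound, sizeBound]; ring

theorem length_creation_le (hB : IsBaseInstance B) {y : GTerm S C} (hy : y ∈ terms (obLim P B))
    {k : ℕ} (hk : y.depth ≤ k) : y.creation.length ≤ sizeBound P k :=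
  (List.length_filterMap_le _ _).trans (length_subterms_le hB hy hk)

theorem length_consts_le (hB : IsBaseInstance B) {y : GTerm S C} (hy : y ∈ terms (obLim P B))
    {k : ℕ} (hk : y.depth ≤ k) : y.consts.length ≤ sizeBound P k :=
  (List.length_filterMap_le _ _).trans (length_subterms_le hB hy hk)

theorem GTerm.mapC_congr {C' : Type*} {e e' : C → C'} {y : GTerm S C}
    (h : ∀ c ∈ y.consts, e c = e' c) : y.mapC e = y.mapC e' := by
  induction y with
  | const c => rw [GTerm.mapC, GTerm.mapC, h c (GTerm.mem_consts.2 (GTerm.self_mem_subterms _))]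
  | null r g z ih =>
    simp only [GTerm.mapC, GTerm.null.injEq, heq_eq_eq, true_and, and_true]
    funext x
    exact ih x fun c hc => h c (GTerm.mem_consts.2
      (GTerm.mem_subterms_null.2 (Or.inr ⟨x, GTerm.mem_consts.1 hc⟩)))

end Subterms

section Endomorphisms

variable {S : Signature.{u}} {C : Type v}

/-- A term mapping that fixes the constants and maps the limit of the chase into itself. -/
def IsEndo (P : Program S) (B : Inst S C) (g : GTerm S C → GTerm S C) : Prop :=
  FixesConst g ∧ ∀ f ∈ obLim P B, f.map g ∈ obLim P B

/-- A term mapping that fixes the constants and maps each round of the chase into the round that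
comes `K` rounds later. -/
def IsShift (P : Program S) (B : Inst S C) (K : ℕ) (g : GTerm S C → GTerm S C) : Prop :=
  FixesConst g ∧ ∀ t, ∀ f ∈ ob P B t, f.map g ∈ ob P B (t + K)

variable {P : Program S} {B : Inst S C}

theorem IsShift.isEndo {K : ℕ} {g : GTerm S C → GTerm S C} (h : IsShift P B K g) :
    IsEndo P B g :=
  ⟨h.1, fun f ⟨t, hf⟩ => ⟨_, h.2 t f hf⟩⟩

theorem IsEndo.id : IsEndo P B id := ⟨FixesConst.id, fun _ h => h⟩

theorem IsEndo.comp {g g' : GTerm S C → GTerm S C} (h : IsEndo P B g) (h' : IsEndo P B g') :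
    IsEndo P B (g ∘ g') :=
  ⟨h.1.comp h'.1, fun f hf => h.2 _ (h'.2 f hf)⟩

theorem IsEndo.iterate {g : GTerm S C → GTerm S C} (h : IsEndo P B g) (n : ℕ) :
    IsEndo P B g^[n] := by
  induction n with
  | zero => exact IsEndo.id
  | succ n ih => rw [Function.iterate_succ]; exact ih.comp h

theorem IsEndo.mem_terms {g : GTerm S C → GTerm S C} (h : IsEndo P B g) {y : GTerm S C}
    (hy : y ∈ terms (obLim P B)) : g y ∈ terms (obLim P B) :=
  terms_map h.2 hy

/-- A term mapping on a set `W` of terms of the chase that is closed under parents extends to the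
whole chase if it can be realized on each block of nulls that meets `W`. -/
theorem exists_isShift_extension (hB : IsBaseInstance B) {W : Set (GTerm S C)} {K : ℕ}
    {τ : GTerm S C → GTerm S C} (hτ : FixesConst τ)
    (hWX : ∀ r h z, GTerm.null r h z ∈ W → GTerm.null r h z ∈ terms (obLim P B))
    (hWp : ∀ r h z x, GTerm.null r h z ∈ W → h x ∈ W)
    (hσ : ∀ r h z, GTerm.null r h z ∈ W → ∃ σ : GTerm S C → GTerm S C, FixesConst σ ∧
      (∀ w ∈ W, (∃ i, (Rule.headFact r h).args i = w) → σ w = τ w) ∧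
      (r.headFact h).map σ ∈ ob P B K) :
    ∃ g, IsShift P B K g ∧ (∀ w ∈ W, g w = τ w) ∧
      ∀ r h z, (∀ z', GTerm.null r h z' ∉ W) → g (.null r h z) = .null r (fun x => g (h x)) z := by
  classical
  have hσ' : ∀ r h, ∃ σ : GTerm S C → GTerm S C, (∃ z, GTerm.null r h z ∈ W) →
      FixesConst σ ∧ (∀ w ∈ W, (∃ i, (Rule.headFact r h).args i = w) → σ w = τ w) ∧
      (r.headFact h).map σ ∈ ob P B K := fun r h => by
    by_cases hz : ∃ z, GTerm.null r h z ∈ W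
    · obtain ⟨z, hz⟩ := hz
      obtain ⟨σ, hσ⟩ := hσ r h z hz
      exact ⟨σ, fun _ => hσ⟩
    · exact ⟨id, fun h => absurd h hz⟩
  choose σ hσ using hσ'
  let g : GTerm S C → GTerm S C := GTerm.fold GTerm.const fun r h h' z =>
    if ∃ z, GTerm.null r h z ∈ W then σ r h (.null r h z) else .null r h' z
  have hg1 : ∀ r h z, (∃ z, GTerm.null r h z ∈ W) → g (.null r h z) = σ r h (.null r h z) :=
    fun r h z hz => by simp only [g, GTerm.fold]; exact if_pos hz
  have hg2 : ∀ r h z, (¬ ∃ z, GTerm.null r h z ∈ W) →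
      g (.null r h z) = .null r (fun x => g (h x)) z :=
    fun r h z hz => by simp only [g, GTerm.fold]; exact if_neg hz
  have hgW : ∀ w ∈ W, g w = τ w := by
    intro w hw
    cases w with
    | const c => exact (hτ c).symm
    | null r h z =>
      rw [hg1 r h z ⟨z, hw⟩]
      obtain ⟨_, hz, ⟨i, hi⟩, _⟩ := null_mem_terms_obLim hB (hWX r h z hw)
      refine (hσ r h ⟨z, hw⟩).2.1 _ hw ⟨i, ?_⟩
      change r.skolemExt h (r.head.args i) = _
      rw [hi, Rule.skolemExt_of_notMem hz]
  refine ⟨g, ⟨fun c => rfl, fun t => ?_⟩, hgW, fun r h z hz => hg2 r h z (by simpa using hz)⟩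
  induction t with
  | zero =>
    intro f hf
    have : f.map g = f := PredAtom.map_eq_self fun i => by
      obtain ⟨c, hc⟩ := (hB.2 f hf).2 i
      rw [hc]; rfl
    rw [this]
    exact ob_mono (Nat.zero_le _) hf
  | succ t ih =>
    intro f hf
    rcases mem_ob_succ.1 hf with hf | ⟨r, hr, h, ht, rfl⟩
    · exact ob_mono (by omega) (ih f hf)
    · by_cases hz : ∃ z, GTerm.null r h z ∈ W
      · have : (r.headFact h).map g = (r.headFact h).map (σ r h) := PredAtom.map_congr fun i => by
          change g (r.skolemExt h (r.head.args i)) = σ r h (r.skolemExt h (r.head.args i))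
          by_cases hx : r.head.args i ∈ r.bodyVars
          · rw [Rule.skolemExt_of_mem hx]
            obtain ⟨z, hz'⟩ := hz
            have hxW := hWp r h z ⟨_, hx⟩ hz'
            rw [hgW _ hxW]
            refine ((hσ r h ⟨z, hz'⟩).2.1 _ hxW ⟨i, ?_⟩).symm
            exact Rule.skolemExt_of_mem hx
          · rw [Rule.skolemExt_of_notMem hx, hg1 r h _ hz]
        rw [this]
        exact ob_mono (by omega) (hσ r h hz).2.2
      · have hs : ∀ x, g (r.skolemExt h x) = r.skolemExt (fun x => g (h x)) x := fun x => by
          by_cases hx : x ∈ r.bodyVars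
          · rw [Rule.skolemExt_of_mem hx, Rule.skolemExt_of_mem hx]
          · rw [Rule.skolemExt_of_notMem hx, Rule.skolemExt_of_notMem hx, hg2 r h x hz]
        have : (r.headFact h).map g = r.headFact fun x => g (h x) := by
          rw [Rule.headFact_map]
          exact PredAtom.map_congr fun i => hs _
        rw [this, Nat.add_right_comm]
        refine headFact_mem_ob hr fun A hA => ?_
        have := ih _ (ht A hA)
        rw [PredAtom.map_map] at this
        convert this using 1
        exact PredAtom.map_congr fun i => (hs _).symm

end Endomorphisms

section Iterate

/-- Some positive iterate of a self-map of a finite set is idempotent. -/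
theorem exists_iterate_idempotent {α : Type*} {A : Set α} (hA : A.Finite) {f : α → α}
    (hf : Set.MapsTo f A A) : ∃ N, 1 ≤ N ∧ ∀ x ∈ A, f^[N] (f^[N] x) = f^[N] x := by
  have : Finite A := hA
  let F : ℕ → A → A := fun n x => ⟨f^[n] x, hf.iterate n x.2⟩
  obtain ⟨a, b, hab, hF⟩ := Finite.exists_ne_map_eq_of_infinite F
  wlog hlt : a < b generalizing a b
  · exact this b a hab.symm hF.symm (by omega)
  obtain ⟨p, rfl⟩ := Nat.exists_eq_add_of_lt hlt
  have h1 : ∀ m, ∀ x ∈ A, f^[a + m + (p + 1)] x = f^[a + m] x := by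
    intro m x hx
    have := congrArg Subtype.val (congrFun hF ⟨x, hx⟩)
    change f^[a] x = f^[a + p + 1] x at this
    rw [show a + m + (p + 1) = m + (a + p + 1) by omega, Function.iterate_add_apply, ← this,
      ← Function.iterate_add_apply, Nat.add_comm]
  have h2 : ∀ j m, ∀ x ∈ A, f^[a + m + (p + 1) * j] x = f^[a + m] x := by
    intro j
    induction j with
    | zero => intro m x _; simp
    | succ j ih =>
      intro m x hx
      rw [show a + m + (p + 1) * (j + 1) = a + (m + (p + 1) * j) + (p + 1) by ring, h1 _ x hx,
        ← Nat.add_assoc, ih m x hx]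
  refine ⟨(p + 1) * (a + 1), Nat.mul_pos (Nat.succ_pos _) (Nat.succ_pos _), fun x hx => ?_⟩
  rw [← Function.iterate_add_apply]
  have := h2 (a + 1) (p * a + p + 1) x hx
  rwa [show a + (p * a + p + 1) = (p + 1) * (a + 1) by ring] at this

/-- A map that is injective on a finite set, which it maps into itself, has a positive iterate that
is the identity there. -/
theorem exists_iterate_eq_id {α : Type*} {A : Set α} (hA : A.Finite) {f : α → α}
    (hf : Set.MapsTo f A A) (hinj : Set.InjOn f A) : ∃ N, ∀ x ∈ A, f^[N] (f x) = x := by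
  obtain ⟨N, hN, h⟩ := exists_iterate_idempotent hA hf
  obtain ⟨n, rfl⟩ : ∃ n, N = n + 1 := ⟨N - 1, by omega⟩
  refine ⟨n, fun x hx => ?_⟩
  have hi : Set.InjOn f^[n + 1] A := hinj.iterate hf _
  have := hi (hf.iterate _ hx) hx (h x hx)
  rwa [Function.iterate_succ_apply] at this

end Iterate

section Stopping

theorem PredAtom.exists_args_eq {S : Signature.{u}} {T : Type*} {a b : PredAtom S T} (h : a = b)
    (j : Fin (S.arity a.pred)) : ∃ j', a.args j = b.args j' := by
  subst h; exact ⟨j, rfl⟩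

variable {S : Signature.{u}} {C : Type v} {P : Program S} {B : Inst S C}

theorem Entails.refl (I : Inst S C) : Entails I I := ⟨id, fun _ => rfl, fun _ h => h⟩

theorem Entails.of_subset {I J : Inst S C} (h : J ⊆ I) : Entails I J :=
  ⟨id, fun _ => rfl, fun _ hf => h hf⟩

theorem logEquiv_succ_iff {t : ℕ} :
    LogEquiv (ob P B (t + 1)) (ob P B t) ↔ Entails (ob P B t) (ob P B (t + 1)) :=
  ⟨fun h => h.2, fun h => ⟨Entails.of_subset (ob_subset_succ t), h⟩⟩

open Classical in
/-- The equivalent chase agrees with the chase that never stops until it stops. -/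
theorem chaseStep_cases (i : ℕ) :
    (chaseStep P B i = ob P B i ∧ chaseStep P B (i + 1) = ob P B (i + 1) ∧
      ∀ m, m < i → ¬ Entails (ob P B m) (ob P B (m + 1))) ∨
    ∃ m, m < i ∧ chaseStep P B i = ob P B (m + 1) ∧ chaseStep P B (i + 1) = ob P B (m + 1) ∧
      Entails (ob P B m) (ob P B (m + 1)) ∧
      ∀ m' < m, ¬ Entails (ob P B m') (ob P B (m' + 1)) := by
  induction i with
  | zero => left; exact ⟨by rw [chaseStep]; rfl, by rw [chaseStep]; rfl, by simp⟩
  | succ i ih =>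
    have hs : chaseStep P B (i + 1 + 1) =
        if LogEquiv (chaseStep P B (i + 1)) (chaseStep P B i) then chaseStep P B (i + 1)
        else chaseRound P (chaseStep P B (i + 1)) := by
      rw [chaseStep]
    rcases ih with ⟨h1, h2, h3⟩ | ⟨m, hm, h1, h2, h3, h4⟩
    · rw [h1, h2] at hs
      by_cases he : Entails (ob P B i) (ob P B (i + 1))
      · right
        rw [if_pos (logEquiv_succ_iff.2 he)] at hs
        exact ⟨i, by omega, h2, hs, he, h3⟩
      · left
        rw [if_neg (fun h => he (logEquiv_succ_iff.1 h))] at hs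
        refine ⟨h2, hs, fun m hm => ?_⟩
        rcases Nat.lt_succ_iff_lt_or_eq.1 hm with hm | rfl
        · exact h3 m hm
        · exact he
    · right
      rw [h1, h2, if_pos ⟨Entails.refl _, Entails.refl _⟩] at hs
      exact ⟨m, by omega, h2, hs, h3, h4⟩

theorem chaseStep_eq_ob {i : ℕ} (h : ∀ m, m < i → ¬ Entails (ob P B m) (ob P B (m + 1))) :
    chaseStep P B i = ob P B i := by
  rcases chaseStep_cases (P := P) (B := B) i with h' | ⟨m, hm, _, _, h', _⟩
  · exact h'.1
  · exact absurd h' (h m hm)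

/-- If a round of the chase entails the next one, then the limit maps into this round. -/
theorem exists_hom_of_entails_succ (hB : IsBaseInstance B) {n : ℕ}
    (h : Entails (ob P B n) (ob P B (n + 1))) :
    ∃ g, FixesConst g ∧ ∀ f ∈ obLim P B, f.map g ∈ ob P B n := by
  obtain ⟨σ, hσc, hσ⟩ := h
  have hσn : ∀ f ∈ ob P B n, f.map σ ∈ ob P B n := fun f hf => hσ f (ob_subset_succ n hf)
  obtain ⟨N, hN, hid⟩ := exists_iterate_idempotent (terms_finite (ob_finite hB.1 n))
    (f := σ) (fun y hy => terms_map hσn hy)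
  obtain ⟨M, rfl⟩ : ∃ M, N = M + 1 := ⟨N - 1, by omega⟩
  have hiter : ∀ M, ∀ f ∈ ob P B n, f.map σ^[M] ∈ ob P B n := by
    intro M
    induction M with
    | zero => exact fun f hf => hf
    | succ M ih =>
      intro f hf
      rw [Function.iterate_succ, ← PredAtom.map_map]
      exact ih _ (hσn f hf)
  have hconst : ∀ M, FixesConst (σ^[M]) := by
    intro M c
    induction M with
    | zero => rfl
    | succ M ih => rw [Function.iterate_succ_apply, hσc, ih]
  have hπ1 : ∀ f ∈ ob P B (n + 1), f.map σ^[M + 1] ∈ ob P B n := fun f hf => by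
    rw [Function.iterate_succ, ← PredAtom.map_map]
    exact hiter M _ (hσ f hf)
  let g : GTerm S C → GTerm S C := GTerm.fold GTerm.const fun r _ h' z =>
    σ^[M + 1] (σ^[M + 1] (.null r h' z))
  have hg : ∀ r h z, g (.null r h z) = σ^[M + 1] (σ^[M + 1] (.null r (fun x => g (h x)) z)) :=
    fun r h z => by simp only [g, GTerm.fold]
  have key : ∀ t, ∀ f ∈ ob P B t, ∃ f' ∈ ob P B n, f.map g = f'.map σ^[M + 1] := by
    intro t
    induction t with
    | zero =>
      intro f hf
      refine ⟨f, ob_mono (Nat.zero_le _) hf, PredAtom.map_congr fun i => ?_⟩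
      obtain ⟨c, hc⟩ := (hB.2 f hf).2 i
      rw [hc, hconst]; rfl
    | succ t ih =>
      intro f hf
      rcases mem_ob_succ.1 hf with hf | ⟨r, hr, h, ht, rfl⟩
      · exact ih f hf
      · have htr : r.IsTrigger (fun x => g (h x)) (ob P B n) := fun A hA => by
          obtain ⟨f', hf', e⟩ := ih _ (ht A hA)
          have := hiter (M + 1) f' hf'
          rw [← e, PredAtom.map_map] at this
          convert this using 1
          refine Rule.map_body_congr (fun x hx => ?_) hA
          rw [Function.comp, Rule.skolemExt_of_mem hx, Rule.skolemExt_of_mem hx]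
        refine ⟨_, hπ1 _ (headFact_mem_ob hr htr), ?_⟩
        rw [PredAtom.map_map, Rule.headFact_map, Rule.headFact_map]
        refine PredAtom.map_congr fun i => ?_
        by_cases hx : r.head.args i ∈ r.bodyVars
        · rw [Rule.skolemExt_of_mem hx, Rule.skolemExt_of_mem hx]
          obtain ⟨f', hf', j, hj⟩ := ht.mem_terms ⟨_, hx⟩
          obtain ⟨f'', hf'', e⟩ := ih f' hf'
          obtain ⟨j', h1⟩ := PredAtom.exists_args_eq e j
          change g (f'.args j) = σ^[M + 1] (f''.args j') at h1
          rw [hj] at h1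
          have h2 := hid (f''.args j') ⟨f'', hf'', j', rfl⟩
          rw [Function.comp, h1, h2, h2]
        · rw [Rule.skolemExt_of_notMem hx, Rule.skolemExt_of_notMem hx, hg]
          rfl
  refine ⟨g, fun c => rfl, ?_⟩
  rintro f ⟨t, hf⟩
  obtain ⟨f', hf', e⟩ := key t f hf
  rw [e]
  exact hiter _ f' hf'

theorem entails_succ_of_hom {K t : ℕ}
    (h : ∃ g, FixesConst g ∧ ∀ f ∈ obLim P B, f.map g ∈ ob P B K) (hK : K ≤ t) :
    Entails (ob P B t) (ob P B (t + 1)) := by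
  obtain ⟨g, h1, h2⟩ := h
  exact ⟨g, h1, fun f hf => ob_mono hK (h2 f (ob_subset_obLim _ hf))⟩

theorem entails_succ_mono (hB : IsBaseInstance B) {m n : ℕ}
    (h : Entails (ob P B m) (ob P B (m + 1))) (hmn : m ≤ n) :
    Entails (ob P B n) (ob P B (n + 1)) :=
  entails_succ_of_hom (exists_hom_of_entails_succ hB h) hmn

theorem isBDD_iff : IsBDD C P ↔ ∃ k, ∀ B : Inst S C, IsBaseInstance B →
    Entails (ob P B k) (ob P B (k + 1)) := by
  constructor
  · rintro ⟨k, hk⟩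
    refine ⟨k, fun B hB => ?_⟩
    rcases chaseStep_cases (P := P) (B := B) k with h | ⟨m, hm, _, _, h, _⟩
    · have := hk B hB
      rwa [h.1, h.2.1] at this
    · exact entails_succ_mono hB h hm.le
  · rintro ⟨k, hk⟩
    refine ⟨k, fun B hB => ?_⟩
    rcases chaseStep_cases (P := P) (B := B) k with h | ⟨m, hm, h1, h2, h, _⟩
    · rw [h.1, h.2.1]; exact hk B hB
    · rw [h1, h2]; exact Entails.refl _

theorem const_mem_terms_base {c : C} (h : GTerm.const c ∈ terms (obLim P B)) :
    GTerm.const c ∈ terms B := by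
  obtain ⟨f, ⟨t, hf⟩, i, hi⟩ := h
  induction t generalizing f with
  | zero => exact ⟨f, hf, i, hi⟩
  | succ t ih =>
    rcases mem_ob_succ.1 hf with hf | ⟨r, hr, h, ht, rfl⟩
    · exact ih f hf i hi
    · change r.skolemExt h (r.head.args i) = _ at hi
      by_cases hx : r.head.args i ∈ r.bodyVars
      · rw [Rule.skolemExt_of_mem hx] at hi
        obtain ⟨f', hf', j, hj⟩ := ht.mem_terms ⟨_, hx⟩
        exact ih f' hf' j (hj.trans hi)
      · rw [Rule.skolemExt_of_notMem hx] at hi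
        cases hi

theorem finite_terms_depth_le (hB : IsBaseInstance B) (k : ℕ) :
    {y ∈ terms (obLim P B) | y.depth ≤ k}.Finite := by
  induction k with
  | zero =>
    refine Set.Finite.subset Set.finite_empty fun y hy => ?_
    have := y.depth_pos
    have := hy.2
    omega
  | succ k ih =>
    have hfin : (terms B ∪ ⋃ r ∈ P, ⋃ i, (fun h => GTerm.null r h (r.head.args i)) ''
        {h | ∀ x, h x ∈ {y ∈ terms (obLim P B) | y.depth ≤ k}}).Finite :=
      (terms_finite hB.1).union (P.finite_toSet.biUnion fun r _ => Set.finite_iUnion fun i =>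
        (Set.Finite.pi' fun _ => ih).image _)
    refine hfin.subset ?_
    rintro y ⟨hy, hd⟩
    cases y with
    | const c => exact Or.inl (const_mem_terms_base hy)
    | null r h z =>
      right
      obtain ⟨hr, hz, ⟨i, hi⟩, ht⟩ := null_mem_terms_obLim hB hy
      simp only [Set.mem_iUnion]
      refine ⟨r, hr, i, h, fun x => ⟨ht.mem_terms x, ?_⟩, by rw [hi]⟩
      have := GTerm.depth_lt_null h z x
      omega

theorem exists_obLim_subset_of_depth_le (hB : IsBaseInstance B) {k : ℕ}
    (h : ∀ y ∈ terms (obLim P B), y.depth ≤ k) : ∃ t, obLim P B ⊆ ob P B t := by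
  have hT : (terms (obLim P B)).Finite :=
    (finite_terms_depth_le hB k).subset fun y hy => ⟨hy, h y hy⟩
  have hX : (obLim P B).Finite := by
    have hfin : (B ∪ ⋃ r ∈ P, (fun a : Fin (S.arity r.head.pred) → GTerm S C =>
        (⟨r.head.pred, a⟩ : GroundFact S C)) '' {a | ∀ i, a i ∈ terms (obLim P B)}).Finite :=
      hB.1.union (P.finite_toSet.biUnion fun r _ => (Set.Finite.pi' fun _ => hT).image _)
    refine hfin.subset fun f hf => ?_
    rcases obLim_cases hf with h | ⟨r, hr, h, ht, rfl⟩
    · exact Or.inl h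
    · right
      simp only [Set.mem_iUnion]
      exact ⟨r, hr, (r.headFact h).args, fun i => ⟨_, hf, i, rfl⟩, rfl⟩
  exact exists_ob_of_forall_obLim (F := id) hX fun f hf => hf

/-- If the terms of the equivalent chase have bounded depth, then the limit of the chase maps into
a round with terms of bounded depth. -/
theorem exists_hom_of_chaseStep_depth_le (hB : IsBaseInstance B) {k : ℕ}
    (h : ∀ i, ∀ f ∈ chaseStep P B i, ∀ j, (f.args j).depth ≤ k) :
    ∃ n, (∀ m < n, ¬ Entails (ob P B m) (ob P B (m + 1))) ∧
      Entails (ob P B n) (ob P B (n + 1)) ∧ (∀ y ∈ terms (ob P B n), y.depth ≤ k) ∧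
      ∃ g, FixesConst g ∧ ∀ f ∈ obLim P B, f.map g ∈ ob P B n := by
  classical
  have hex : ∃ n, Entails (ob P B n) (ob P B (n + 1)) := by
    by_contra! hne
    have heq : ∀ i, chaseStep P B i = ob P B i := fun i => chaseStep_eq_ob fun m _ => hne m
    obtain ⟨t, ht⟩ := exists_obLim_subset_of_depth_le (P := P) hB (k := k) (by
      rintro y ⟨f, ⟨t, hf⟩, i, rfl⟩
      exact h t f (by rwa [heq]) i)
    exact hne t (Entails.of_subset fun f hf => ht ⟨_, hf⟩)
  have hmin : ∀ m < Nat.find hex, ¬ Entails (ob P B m) (ob P B (m + 1)) :=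
    fun m hm => Nat.find_min hex hm
  refine ⟨Nat.find hex, hmin, Nat.find_spec hex, ?_,
    exists_hom_of_entails_succ hB (Nat.find_spec hex)⟩
  rintro y ⟨f, hf, i, rfl⟩
  exact h _ f (by rwa [chaseStep_eq_ob hmin]) i

/-- A finite retract `Y` of the terms of the chase, with the retraction `ρ`, that is minimal: each
endomorphism is injective on `Y`, and has a left inverse there. -/
structure IsCore (P : Program S) (B : Inst S C) (k : ℕ) (Y : Set (GTerm S C))
    (ρ : GTerm S C → GTerm S C) : Prop where
  finite : Y.Finite
  depth_le : ∀ y ∈ Y, y.depth ≤ k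
  subset : Y ⊆ terms (obLim P B)
  isEndo : IsEndo P B ρ
  eq_self : ∀ y ∈ Y, ρ y = y
  mapsTo : ∀ y ∈ terms (obLim P B), ρ y ∈ Y
  exists_inverse : ∀ g, IsEndo P B g → ∃ g', IsEndo P B g' ∧
    (∀ y ∈ terms (obLim P B), g' y ∈ Y) ∧ ∀ y ∈ Y, g' (g y) = y

theorem exists_isCore (hB : IsBaseInstance B) {n k : ℕ}
    (hk : ∀ y ∈ terms (ob P B n), y.depth ≤ k)
    (hg : ∃ g, FixesConst g ∧ ∀ f ∈ obLim P B, f.map g ∈ ob P B n) :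
    ∃ Y ρ, IsCore P B k Y ρ := by
  classical
  set X := terms (obLim P B) with hX
  have hex : ∃ N, ∃ g, IsEndo P B g ∧ (∀ y ∈ X, g y ∈ terms (ob P B n)) ∧ (g '' X).ncard = N := by
    obtain ⟨g, h1, h2⟩ := hg
    exact ⟨_, g, ⟨h1, fun f hf => ob_subset_obLim _ (h2 f hf)⟩, fun y hy => terms_map h2 hy, rfl⟩
  obtain ⟨ρ₀, hρ₀, hρ₀n, hcard⟩ := Nat.find_spec hex
  have hmin : ∀ g, IsEndo P B g → (∀ y ∈ X, g y ∈ terms (ob P B n)) →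
      (ρ₀ '' X).ncard ≤ (g '' X).ncard := fun g h1 h2 => by
    rw [hcard]; exact Nat.find_min' hex ⟨g, h1, h2, rfl⟩
  have hYfin : (ρ₀ '' X).Finite := (terms_finite (ob_finite hB.1 n)).subset (by
    rintro _ ⟨y, hy, rfl⟩; exact hρ₀n y hy)
  have hYX : ρ₀ '' X ⊆ X := by
    rintro _ ⟨y, hy, rfl⟩; exact hρ₀.mem_terms hy
  have hinj : ∀ g, IsEndo P B g → Set.MapsTo (ρ₀ ∘ g) (ρ₀ '' X) (ρ₀ '' X) ∧
      Set.InjOn (ρ₀ ∘ g) (ρ₀ '' X) := fun g hgE => by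
    have hm : Set.MapsTo (ρ₀ ∘ g) (ρ₀ '' X) (ρ₀ '' X) :=
      fun y hy => ⟨g y, hgE.mem_terms (hYX hy), rfl⟩
    refine ⟨hm, ?_⟩
    have h1 := hmin (ρ₀ ∘ g ∘ ρ₀) (hρ₀.comp (hgE.comp hρ₀)) fun y hy =>
      hρ₀n _ (hgE.mem_terms (hρ₀.mem_terms hy))
    rw [← Function.comp_assoc, Set.image_comp] at h1
    exact Set.injOn_of_ncard_image_eq (le_antisymm (Set.ncard_image_le hYfin) h1) hYfin
  obtain ⟨N, hN⟩ : ∃ N, ∀ x ∈ ρ₀ '' X, ρ₀^[N] (ρ₀ x) = x :=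
    exists_iterate_eq_id hYfin (hinj id IsEndo.id).1 (hinj id IsEndo.id).2
  have hρm : ∀ y ∈ X, ρ₀^[N] (ρ₀ y) ∈ ρ₀ '' X := fun y hy =>
    Set.MapsTo.iterate (hinj id IsEndo.id).1 N ⟨y, hy, rfl⟩
  refine ⟨ρ₀ '' X, ρ₀^[N] ∘ ρ₀, hYfin, ?_, hYX, (hρ₀.iterate N).comp hρ₀, hN, hρm, ?_⟩
  · rintro _ ⟨y, hy, rfl⟩; exact hk _ (hρ₀n y hy)
  · intro g hgE
    obtain ⟨M, hM⟩ := exists_iterate_eq_id hYfin (hinj g hgE).1 (hinj g hgE).2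
    refine ⟨(ρ₀ ∘ g)^[M] ∘ ρ₀, ((hρ₀.comp hgE).iterate M).comp hρ₀, fun y hy => ?_, hM⟩
    exact Set.MapsTo.iterate (hinj g hgE).1 M ⟨y, hy, rfl⟩

end Stopping

section Finiteness

variable {S : Signature.{u}}

theorem exists_uniform_bound {α : Type*} {s : Set α} (hs : s.Finite) {p : α → ℕ → Prop}
    (hmono : ∀ a, ∀ m n, m ≤ n → p a m → p a n) (h : ∀ a ∈ s, ∃ n, p a n) :
    ∃ n, ∀ a ∈ s, p a n := by
  induction s, hs using Set.Finite.induction_on with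
  | empty => exact ⟨0, by simp⟩
  | @insert a s _ _ ih =>
    obtain ⟨n, hn⟩ := ih fun i hi => h i (Set.mem_insert_of_mem _ hi)
    obtain ⟨m, hm⟩ := h a (Set.mem_insert _ _)
    refine ⟨max m n, fun i hi => ?_⟩
    rcases hi with rfl | hi
    · exact hmono _ _ _ (le_max_left _ _) hm
    · exact hmono _ _ _ (le_max_right _ _) (hn i hi)

theorem finite_predAtom {T : Type*} {F : Set S.Pred} (hF : F.Finite) {G : Set T} (hG : G.Finite) :
    {A : PredAtom S T | A.pred ∈ F ∧ ∀ i, A.args i ∈ G}.Finite := by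
  have hfin : (⋃ p ∈ F, (fun a : Fin (S.arity p) → T => (⟨p, a⟩ : PredAtom S T)) ''
      {a | ∀ i, a i ∈ G}).Finite :=
    hF.biUnion fun p _ => (Set.Finite.pi' fun _ => hG).image _
  refine hfin.subset fun A hA => ?_
  simp only [Set.mem_iUnion]
  exact ⟨A.pred, hA.1, A.args, hA.2, rfl⟩

theorem finite_list_of_mem {α : Type*} {G : Set α} (hG : G.Finite) (n : ℕ) :
    {l : List α | l.length ≤ n ∧ ∀ a ∈ l, a ∈ G}.Finite := by
  have : Finite G := hG
  refine ((List.finite_length_le G n).image (List.map Subtype.val)).subset ?_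
  rintro l ⟨h1, h2⟩
  refine ⟨l.attach.map fun a => ⟨a.1, h2 a.1 a.2⟩, by simpa using h1, ?_⟩
  rw [List.map_map]
  exact List.attach_map_subtype_val l

/-- The head predicates of a program. -/
def headPreds (P : Program S) : Set S.Pred := {p | ∃ r ∈ P, r.head.pred = p}

theorem headPreds_finite (P : Program S) : (headPreds P).Finite := by
  have : headPreds P = (fun r : Rule S => r.head.pred) '' (P : Set (Rule S)) := by
    ext p; simp [headPreds]
  rw [this]; exact P.finite_toSet.image _

/-- The body predicates of a program. -/
def bodyPreds (P : Program S) : Set S.Pred := {p | ∃ r ∈ P, ∃ A ∈ r.body, A.pred = p}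

theorem bodyPreds_finite (P : Program S) : (bodyPreds P).Finite := by
  have : bodyPreds P = ⋃ r ∈ P, PredAtom.pred '' {A | A ∈ r.body} := by
    ext p; simp [bodyPreds]
  rw [this]; exact P.finite_toSet.biUnion fun r _ => r.body.finite_toSet.image _

/-- A bound for the arities of the head predicates. -/
def headArity (P : Program S) : ℕ := P.sup fun r => S.arity r.head.pred

theorem arity_le_headArity {P : Program S} {p : S.Pred} (hp : p ∈ headPreds P) :
    S.arity p ≤ headArity P := by
  obtain ⟨r, hr, rfl⟩ := hp
  exact Finset.le_sup (f := fun r : Rule S => S.arity r.head.pred) hr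

end Finiteness

section Queries

variable {S : Signature.{u}} {C : Type v} {P : Program S} {B : Inst S C}

theorem BCQ.TrueIn.map {Q : BCQ S C} {I J : Inst S C} (h : Q.TrueIn I)
    {g : GTerm S C → GTerm S C} (hg : FixesConst g) (hIJ : ∀ f ∈ I, f.map g ∈ J) :
    Q.TrueIn J := by
  obtain ⟨σ, hσ⟩ := h
  refine ⟨g ∘ σ, fun A hA => ?_⟩
  have := hIJ _ (hσ A hA)
  rw [PredAtom.map_map] at this
  convert this using 1
  refine PredAtom.map_congr fun i => ?_
  cases A.args i with
  | inl c => exact (hg c).symm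
  | inr x => rfl

theorem BCQ.TrueIn.mono {Q : BCQ S C} {I J : Inst S C} (h : Q.TrueIn I) (hIJ : I ⊆ J) :
    Q.TrueIn J :=
  h.map FixesConst.id fun _ hf => hIJ hf

theorem kbEntails_iff (hB : IsBaseInstance B) {Q : BCQ S C} :
    KBEntails P B Q ↔ Q.TrueIn (obLim P B) := by
  refine ⟨fun h => h _ obLim_isModel, fun h M hM => ?_⟩
  obtain ⟨μ, h1, h2⟩ := exists_hom_of_isModel hB hM
  exact h.map h1 h2

theorem finite_consts_bcq (Q : BCQ S C) :
    {c : C | ∃ A ∈ Q, ∃ i, A.args i = Sum.inl c}.Finite := by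
  have hfin : (⋃ A ∈ {A | A ∈ Q}, Set.range A.args).Finite :=
    (List.finite_toSet Q).biUnion fun A _ => Set.finite_range _
  refine (hfin.preimage Sum.inl_injective.injOn).subset ?_
  rintro c ⟨A, hA, i, hi⟩
  simp only [Set.mem_preimage, Set.mem_iUnion]
  exact ⟨A, hA, i, hi⟩

theorem finite_avoid_embedding [Infinite C] {F : Set C} (hF : F.Finite) :
    ∃ fr : ℕ → C, Function.Injective fr ∧ ∀ n, fr n ∉ F := by
  have := hF.infinite_compl
  exact ⟨fun n => (this.natEmbedding _ n : C),
    fun a b h => (this.natEmbedding _).injective (Subtype.ext h),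
    fun n => (this.natEmbedding _ n).2⟩

/-- A query that holds in the chase of a base instance has a match in a bounded round of the chase,
with terms of bounded depth, and the bound depends on the query only. -/
theorem exists_round_of_fus [Infinite C] {k : ℕ}
    (hk : ∀ B : Inst S C, IsBaseInstance B → ∀ i, ∀ f ∈ chaseStep P B i, ∀ j,
      (f.args j).depth ≤ k) (hF : IsFUS C P) (Q : BCQ S C) :
    ∃ K, ∀ (C' : Type w) (B' : Inst S C') (B : Inst S C) (d : C → C'),
      IsBaseInstance B → (∀ f ∈ B, f.map (GTerm.mapC d) ∈ B') → Q.TrueIn (obLim P B) →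
      ∃ ν : Var → GTerm S C', ∀ A ∈ Q,
        A.map (Sum.elim (fun c => GTerm.const (d c)) ν) ∈ ob P B' K ∧
        ∀ i, (Sum.elim (fun c => GTerm.const (d c)) ν (A.args i)).depth ≤ k := by
  classical
  obtain ⟨Q', hQ'⟩ := hF Q
  have key : ∀ q ∈ {q | q ∈ Q'}, ∃ K, ∀ (C' : Type w) (B' : Inst S C') (B : Inst S C) (d : C → C'),
      IsBaseInstance B → (∀ f ∈ B, f.map (GTerm.mapC d) ∈ B') → q.TrueIn B →
      ∃ ν : Var → GTerm S C', ∀ A ∈ Q,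
        A.map (Sum.elim (fun c => GTerm.const (d c)) ν) ∈ ob P B' K ∧
        ∀ i, (Sum.elim (fun c => GTerm.const (d c)) ν (A.args i)).depth ≤ k := by
    intro q hq
    by_cases hext : ∀ A ∈ q, A.pred ∈ S.extensional
    swap
    · refine ⟨0, fun C' B' B d hB _ ⟨σ, hσ⟩ => absurd (fun A hA => ?_) hext⟩
      exact (hB.2 _ (hσ A hA)).1
    obtain ⟨fr, hfr, hfrF⟩ := finite_avoid_embedding
      ((finite_consts_bcq q).union (finite_consts_bcq Q))
    let Bq : Inst S C := {f | ∃ A ∈ q, f = A.map (Sum.elim GTerm.const fun v => .const (fr v))}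
    have hBq : IsBaseInstance Bq := by
      constructor
      · have : Bq = (fun A => A.map (Sum.elim GTerm.const fun v => .const (fr v))) ''
            {A | A ∈ q} := by
          ext f; simp [Bq, eq_comm]
        rw [this]; exact (List.finite_toSet q).image _
      · rintro f ⟨A, hA, rfl⟩
        refine ⟨hext A hA, fun i => ?_⟩
        change ∃ c, Sum.elim GTerm.const _ (A.args i) = _
        cases A.args i with
        | inl c => exact ⟨c, rfl⟩
        | inr x => exact ⟨fr x, rfl⟩
    have hQ : Q.TrueIn (obLim P Bq) := (kbEntails_iff hBq).1 <|
      (hQ' Bq hBq).2 ⟨q, hq, fun v => .const (fr v), fun A hA => ⟨A, hA, rfl⟩⟩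
    obtain ⟨n, _, _, hnk, g, hg, hgn⟩ := exists_hom_of_chaseStep_depth_le (P := P) hBq (hk Bq hBq)
    obtain ⟨μ, hμ⟩ := hQ.map hg hgn
    refine ⟨n, fun C' B' B d hB hd ⟨σ, hσ⟩ => ?_⟩
    let cst : GTerm S C → C := fun y => match y with
      | .const c => c
      | .null _ _ _ => fr 0
    let e : C → C' := fun c => if h : ∃ v, fr v = c then d (cst (σ h.choose)) else d c
    have he1 : ∀ v, e (fr v) = d (cst (σ v)) := fun v => by
      have h : ∃ v', fr v' = fr v := ⟨v, rfl⟩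
      simp only [e, dif_pos h]
      rw [hfr h.choose_spec]
    have he2 : ∀ c, (∃ A ∈ q, ∃ i, A.args i = Sum.inl c) ∨ (∃ A ∈ Q, ∃ i, A.args i = Sum.inl c) →
        e c = d c := fun c hc => dif_neg (by rintro ⟨v, rfl⟩; exact hfrF v hc)
    have heB : ∀ f ∈ Bq, f.map (GTerm.mapC e) ∈ B' := by
      rintro f ⟨A, hA, rfl⟩
      have h1 := hσ A hA
      have h2 := hd _ h1
      rw [PredAtom.map_map] at h2 ⊢
      convert h2 using 1
      refine PredAtom.map_congr fun i => ?_
      cases hi : A.args i with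
      | inl c =>
        simp only [Function.comp, Sum.elim_inl, GTerm.mapC]
        rw [he2 c (Or.inl ⟨A, hA, i, hi⟩)]
      | inr x =>
        obtain ⟨c, hc⟩ := (hB.2 _ h1).2 i
        change Sum.elim GTerm.const σ (A.args i) = _ at hc
        rw [hi, Sum.elim_inr] at hc
        simp only [Function.comp, Sum.elim_inr, GTerm.mapC, he1, hc]
        rfl
    have hterm : ∀ A ∈ Q, ∀ i, Sum.elim (fun c => GTerm.const (d c))
        (fun x => (μ x).mapC e) (A.args i) = ((Sum.elim GTerm.const μ) (A.args i)).mapC e := by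
      intro A hA i
      cases hi : A.args i with
      | inl c =>
        rw [Sum.elim_inl, Sum.elim_inl, GTerm.mapC, he2 c (Or.inr ⟨A, hA, i, hi⟩)]
      | inr x => rfl
    refine ⟨fun x => (μ x).mapC e, fun A hA => ⟨?_, fun i => ?_⟩⟩
    · have := ob_mapC e heB (hμ A hA)
      rw [PredAtom.map_map] at this
      convert this using 1
      exact PredAtom.map_congr (hterm A hA)
    · rw [hterm A hA, GTerm.depth_mapC]
      exact hnk _ ⟨_, hμ A hA, i, rfl⟩
  obtain ⟨K, hK⟩ := exists_uniform_bound (List.finite_toSet Q') (fun q m n hmn h C' B' B d h1 h2 h3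
    => by
      obtain ⟨ν, hν⟩ := h C' B' B d h1 h2 h3
      exact ⟨ν, fun A hA => ⟨ob_mono hmn (hν A hA).1, (hν A hA).2⟩⟩) key
  refine ⟨K, fun C' B' B d hB hd hQ => ?_⟩
  obtain ⟨q, hq, hqB⟩ := (hQ' B hB).1 ((kbEntails_iff hB).2 hQ)
  exact hK q hq C' B' B d hB hd hqB

end Queries

section Realization

variable {S : Signature.{u}} {C : Type v} {P : Program S}

/-- The finite parts of the limit of the chase, over any type of constants, map into a bounded round
of the chase with terms of depth at most `k`. -/
def FinitelyRealizable (P : Program S) (k : ℕ) : Prop :=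
  ∀ s, ∃ K, ∀ (C' : Type w) [Nonempty C'] (B' : Inst S C'), IsBaseInstance B' →
    ∀ A : List (GroundFact S C'), A.length ≤ s → (∀ f ∈ A, f ∈ obLim P B') →
    ∃ σ, FixesConst σ ∧ ∀ f ∈ A, f.map σ ∈ ob P B' K ∧ ∀ i, (σ (f.args i)).depth ≤ k

theorem finitelyRealizable_of_tdb_fus [Infinite C] {k : ℕ} (hk1 : 1 ≤ k)
    (hk : ∀ B : Inst S C, IsBaseInstance B → ∀ i, ∀ f ∈ chaseStep P B i, ∀ j,
      (f.args j).depth ≤ k) (hF : IsFUS C P) : FinitelyRealizable.{u, w} P k := by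
  classical
  intro s
  let c₀ : ℕ → C := Infinite.natEmbedding C
  have hc₀ : Function.Injective c₀ := (Infinite.natEmbedding C).injective
  let M := s * headArity P
  let G : Set (C ⊕ Var) := (fun n => Sum.inl (c₀ n)) '' Set.Iio M ∪ Sum.inr '' Set.Iio M
  have hG : G.Finite := ((Set.finite_Iio M).image _).union ((Set.finite_Iio M).image _)
  obtain ⟨K, hK⟩ := exists_uniform_bound
    (finite_list_of_mem (finite_predAtom (headPreds_finite P) hG) s)
    (fun Q m n hmn h C' B' B d h1 h2 h3 => by
      obtain ⟨ν, hν⟩ := h C' B' B d h1 h2 h3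
      exact ⟨ν, fun A hA => ⟨ob_mono hmn (hν A hA).1, (hν A hA).2⟩⟩)
    (fun Q _ => exists_round_of_fus.{u, v, w} hk hF Q)
  refine ⟨K, fun C' _ B' hB' A₀ hA₀s hA₀ => ?_⟩
  let A := A₀.filter fun f => f.pred ∈ headPreds P
  have hAs : A.length ≤ s := (List.length_filter_le _ _).trans hA₀s
  have hApred : ∀ f ∈ A, f.pred ∈ headPreds P := fun f hf => by
    simpa using (List.mem_filter.1 hf).2
  have hA : ∀ f ∈ A, f ∈ obLim P B' := fun f hf => hA₀ f (List.mem_filter.1 hf).1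
  let T₁ : List (GTerm S C') := A.flatMap fun f => List.ofFn f.args
  have hT₁ : T₁.length ≤ M := (List.length_flatMap_le _ _ (headArity P) fun f hf => by
    rw [List.length_ofFn]; exact arity_le_headArity (hApred f hf)).trans
      (Nat.mul_le_mul_right _ hAs)
  let T₂ : List (GTerm S C') := (terms_finite hB'.1).toFinset.toList
  let enc : GTerm S C' → ℕ := fun y => (T₁ ++ T₂).idxOf y
  have hT₁mem : ∀ f ∈ A, ∀ i, f.args i ∈ T₁ := fun f hf i =>
    List.mem_flatMap.2 ⟨f, hf, by simp⟩
  have henc : ∀ y ∈ T₁, enc y < M := fun y hy => by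
    simp only [enc, List.idxOf_append_of_mem hy]
    exact (List.idxOf_lt_length_iff.2 hy).trans_le hT₁
  have hinj : ∀ y ∈ T₁ ++ T₂, ∀ y', enc y = enc y' → y = y' := fun y hy y' h =>
    (List.idxOf_inj hy).1 h
  let e : C' → C := fun c => c₀ (enc (.const c))
  let d : C → C' := fun c => if h : ∃ c', .const c' ∈ T₁ ++ T₂ ∧ e c' = c then h.choose
    else Classical.arbitrary C'
  have hde : ∀ c, .const c ∈ T₁ ++ T₂ → d (e c) = c := fun c hc => by
    have h : ∃ c', .const c' ∈ T₁ ++ T₂ ∧ e c' = e c := ⟨c, hc, rfl⟩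
    simp only [d, dif_pos h]
    have := hinj _ h.choose_spec.1 _ (hc₀ h.choose_spec.2)
    exact GTerm.const.inj this
  let B : Inst S C := (fun f => f.map (GTerm.mapC e)) '' B'
  have hB : IsBaseInstance B := by
    refine ⟨hB'.1.image _, ?_⟩
    rintro _ ⟨f, hf, rfl⟩
    refine ⟨(hB'.2 f hf).1, fun i => ?_⟩
    obtain ⟨c, hc⟩ := (hB'.2 f hf).2 i
    exact ⟨e c, by simp [PredAtom.map, hc, GTerm.mapC]⟩
  have hBd : ∀ f ∈ B, f.map (GTerm.mapC d) ∈ B' := by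
    rintro _ ⟨f, hf, rfl⟩
    have : (f.map (GTerm.mapC e)).map (GTerm.mapC d) = f := by
      rw [PredAtom.map_map]
      refine PredAtom.map_eq_self fun i => ?_
      obtain ⟨c, hc⟩ := (hB'.2 f hf).2 i
      simp only [Function.comp, hc, GTerm.mapC]
      rw [hde c]
      refine List.mem_append_right _ ?_
      simp only [T₂, Finset.mem_toList, Set.Finite.mem_toFinset]
      exact ⟨f, hf, i, hc⟩
    rwa [this]
  let code : GTerm S C' → C ⊕ Var := fun y => match y with
    | .const c => Sum.inl (e c)
    | .null r h z => Sum.inr (enc (.null r h z))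
  let Q : BCQ S C := A.map fun f => f.map code
  have hQ : Q ∈ {l : List (PredAtom S (C ⊕ Var)) | l.length ≤ s ∧ ∀ a ∈ l,
      a ∈ {A : PredAtom S (C ⊕ Var) | A.pred ∈ headPreds P ∧ ∀ i, A.args i ∈ G}} := by
    refine ⟨by simpa [Q] using hAs, fun a ha => ?_⟩
    obtain ⟨f, hf, rfl⟩ := List.mem_map.1 ha
    refine ⟨hApred f hf, fun i => ?_⟩
    have h1 := henc _ (hT₁mem f hf i)
    change code (f.args i) ∈ G
    cases hy : f.args i with
    | const c => rw [hy] at h1; exact Or.inl ⟨_, h1, rfl⟩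
    | null r h z => rw [hy] at h1; exact Or.inr ⟨_, h1, rfl⟩
  have hQtrue : Q.TrueIn (obLim P B) := by
    refine ⟨fun n => ((T₁ ++ T₂).getD n (.const (Classical.arbitrary C'))).mapC e,
      fun a ha => ?_⟩
    obtain ⟨f, hf, rfl⟩ := List.mem_map.1 ha
    have := obLim_mapC e (B' := B) (fun f hf => ⟨f, hf, rfl⟩) (hA f hf)
    rw [PredAtom.map_map]
    convert this using 1
    refine PredAtom.map_congr fun i => ?_
    have hm : f.args i ∈ T₁ ++ T₂ := List.mem_append_left _ (hT₁mem f hf i)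
    cases hy : f.args i with
    | const c => simp only [Function.comp, code, Sum.elim_inl, GTerm.mapC]
    | null r h z =>
      rw [hy] at hm
      simp only [Function.comp, code, Sum.elim_inr]
      congr 1
      rw [List.getD_eq_getElem _ _ (List.idxOf_lt_length_iff.2 hm)]
      exact List.getElem_idxOf _
  obtain ⟨ν, hν⟩ := hK Q hQ C' B' B d hB hBd hQtrue
  let σ : GTerm S C' → GTerm S C' := fun y => match y with
    | .const c => .const c
    | .null r h z => ν (enc (.null r h z))
  refine ⟨σ, fun c => rfl, fun f hf => ?_⟩
  by_cases hp : f.pred ∈ headPreds P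
  · have hfA : f ∈ A := List.mem_filter.2 ⟨hf, by simpa using hp⟩
    have hσ : ∀ i, σ (f.args i) = Sum.elim (fun c => GTerm.const (d c)) ν (code (f.args i)) :=
      fun i => by
        have hm : f.args i ∈ T₁ ++ T₂ := List.mem_append_left _ (hT₁mem f hfA i)
        cases hy : f.args i with
        | const c =>
          rw [hy] at hm
          simp only [σ, code, Sum.elim_inl, hde c hm]
        | null r h z => rfl
    obtain ⟨h1, h2⟩ := hν _ (List.mem_map.2 ⟨f, hfA, rfl⟩)
    refine ⟨?_, fun i => by rw [hσ]; exact h2 i⟩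
    rw [PredAtom.map_map] at h1
    convert h1 using 1
    exact PredAtom.map_congr hσ
  · have hfB : f ∈ B' := by
      rcases obLim_cases (hA₀ f hf) with h | ⟨r, hr, h, _, rfl⟩
      · exact h
      · exact absurd ⟨r, hr, rfl⟩ hp
    have hσ : ∀ i, σ (f.args i) = f.args i := fun i => by
      obtain ⟨c, hc⟩ := (hB'.2 f hfB).2 i
      rw [hc]
    refine ⟨?_, fun i => ?_⟩
    · rw [PredAtom.map_eq_self hσ]
      exact ob_mono (Nat.zero_le _) hfB
    · rw [hσ]
      obtain ⟨c, hc⟩ := (hB'.2 f hfB).2 i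
      rw [hc]
      exact hk1

end Realization

section RealizedMaps

variable {S : Signature.{u}} {C : Type v} {P : Program S} {B : Inst S C}

/-- The map `ζ` on `I` extends, for each set of at most `s` facts of the limit of the chase, to a
term mapping that sends these facts to the round `K`. -/
def IsRealized (P : Program S) (B : Inst S C) (s K : ℕ) (I : Set (GTerm S C))
    (ζ : GTerm S C → GTerm S C) : Prop :=
  ∀ A : List (GroundFact S C), A.length ≤ s → (∀ f ∈ A, f ∈ obLim P B) →
    ∃ σ, FixesConst σ ∧ (∀ y ∈ I, σ y = ζ y) ∧ ∀ f ∈ A, f.map σ ∈ ob P B K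

theorem IsRealized.mono {s s' K K' : ℕ} {I I' : Set (GTerm S C)} {ζ : GTerm S C → GTerm S C}
    (h : IsRealized P B s K I ζ) (hs : s' ≤ s) (hK : K ≤ K') (hI : I' ⊆ I) : IsRealized P B s' K' I' ζ :=
  fun A hA hAX => by
    obtain ⟨σ, h1, h2, h3⟩ := h A (hA.trans hs) hAX
    exact ⟨σ, h1, fun y hy => h2 y (hI hy), fun f hf => ob_mono hK (h3 f hf)⟩

theorem IsRealized.congr {s K : ℕ} {I : Set (GTerm S C)} {ζ ζ' : GTerm S C → GTerm S C}
    (h : IsRealized P B s K I ζ) (hζ : ∀ y ∈ I, ζ y = ζ' y) : IsRealized P B s K I ζ' :=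
  fun A hA hAX => by
    obtain ⟨σ, h1, h2, h3⟩ := h A hA hAX
    exact ⟨σ, h1, fun y hy => (h2 y hy).trans (hζ y hy), h3⟩

theorem IsRealized.comp_isShift {s K K' : ℕ} {I : Set (GTerm S C)} {ζ g : GTerm S C → GTerm S C}
    (h : IsRealized P B s K I ζ) (hg : IsShift P B K' g) : IsRealized P B s (K + K') I (g ∘ ζ) :=
  fun A hA hAX => by
    obtain ⟨σ, h1, h2, h3⟩ := h A hA hAX
    exact ⟨g ∘ σ, hg.1.comp h1, fun y hy => congrArg g (h2 y hy), fun f hf => by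
      rw [← PredAtom.map_map]; exact hg.2 _ _ (h3 f hf)⟩

/-- Realized maps can be transported along endomorphisms. -/
theorem IsRealized.precomp {s K : ℕ} {I : Set (GTerm S C)} {ζ e : GTerm S C → GTerm S C}
    (h : IsRealized P B s K I ζ) (he : IsEndo P B e) {I' : Set (GTerm S C)}
    (hI : ∀ y ∈ I', e y ∈ I) : IsRealized P B s K I' (ζ ∘ e) :=
  fun A hA hAX => by
    obtain ⟨σ, h1, h2, h3⟩ := h (A.map (PredAtom.map e)) (by simpa using hA) (by
      intro f hf
      obtain ⟨f', hf', rfl⟩ := List.mem_map.1 hf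
      exact he.2 f' (hAX f' hf'))
    refine ⟨σ ∘ e, h1.comp he.1, fun y hy => h2 _ (hI y hy), fun f hf => ?_⟩
    rw [← PredAtom.map_map]
    exact h3 _ (List.mem_map.2 ⟨f, hf, rfl⟩)

/-- A term mapping that sends the creation facts of the terms in `Z` to the round `K` agrees on
the subterms of these terms with an endomorphism that delays by `K` rounds. -/
theorem exists_isShift_of_creation (hB : IsBaseInstance B) {Z : Set (GTerm S C)} {K : ℕ}
    (hZ : Z ⊆ terms (obLim P B)) {σ : GTerm S C → GTerm S C} (hσ : FixesConst σ)
    (h : ∀ y ∈ Z, ∀ f ∈ y.creation, f.map σ ∈ ob P B K) :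
    ∃ g, IsShift P B K g ∧ ∀ y ∈ Z, ∀ u ∈ y.subterms, g u = σ u := by
  obtain ⟨g, hg, hgW, _⟩ := exists_isShift_extension hB (W := {u | ∃ y ∈ Z, u ∈ y.subterms}) hσ
    (fun r h z ⟨y, hy, hu⟩ => subterm_mem_terms hB (hZ hy) hu)
    (fun r h z x ⟨y, hy, hu⟩ => ⟨y, hy, GTerm.parent_mem_subterms hu x⟩)
    (fun r h' z ⟨y, hy, hu⟩ =>
      ⟨σ, hσ, fun _ _ _ => rfl, h y hy _ (GTerm.headFact_mem_creation hu)⟩)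
  exact ⟨g, hg, fun y hy u hu => hgW u ⟨y, hy, hu⟩⟩

/-- The creation facts of the terms in a finite set, as a list. -/
theorem exists_creation_list (hB : IsBaseInstance B) {Z : Set (GTerm S C)} (hfin : Z.Finite)
    (hZ : Z ⊆ terms (obLim P B)) {k : ℕ} (hk : ∀ y ∈ Z, y.depth ≤ k) :
    ∃ L : List (GroundFact S C), L.length ≤ Z.ncard * sizeBound P k ∧
      (∀ f ∈ L, f ∈ obLim P B) ∧ ∀ y ∈ Z, ∀ f ∈ y.creation, f ∈ L := by
  refine ⟨hfin.toFinset.toList.flatMap GTerm.creation, ?_, ?_, ?_⟩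
  · refine (List.length_flatMap_le _ _ (sizeBound P k) fun y hy => ?_).trans ?_
    · have hy : y ∈ Z := by simpa using hy
      exact length_creation_le hB (hZ hy) (hk y hy)
    · rw [Finset.length_toList, Set.ncard_eq_toFinset_card Z hfin]
  · intro f hf
    obtain ⟨y, hy, hf⟩ := List.mem_flatMap.1 hf
    exact creation_subset hB (hZ (by simpa using hy)) hf
  · intro y hy f hf
    exact List.mem_flatMap.2 ⟨y, by simpa using hy, hf⟩

/-- A map that is realized for sufficiently many facts extends to an endomorphism. -/
theorem IsRealized.exists_isShift (hB : IsBaseInstance B) {s K k : ℕ} {I : Set (GTerm S C)}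
    {ζ : GTerm S C → GTerm S C} (h : IsRealized P B s K I ζ) (hfin : I.Finite)
    (hI : I ⊆ terms (obLim P B)) (hk : ∀ y ∈ I, y.depth ≤ k)
    (hs : I.ncard * sizeBound P k ≤ s) : ∃ g, IsShift P B K g ∧ ∀ y ∈ I, g y = ζ y := by
  obtain ⟨L, hL1, hL2, hL3⟩ := exists_creation_list hB hfin hI hk
  obtain ⟨σ, h1, h2, h3⟩ := h L (hL1.trans hs) hL2
  obtain ⟨g, hg, hgu⟩ := exists_isShift_of_creation hB hI h1
    fun y hy f hf => h3 f (hL3 y hy f hf)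
  exact ⟨g, hg, fun y hy => (hgu y hy y y.self_mem_subterms).trans (h2 y hy)⟩

/-- Two realized maps on `I` differ by an endomorphism. -/
theorem IsRealized.exists_isShift_comp (hB : IsBaseInstance B) {s K k : ℕ} {I : Set (GTerm S C)}
    {ζ η e : GTerm S C → GTerm S C} (h : IsRealized P B s K I η) (hfin : I.Finite)
    (hI : ∀ y ∈ I, ζ y ∈ terms (obLim P B)) (hk : ∀ y ∈ I, (ζ y).depth ≤ k)
    (he : IsEndo P B e) (heζ : ∀ y ∈ I, e (ζ y) = y)
    (hs : I.ncard * sizeBound P k ≤ s) : ∃ g, IsShift P B K g ∧ ∀ y ∈ I, g (ζ y) = η y := by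
  have hinj : Set.InjOn ζ I := fun y hy y' hy' h => by rw [← heζ y hy, h, heζ y' hy']
  have h' : IsRealized P B s K (ζ '' I) (η ∘ e) := h.precomp he (by
    rintro _ ⟨y, hy, rfl⟩; rwa [heζ y hy])
  obtain ⟨g, hg, hgI⟩ := h'.exists_isShift hB (k := k) (hfin.image ζ)
    (by rintro _ ⟨y, hy, rfl⟩; exact hI y hy) (by rintro _ ⟨y, hy, rfl⟩; exact hk y hy)
    (by rwa [hinj.ncard_image])
  exact ⟨g, hg, fun y hy => by rw [hgI _ ⟨y, hy, rfl⟩, Function.comp, heζ y hy]⟩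

end RealizedMaps

section Derivations

variable {S : Signature.{u}} {C : Type v} {P : Program S} {B : Inst S C}

/-- One more than a bound for the number of body atoms. -/
def bodyBound (P : Program S) : ℕ := P.sup (fun r => r.body.length) + 1

/-- Finitely many facts of a round of the chase derive from a bounded number of base facts. -/
theorem exists_support {t : ℕ} {f : GroundFact S C} (hf : f ∈ ob P B t) :
    ∃ L : List (GroundFact S C), L.length ≤ bodyBound P ^ t ∧
      (∀ g ∈ L, g ∈ B ∧ (g.pred ∈ bodyPreds P ∨ g = f)) ∧ f ∈ ob P {g | g ∈ L} t := by
  induction t generalizing f with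
  | zero =>
    refine ⟨[f], by simp, ?_, by simp [ob]⟩
    intro g hg
    obtain rfl := List.mem_singleton.1 hg
    exact ⟨hf, Or.inr rfl⟩
  | succ t ih =>
    rcases mem_ob_succ.1 hf with hf | ⟨r, hr, h, ht, rfl⟩
    · obtain ⟨L, h1, h2, h3⟩ := ih hf
      exact ⟨L, h1.trans (Nat.pow_le_pow_right (Nat.succ_pos _) (Nat.le_succ _)), h2,
        ob_subset_succ _ h3⟩
    · have := fun A : {A // A ∈ r.body} => ih (ht A.1 A.2)
      choose L h1 h2 h3 using this
      refine ⟨r.body.attach.flatMap L, ?_, ?_, ?_⟩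
      · refine (List.length_flatMap_le _ _ _ fun A _ => h1 A).trans ?_
        rw [List.length_attach, Nat.pow_succ']
        refine Nat.mul_le_mul_right _ (Nat.le_succ_of_le ?_)
        exact Finset.le_sup (f := fun r : Rule S => r.body.length) hr
      · intro g hg
        obtain ⟨A, _, hA⟩ := List.mem_flatMap.1 hg
        refine ⟨(h2 A g hA).1, Or.inl ?_⟩
        rcases (h2 A g hA).2 with h | rfl
        · exact h
        · exact ⟨r, hr, A.1, A.2, rfl⟩
      · refine headFact_mem_ob hr fun A hA => ?_
        refine ob_mono_base (fun g hg => ?_) t (h3 ⟨A, hA⟩)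
        exact List.mem_flatMap.2 ⟨⟨A, hA⟩, List.mem_attach _ _, hg⟩

theorem exists_support_list {t s : ℕ} {A : List (GroundFact S C)} (hs : A.length ≤ s)
    (hA : ∀ f ∈ A, f ∈ ob P B t) :
    ∃ L : List (GroundFact S C), L.length ≤ s * bodyBound P ^ t ∧
      (∀ g ∈ L, g ∈ B ∧ (g.pred ∈ bodyPreds P ∨ g ∈ A)) ∧ ∀ f ∈ A, f ∈ ob P {g | g ∈ L} t := by
  have := fun f : {f // f ∈ A} => exists_support (hA f.1 f.2)
  choose L h1 h2 h3 using this
  refine ⟨A.attach.flatMap L, ?_, ?_, ?_⟩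
  · refine (List.length_flatMap_le _ _ _ fun f _ => h1 f).trans ?_
    rw [List.length_attach]
    exact Nat.mul_le_mul_right _ hs
  · intro g hg
    obtain ⟨f, _, hf⟩ := List.mem_flatMap.1 hg
    refine ⟨(h2 f g hf).1, (h2 f g hf).2.imp_right ?_⟩
    rintro rfl; exact f.2
  · intro f hf
    refine ob_mono_base (fun g hg => ?_) t (h3 ⟨f, hf⟩)
    exact List.mem_flatMap.2 ⟨⟨f, hf⟩, List.mem_attach _ _, hg⟩

end Derivations

section Copies

variable {S : Signature.{u}} {C : Type v} {P : Program S} {B : Inst S C} {q : ℕ}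

open Classical in
/-- The embedding into the `j`-th copy of the constants; the copies agree on `U`. -/
noncomputable def copyMap (U : Set C) (j : Fin q) (c : C) : C ⊕ (Fin q × C) :=
  if c ∈ U then Sum.inl c else Sum.inr (j, c)

/-- The projection of the copies of the constants. -/
def foldCopy : C ⊕ (Fin q × C) → C := Sum.elim id Prod.snd

theorem foldCopy_copyMap (U : Set C) (j : Fin q) (c : C) : foldCopy (copyMap U j c) = c := by
  unfold copyMap; split <;> rfl

/-- The base instance that consists of `B` and `q` further copies of `B`, glued along `U`. -/
def copyInst (U : Set C) (q : ℕ) (B : Inst S C) : Inst S (C ⊕ (Fin q × C)) :=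
  {f | ∃ f' ∈ B, f = f'.map (GTerm.mapC Sum.inl) ∨ ∃ j, f = f'.map (GTerm.mapC (copyMap U j))}

theorem isBaseInstance_copyInst (hB : IsBaseInstance B) (U : Set C) :
    IsBaseInstance (copyInst U q B) := by
  constructor
  · have hfin : ((fun f => f.map (GTerm.mapC Sum.inl)) '' B ∪
        ⋃ j : Fin q, (fun f => f.map (GTerm.mapC (copyMap U j))) '' B).Finite :=
      (hB.1.image _).union (Set.finite_iUnion fun j => hB.1.image _)
    refine hfin.subset ?_
    rintro f ⟨f', hf', rfl | ⟨j, rfl⟩⟩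
    · exact Or.inl ⟨f', hf', rfl⟩
    · exact Or.inr (Set.mem_iUnion.2 ⟨j, f', hf', rfl⟩)
  · have key : ∀ (e : C → C ⊕ (Fin q × C)), ∀ f' ∈ B, ∀ i,
        ∃ c, (PredAtom.map (GTerm.mapC e) f').args i = GTerm.const c := fun e f' hf' i => by
      obtain ⟨c, hc⟩ := (hB.2 f' hf').2 i
      exact ⟨e c, by simp [PredAtom.map, hc, GTerm.mapC]⟩
    rintro f ⟨f', hf', rfl | ⟨j, rfl⟩⟩
    · exact ⟨(hB.2 f' hf').1, key _ f' hf'⟩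
    · exact ⟨(hB.2 f' hf').1, key _ f' hf'⟩

theorem map_inl_mem_obLim (U : Set C) {f : GroundFact S C} (hf : f ∈ obLim P B) :
    f.map (GTerm.mapC Sum.inl) ∈ obLim P (copyInst U q B) :=
  obLim_mapC _ (B' := copyInst U q B) (fun f hf => ⟨f, hf, Or.inl rfl⟩) hf

theorem map_copyMap_mem_obLim (U : Set C) (j : Fin q) {f : GroundFact S C}
    (hf : f ∈ obLim P B) : f.map (GTerm.mapC (copyMap U j)) ∈ obLim P (copyInst U q B) :=
  obLim_mapC _ (B' := copyInst U q B) (fun f hf => ⟨f, hf, Or.inr ⟨j, rfl⟩⟩) hf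

theorem PredAtom.map_mapC_eq_self {C' : Type*} {e : C → C'} {e' : C' → C} (h : ∀ c, e' (e c) = c)
    (f : GroundFact S C) : (f.map (GTerm.mapC e)).map (GTerm.mapC e') = f := by
  rw [PredAtom.map_map]
  refine PredAtom.map_eq_self fun i => ?_
  rw [Function.comp, GTerm.mapC_mapC, show e' ∘ e = id from funext h, GTerm.mapC_id]

theorem map_foldCopy_mem (U : Set C) {f : GroundFact S (C ⊕ (Fin q × C))}
    (hf : f ∈ copyInst U q B) : f.map (GTerm.mapC foldCopy) ∈ B := by
  obtain ⟨f', hf', rfl | ⟨j, rfl⟩⟩ := hf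
  · rwa [PredAtom.map_mapC_eq_self fun _ => rfl]
  · rwa [PredAtom.map_mapC_eq_self (foldCopy_copyMap U j)]

end Copies

section PartTypes

variable {S : Signature.{u}} {C : Type v} {P : Program S} {B : Inst S C}

open Classical in
/-- The position of a term in a list of terms. -/
noncomputable def termCode (T : List (GTerm S C)) (y : GTerm S C) : ℕ := T.idxOf y

theorem getElem?_termCode {T : List (GTerm S C)} {y : GTerm S C} (h : y ∈ T) :
    T[termCode T y]? = some y := by
  classical
  unfold termCode
  rw [List.getElem?_eq_getElem (List.idxOf_lt_length_iff.2 h), List.getElem_idxOf]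

theorem termCode_lt_length {T : List (GTerm S C)} {y : GTerm S C} (h : y ∈ T) :
    termCode T y < T.length := by
  classical
  exact List.idxOf_lt_length_iff.2 h

theorem termCode_append {T T' : List (GTerm S C)} {y : GTerm S C} (h : y ∈ T) :
    termCode (T ++ T') y = termCode T y := by
  classical
  exact List.idxOf_append_of_mem h

/-- The terms of a list of facts. -/
def argList {T : Type*} (A : List (PredAtom S T)) : List T := A.flatMap fun f => List.ofFn f.args

theorem mem_argList {T : Type*} {A : List (PredAtom S T)} {f : PredAtom S T} (hf : f ∈ A)
    (i : Fin (S.arity f.pred)) : f.args i ∈ argList A :=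
  List.mem_flatMap.2 ⟨f, hf, by simp⟩

theorem length_argList_le {T : Type*} {A : List (PredAtom S T)} {n a : ℕ} (hn : A.length ≤ n)
    (ha : ∀ f ∈ A, S.arity f.pred ≤ a) : (argList A).length ≤ n * a :=
  (List.length_flatMap_le _ _ a fun f hf => by rw [List.length_ofFn]; exact ha f hf).trans
    (Nat.mul_le_mul_right _ hn)

/-- The type of a list `A` of facts: its shape, the positions of its constants in `T`, and the
patterns over these constants that occur in the base instance. -/
noncomputable def partType (P : Program S) (B : Inst S C) (N n : ℕ) (T : List (GTerm S C))
    (A : List (GroundFact S C)) : List (PredAtom S ℕ) × Set ℕ × Set (List (PredAtom S ℕ)) :=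
  (A.map fun f => f.map (termCode T), {i | ∃ c, T[i]? = some (.const c)},
    {pat | (pat.length ≤ N ∧ ∀ a ∈ pat, a ∈ {a : PredAtom S ℕ | a.pred ∈ bodyPreds P ∧
      ∀ i, a.args i ∈ Set.Iio n}) ∧ ∃ e : ℕ → C, (∀ i c, T[i]? = some (.const c) → e i = c) ∧
      ∀ a ∈ pat, a.map (fun i => GTerm.const (e i)) ∈ B})

theorem exists_finite_partType (P : Program S) (s N n n₁ : ℕ) :
    ∃ F : Set (List (PredAtom S ℕ) × Set ℕ × Set (List (PredAtom S ℕ))), F.Finite ∧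
      ∀ (C : Type v) (B : Inst S C) (T : List (GTerm S C)) (A : List (GroundFact S C)),
        A.length ≤ s → (∀ f ∈ A, f.pred ∈ headPreds P) → T.length ≤ n₁ →
        (∀ y ∈ argList A, y ∈ T) → partType P B N n T A ∈ F := by
  refine ⟨_, (finite_list_of_mem (finite_predAtom (headPreds_finite P) (Set.finite_Iio n₁)) s).prod
    ((Set.finite_Iio n₁).finite_subsets.prod (finite_list_of_mem (finite_predAtom
      (bodyPreds_finite P) (Set.finite_Iio n)) N).finite_subsets), ?_⟩
  intro C B T A hs hp hT hA
  refine ⟨⟨by simpa [partType] using hs, ?_⟩, ?_, fun pat hpat => hpat.1⟩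
  · intro a ha
    obtain ⟨f, hf, rfl⟩ := List.mem_map.1 ha
    exact ⟨hp f hf, fun i => (termCode_lt_length (hA _ (mem_argList hf i))).trans_le hT⟩
  · rintro i ⟨c, hc⟩
    exact (List.getElem?_eq_some_iff.1 hc).1.trans_le hT

/-- Parts of the same type have a renaming of constants between them that maps a given finite part
of the base instance into the base instance. -/
theorem exists_renaming_of_partType_eq [Nonempty C] {N n b : ℕ} {T T' : List (GTerm S C)}
    {A A' : List (GroundFact S C)} (h : partType P B N n T A = partType P B N n T' A')
    (hB : IsBaseInstance B) {L : List (GroundFact S C)} (hL : ∀ f ∈ L, f ∈ B)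
    (hLN : L.length ≤ N) (hLp : ∀ f ∈ L, f.pred ∈ bodyPreds P)
    (hb : ∀ p ∈ bodyPreds P, S.arity p ≤ b) (hn : T.length + N * b ≤ n) :
    ∃ θ : C → C, (∀ c, .const c ∈ T → T'[termCode T (.const c)]? = some (.const (θ c))) ∧
      ∀ f ∈ L, f.map (GTerm.mapC θ) ∈ B := by
  classical
  simp only [partType, Prod.mk.injEq] at h
  obtain ⟨-, h2, h3⟩ := h
  let cst : GTerm S C → C := fun y => match y with
    | .const c => c
    | .null _ _ _ => Classical.arbitrary C
  let T₂ := T ++ argList L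
  have hT₂ : T₂.length ≤ n := by
    rw [List.length_append]
    exact (Nat.add_le_add_left (length_argList_le hLN fun f hf => hb _ (hLp f hf)) _).trans hn
  let pat : List (PredAtom S ℕ) := L.map fun f => f.map (termCode T₂)
  have hpat := Set.ext_iff.1 h3 pat
  simp only [Set.mem_ofPred_eq] at hpat
  obtain ⟨_, e', he1, he2⟩ := hpat.1 ⟨⟨by simpa [pat] using hLN, fun a ha => by
      obtain ⟨f, hf, rfl⟩ := List.mem_map.1 ha
      exact ⟨hLp f hf, fun i => (termCode_lt_length
        (List.mem_append_right _ (mem_argList hf i))).trans_le hT₂⟩⟩,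
    fun i => cst (T₂.getD i (.const (Classical.arbitrary C))), fun i c hc => by
      have hc' : T₂[i]? = some (.const c) := by
        rw [List.getElem?_append_left (List.getElem?_eq_some_iff.1 hc).1, hc]
      simp only [List.getD_eq_getElem?_getD, hc']
      rfl, fun a ha => by
      obtain ⟨f, hf, rfl⟩ := List.mem_map.1 ha
      rw [PredAtom.map_map]
      have : f.map ((fun i => GTerm.const (cst (T₂.getD i (.const (Classical.arbitrary C))))) ∘
          termCode T₂) = f := PredAtom.map_eq_self fun i => by
        obtain ⟨c, hc⟩ := (hB.2 f (hL f hf)).2 i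
        have hm : f.args i ∈ T₂ := List.mem_append_right _ (mem_argList hf i)
        simp only [Function.comp, List.getD_eq_getElem?_getD, getElem?_termCode hm]
        rw [hc]
        rfl
      rw [this]; exact hL f hf⟩
  refine ⟨fun c => e' (termCode T₂ (.const c)), fun c hc => ?_, fun f hf => ?_⟩
  · have hi : termCode T (.const c) ∈ {i | ∃ c, T[i]? = some (GTerm.const c)} :=
      ⟨c, getElem?_termCode hc⟩
    rw [h2] at hi
    obtain ⟨c', hc'⟩ := hi
    have hcode : termCode T₂ (.const c) = termCode T (.const c) := termCode_append hc
    change _ = some (GTerm.const (e' (termCode T₂ (.const c))))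
    rw [hcode, he1 _ c' hc', hc']
  · have := he2 _ (List.mem_map.2 ⟨f, hf, rfl⟩)
    rw [PredAtom.map_map] at this
    convert this using 1
    refine PredAtom.map_congr fun i => ?_
    obtain ⟨c, hc⟩ := (hB.2 f (hL f hf)).2 i
    rw [Function.comp, hc, GTerm.mapC]

end PartTypes

section UniformRealization

variable {S : Signature.{u}} {C : Type v} {P : Program S} {B : Inst S C}

theorem exists_copy_avoiding {q n : ℕ} (L : List (C ⊕ (Fin q × C))) (hL : L.length ≤ n)
    (hq : n < q) : ∃ j : Fin q, ∀ c, Sum.inr (j, c) ∉ L := by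
  classical
  by_contra! h
  choose c hc using h
  have h1 : (Finset.univ.image fun j : Fin q => (Sum.inr (j, c j) : C ⊕ (Fin q × C))).card ≤
      L.toFinset.card := Finset.card_le_card fun x hx => by
    obtain ⟨j, _, rfl⟩ := Finset.mem_image.1 hx
    exact List.mem_toFinset.2 (hc j)
  rw [Finset.card_image_of_injective _ (fun j j' h => by
    simp only [Sum.inr.injEq, Prod.mk.injEq] at h; exact h.1), Finset.card_univ,
    Fintype.card_fin] at h1
  have := L.toFinset_card_le
  omega

/-- A realization for one list `A₀` of facts yields an endomorphism that turns `g` on `I` into a map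
that works for all lists of the same type. -/
theorem exists_isShift_of_partType [Nonempty C] (hB : IsBaseInstance B) {k : ℕ}
    {Y : Set (GTerm S C)} {ρ : GTerm S C → GTerm S C} (hY : IsCore P B k Y ρ)
    {I : Set (GTerm S C)} (hI : I ⊆ Y) {m s K q N n b : ℕ} (hm : I.ncard ≤ m)
    (hK : ∀ (C' : Type v) [Nonempty C'] (B' : Inst S C'), IsBaseInstance B' →
      ∀ A : List (GroundFact S C'), A.length ≤ q * s + m * sizeBound P k →
      (∀ f ∈ A, f ∈ obLim P B') →
      ∃ σ, FixesConst σ ∧ ∀ f ∈ A, f.map σ ∈ ob P B' K ∧ ∀ i, (σ (f.args i)).depth ≤ k)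
    (hq : m * sizeBound P k < q) {T₀ : List (GTerm S C)}
    (hT₀ : ∀ y ∈ I, ∀ u ∈ y.subterms, u ∈ T₀) (hN : s * bodyBound P ^ K ≤ N)
    (hb : ∀ p ∈ bodyPreds P, S.arity p ≤ b)
    (hn : T₀.length + s * headArity P + N * b ≤ n)
    {g : GTerm S C → GTerm S C} (hg : IsEndo P B g) (hgk : ∀ y ∈ I, (g y).depth ≤ k)
    {A₀ : List (GroundFact S C)} (hA₀s : A₀.length ≤ s) (hA₀ : ∀ f ∈ A₀, f ∈ obLim P B)
    (hA₀p : ∀ f ∈ A₀, f.pred ∈ headPreds P) :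
    ∃ η, IsShift P B K η ∧ (∀ y ∈ I, (η (g y)).depth ≤ k) ∧
      ∀ A : List (GroundFact S C), A.length ≤ s → (∀ f ∈ A, f ∈ obLim P B) →
        partType P B N n (T₀ ++ argList A₀) A₀ = partType P B N n (T₀ ++ argList A) A →
        ∃ σ, FixesConst σ ∧ (∀ y ∈ I, σ y = η (g y)) ∧ ∀ f ∈ A, f.map σ ∈ ob P B K := by
  classical
  have hIfin : I.Finite := hY.finite.subset hI
  let U : Set C := {c | .const c ∈ T₀}
  let B' : Inst S (C ⊕ (Fin q × C)) := copyInst U q B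
  have hB' : IsBaseInstance B' := isBaseInstance_copyInst hB U
  obtain ⟨g', hg', _, hg'g⟩ := hY.exists_inverse g hg
  have hgX : ∀ y ∈ I, g y ∈ terms (obLim P B) := fun y hy => hg.mem_terms (hY.subset (hI hy))
  obtain ⟨L, hL1, hL2, hL3⟩ := exists_creation_list hB (hIfin.image g)
    (by rintro _ ⟨y, hy, rfl⟩; exact hgX y hy) (k := k)
    (by rintro _ ⟨y, hy, rfl⟩; exact hgk y hy)
  have hL1' : L.length ≤ m * sizeBound P k := hL1.trans
    (Nat.mul_le_mul_right _ ((Set.ncard_image_le hIfin).trans hm))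
  let A₁ : List (GroundFact S (C ⊕ (Fin q × C))) :=
    (Finset.univ : Finset (Fin q)).toList.flatMap (fun j =>
      A₀.map fun f => f.map (GTerm.mapC (copyMap U j))) ++
      L.map fun f => (f.map g').map (GTerm.mapC Sum.inl)
  obtain ⟨σ, hσ, hσA⟩ := hK _ B' hB' A₁ (by
    rw [List.length_append, List.length_map]
    refine Nat.add_le_add ?_ hL1'
    refine (List.length_flatMap_le _ _ s fun j _ => by simpa using hA₀s).trans ?_
    simp) (by
    intro f hf
    rcases List.mem_append.1 hf with hf | hf
    · obtain ⟨j, _, hf⟩ := List.mem_flatMap.1 hf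
      obtain ⟨f', hf', rfl⟩ := List.mem_map.1 hf
      exact map_copyMap_mem_obLim U j (hA₀ f' hf')
    · obtain ⟨f', hf', rfl⟩ := List.mem_map.1 hf
      exact map_inl_mem_obLim U (hg'.2 _ (hL2 f' hf')))
  have hσA₀ : ∀ j, ∀ f ∈ A₀, (f.map (GTerm.mapC (copyMap U j))).map σ ∈ ob P B' K := fun j f hf =>
    (hσA _ (List.mem_append_left _ (List.mem_flatMap.2 ⟨j, by simp,
      List.mem_map.2 ⟨f, hf, rfl⟩⟩))).1
  have hσL : ∀ f ∈ L, ((f.map g').map (GTerm.mapC Sum.inl)).map σ ∈ ob P B' K ∧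
      ∀ i, (σ ((g' (f.args i)).mapC Sum.inl)).depth ≤ k := fun f hf =>
    hσA _ (List.mem_append_right _ (List.mem_map.2 ⟨f, hf, rfl⟩))
  let τ : GTerm S C → GTerm S C := fun w => (σ ((g' w).mapC Sum.inl)).mapC foldCopy
  have hτ : FixesConst τ := fun c => by
    simp only [τ, hg'.1 c, GTerm.mapC]
    rw [hσ]; rfl
  obtain ⟨η, hη, hηg⟩ := exists_isShift_of_creation hB (Z := g '' I) (K := K)
    (by rintro _ ⟨y, hy, rfl⟩; exact hgX y hy) hτ (fun y hy f hf => by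
      have := ob_mapC foldCopy (fun f hf => map_foldCopy_mem U hf) (hσL f (hL3 y hy f hf)).1
      simp only [PredAtom.map_map] at this
      exact this)
  have hζ : ∀ y ∈ I, η (g y) = (σ (y.mapC Sum.inl)).mapC foldCopy := fun y hy => by
    rw [hηg _ ⟨y, hy, rfl⟩ _ (GTerm.self_mem_subterms _)]
    simp only [τ, hg'g y (hI hy)]
  have hσI : ∀ y ∈ I, (∃ c, y = .const c) ∨
      (σ (y.mapC Sum.inl)).depth ≤ k ∧ σ (y.mapC Sum.inl) ∈ terms (ob P B' K) := fun y hy => by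
    cases hgy : g y with
    | const c =>
      left
      refine ⟨c, ?_⟩
      rw [← hg'g y (hI hy), hgy, hg'.1]
    | null r h z =>
      right
      obtain ⟨_, hz, ⟨i, hi⟩, _⟩ := null_mem_terms_obLim hB (hgy ▸ hgX y hy)
      have hfL : r.headFact h ∈ L := hL3 (g y) ⟨y, hy, rfl⟩ _
        (GTerm.headFact_mem_creation (by rw [hgy]; exact GTerm.self_mem_subterms _))
      have harg : g' ((r.headFact h).args i) = y := by
        change g' (r.skolemExt h (r.head.args i)) = y
        rw [hi, Rule.skolemExt_of_notMem hz, ← hgy, hg'g y (hI hy)]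
      have h1 := (hσL _ hfL).2 i
      rw [harg] at h1
      refine ⟨h1, _, (hσL _ hfL).1, i, ?_⟩
      change σ ((g' ((r.headFact h).args i)).mapC Sum.inl) = _
      rw [harg]
  obtain ⟨j, hj⟩ := exists_copy_avoiding (hIfin.toFinset.toList.flatMap
    fun y => (σ (y.mapC (Sum.inl : C → C ⊕ (Fin q × C)))).consts) (n := m * sizeBound P k) (by
      refine (List.length_flatMap_le _ _ (sizeBound P k) fun y hy => ?_).trans ?_
      · have hy : y ∈ I := by simpa using hy
        rcases hσI y hy with ⟨c, rfl⟩ | ⟨h1, h2⟩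
        · rw [GTerm.mapC, hσ]
          have : ((GTerm.const (Sum.inl c) : GTerm S (C ⊕ (Fin q × C)))).consts.length ≤ 1 :=
            (List.length_filterMap_le _ _).trans (by simp [GTerm.subterms])
          exact this.trans (Nat.one_le_pow _ _ (Nat.succ_pos _))
        · exact length_consts_le hB' (terms_mono (ob_subset_obLim _) h2) h1
      · rw [Finset.length_toList, ← Set.ncard_eq_toFinset_card I hIfin]
        exact Nat.mul_le_mul_right _ hm) hq
  have hj' : ∀ y ∈ I, ∀ c, Sum.inr (j, c) ∉ (σ (y.mapC Sum.inl)).consts := fun y hy c hc =>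
    hj c (List.mem_flatMap.2 ⟨y, by simpa using hy, hc⟩)
  refine ⟨η, hη, fun y hy => ?_, fun A hAs hA htype => ?_⟩
  · rw [hζ y hy, GTerm.depth_mapC]
    rcases hσI y hy with ⟨c, rfl⟩ | ⟨h1, _⟩
    · rw [GTerm.mapC, hσ]
      exact (GTerm.depth_pos _).trans (hY.depth_le _ (hI hy))
    · exact h1
  obtain ⟨L', hL'1, hL'2, hL'3⟩ := exists_support_list
    (A := A₀.map fun f => (f.map (GTerm.mapC (copyMap U j))).map σ) (P := P) (B := B') (t := K)
    (s := s) (by simpa using hA₀s) (by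
      intro f hf
      obtain ⟨f', hf', rfl⟩ := List.mem_map.1 hf
      exact hσA₀ j f' hf')
  have hL'p : ∀ f ∈ L', f.pred ∈ bodyPreds P := fun f hf => by
    rcases (hL'2 f hf).2 with h | h
    · exact h
    · obtain ⟨f', hf', rfl⟩ := List.mem_map.1 h
      obtain ⟨r, hr, e⟩ := hA₀p f' hf'
      have h1 := (hB'.2 _ (hL'2 _ hf).1).1
      have h2 : f'.pred ∈ S.intensional := e ▸ r.head_intensional
      exact absurd h2 (Set.disjoint_left.1 S.disjoint h1)
  obtain ⟨θ, hθ1, hθ2⟩ := exists_renaming_of_partType_eq htype hB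
    (L := L'.map fun f => f.map (GTerm.mapC foldCopy))
    (by
      intro f hf
      obtain ⟨f', hf', rfl⟩ := List.mem_map.1 hf
      exact map_foldCopy_mem U (hL'2 f' hf').1)
    (by simpa using hL'1.trans hN)
    (by
      intro f hf
      obtain ⟨f', hf', rfl⟩ := List.mem_map.1 hf
      exact hL'p f' hf') hb (by
      refine le_trans (Nat.add_le_add_right ?_ _) hn
      rw [List.length_append]
      exact Nat.add_le_add_left
        (length_argList_le hA₀s fun f hf => arity_le_headArity (hA₀p f hf)) _)
  have hθU : ∀ c ∈ U, θ c = c := fun c hc => by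
    have h1 := hθ1 c (List.mem_append_left _ hc)
    have hc' : (GTerm.const c : GTerm S C) ∈ T₀ := hc
    rw [termCode_append hc', ← termCode_append (T' := argList A) hc',
      getElem?_termCode (List.mem_append_left _ hc')] at h1
    simpa using h1.symm
  let e : C ⊕ (Fin q × C) → C := Sum.elim id fun p => if p.1 = j then θ p.2 else p.2
  have he : ∀ c, e (copyMap U j c) = θ c := fun c => by
    unfold copyMap
    by_cases hc : c ∈ U
    · rw [if_pos hc, hθU c hc]; rfl
    · rw [if_neg hc]; simp [e]
  have heL : ∀ f ∈ L', f.map (GTerm.mapC e) ∈ B := fun f hf => by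
    have hfB := (hL'2 f hf).1
    have hfθ := hθ2 _ (List.mem_map.2 ⟨f, hf, rfl⟩)
    obtain ⟨f', hf', rfl | ⟨i, rfl⟩⟩ := hfB
    · rwa [PredAtom.map_mapC_eq_self fun _ => rfl]
    · by_cases hij : i = j
      · subst hij
        rw [PredAtom.map_mapC_eq_self (foldCopy_copyMap U i)] at hfθ
        convert hfθ using 1
        rw [PredAtom.map_map]
        refine PredAtom.map_congr fun l => ?_
        rw [Function.comp, GTerm.mapC_mapC, show e ∘ copyMap U i = θ from funext he]
      · rwa [PredAtom.map_mapC_eq_self fun c => ?_]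
        unfold copyMap
        split
        · rfl
        · simp [e, hij]
  have heK : ∀ f ∈ A₀, ((f.map (GTerm.mapC (copyMap U j))).map σ).map (GTerm.mapC e) ∈
      ob P B K := fun f hf =>
    ob_mapC e heL (hL'3 _ (List.mem_map.2 ⟨f, hf, rfl⟩))
  let T := T₀ ++ argList A₀
  let T' := T₀ ++ argList A
  let dec : GTerm S C → GTerm S C := fun w =>
    T.getD (termCode T' w) (.const (Classical.arbitrary C))
  let Φ : GTerm S C → GTerm S C := fun w => (σ (w.mapC (copyMap U j))).mapC e
  have htype' := htype
  simp only [partType, Prod.mk.injEq] at htype'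
  have hshape : ∀ f ∈ A, f.map dec ∈ A₀ ∧ ∀ i, T[termCode T' (f.args i)]? = some (dec (f.args i)) ∧
      termCode T (dec (f.args i)) = termCode T' (f.args i) := fun f hf => by
    have h1 : f.map (termCode T') ∈ A₀.map fun f => f.map (termCode T) := by
      rw [htype'.1]; exact List.mem_map.2 ⟨f, hf, rfl⟩
    obtain ⟨f₀, hf₀, h2⟩ := List.mem_map.1 h1
    have hd : ∀ w ∈ T, T.getD (termCode T w) (.const (Classical.arbitrary C)) = w := fun w hw => by
      rw [List.getD_eq_getElem?_getD, getElem?_termCode hw]; rfl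
    constructor
    · have h3 : f.map dec = (f.map (termCode T')).map
          fun n => T.getD n (.const (Classical.arbitrary C)) := rfl
      rw [h3, ← h2, PredAtom.map_map, PredAtom.map_eq_self]
      · exact hf₀
      · exact fun i => hd _ (List.mem_append_right _ (mem_argList hf₀ i))
    · intro i
      obtain ⟨i', hi'⟩ := PredAtom.exists_args_eq h2.symm i
      change termCode T' (f.args i) = termCode T (f₀.args i') at hi'
      have hm : f₀.args i' ∈ T := List.mem_append_right _ (mem_argList hf₀ i')
      have h4 : dec (f.args i) = f₀.args i' := by
        simp only [dec]; rw [hi', hd _ hm]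
      rw [h4, hi', getElem?_termCode hm]
      exact ⟨rfl, rfl⟩
  let σ' : GTerm S C → GTerm S C := fun w =>
    if w ∈ I then η (g w) else match w with
      | .const c => .const c
      | .null r h z => Φ (dec (.null r h z))
  refine ⟨σ', fun c => ?_, fun y hy => if_pos hy, fun f hf => ?_⟩
  · simp only [σ']
    split
    · rw [hg.1, hη.1]
    · rfl
  obtain ⟨hf0, hfi⟩ := hshape f hf
  have hΦ : f.map σ' = (((f.map dec).map (GTerm.mapC (copyMap U j))).map σ).map (GTerm.mapC e) := by
    simp only [PredAtom.map_map]
    refine PredAtom.map_congr fun i => ?_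
    change σ' (f.args i) = Φ (dec (f.args i))
    have hwT' : f.args i ∈ T' := List.mem_append_right _ (mem_argList hf i)
    by_cases hwI : f.args i ∈ I
    · have hw0 : f.args i ∈ T₀ := hT₀ _ hwI _ (GTerm.self_mem_subterms _)
      have hdw : dec (f.args i) = f.args i := by
        have h5 := (hfi i).1
        rw [termCode_append hw0, ← termCode_append (T' := argList A₀) hw0,
          getElem?_termCode (List.mem_append_left _ hw0)] at h5
        exact (Option.some.inj h5).symm
      rw [hdw]
      simp only [σ', if_pos hwI, Φ]
      rw [hζ _ hwI]
      have h6 : (f.args i).mapC (copyMap U j) = (f.args i).mapC Sum.inl :=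
        GTerm.mapC_congr fun c hc => if_pos (hT₀ _ hwI _ (GTerm.mem_consts.1 hc))
      rw [h6]
      refine GTerm.mapC_congr fun c hc => ?_
      rcases c with c | ⟨i', c⟩
      · rfl
      · have : i' ≠ j := by rintro rfl; exact hj' _ hwI c hc
        simp [e, foldCopy, this]
    · simp only [σ', if_neg hwI]
      cases hw : f.args i with
      | null r h z => rfl
      | const c =>
        have h5 := getElem?_termCode hwT'
        have h6 : termCode T' (f.args i) ∈ {i | ∃ c, T'[i]? = some (GTerm.const c)} :=
          ⟨c, by rw [h5, hw]⟩
        rw [← htype'.2.1] at h6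
        obtain ⟨c₀, hc₀⟩ := h6
        have h7 := (hfi i).1.symm.trans hc₀
        have h8 : dec (f.args i) = .const c₀ := Option.some.inj h7
        have h9 := hθ1 c₀ (by rw [← h8]; exact List.mem_of_getElem? (hfi i).1)
        have h10 := (hfi i).2
        rw [h8] at h10
        change T'[termCode T _]? = _ at h9
        rw [h10, h5, hw] at h9
        change GTerm.const c = Φ (dec (.const c))
        rw [← hw, h8, hw]
        simp only [Φ, GTerm.mapC, hσ _, he]
        exact Option.some.inj h9
  rw [hΦ]
  exact heK _ hf0

/-- Small sets of core terms have realizations in a round whose number does not depend on the base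
instance. -/
theorem exists_isRealized [Nonempty C] {k : ℕ} (hR : FinitelyRealizable.{u, v} P k) (m s : ℕ) :
    ∃ K, ∀ B : Inst S C, IsBaseInstance B → ∀ Y ρ, IsCore P B k Y ρ → ∀ I ⊆ Y, I.ncard ≤ m →
      ∃ ζ, IsRealized P B s K I ζ ∧ ∀ y ∈ I, (ζ y).depth ≤ k ∧ ζ y ∈ terms (obLim P B) := by
  classical
  obtain ⟨K, hK⟩ := hR ((m * sizeBound P k + 1) * s + m * sizeBound P k)
  obtain ⟨b, hb⟩ := exists_uniform_bound (bodyPreds_finite P) (p := fun p b => S.arity p ≤ b)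
    (fun p m n hmn h => h.trans hmn) (fun p _ => ⟨_, le_rfl⟩)
  obtain ⟨F, hF, hFmem⟩ := exists_finite_partType.{u, v} P s (s * bodyBound P ^ K)
    (m * sizeBound P k + s * headArity P + s * bodyBound P ^ K * b)
    (m * sizeBound P k + s * headArity P)
  refine ⟨hF.toFinset.card * K, fun B hB Y ρ hY I hI hm => ?_⟩
  have hIfin : I.Finite := hY.finite.subset hI
  let T₀ : List (GTerm S C) := hIfin.toFinset.toList.flatMap GTerm.subterms
  have hT₀l : T₀.length ≤ m * sizeBound P k := by
    refine (List.length_flatMap_le _ _ (sizeBound P k) fun y hy => ?_).trans ?_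
    · have hy : y ∈ I := by simpa using hy
      exact length_subterms_le hB (hY.subset (hI hy)) (hY.depth_le _ (hI hy))
    · rw [Finset.length_toList, ← Set.ncard_eq_toFinset_card I hIfin]
      exact Nat.mul_le_mul_right _ hm
  have hT₀ : ∀ y ∈ I, ∀ u ∈ y.subterms, u ∈ T₀ := fun y hy u hu =>
    List.mem_flatMap.2 ⟨y, by simpa using hy, hu⟩
  let type : List (GroundFact S C) → List (PredAtom S ℕ) × Set ℕ × Set (List (PredAtom S ℕ)) :=
    fun A => partType P B (s * bodyBound P ^ K)
      (m * sizeBound P k + s * headArity P + s * bodyBound P ^ K * b) (T₀ ++ argList A) A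
  have key : ∀ F' : Finset (List (PredAtom S ℕ) × Set ℕ × Set (List (PredAtom S ℕ))),
      ∃ g, IsEndo P B g ∧ (∀ y ∈ I, (g y).depth ≤ k) ∧
        ∀ A : List (GroundFact S C), A.length ≤ s → (∀ f ∈ A, f ∈ obLim P B) →
          (∀ f ∈ A, f.pred ∈ headPreds P) → type A ∈ F' →
          ∃ σ, FixesConst σ ∧ (∀ y ∈ I, σ y = g y) ∧ ∀ f ∈ A, f.map σ ∈ ob P B (F'.card * K) := by
    intro F'
    induction F' using Finset.induction_on with
    | empty => exact ⟨id, IsEndo.id, fun y hy => hY.depth_le _ (hI hy), by simp⟩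
    | @insert τ F' hτ ih =>
      obtain ⟨g, hg, hgk, hgA⟩ := ih
      rw [Finset.card_insert_of_notMem hτ]
      by_cases hA₀ : ∃ A₀ : List (GroundFact S C), A₀.length ≤ s ∧ (∀ f ∈ A₀, f ∈ obLim P B) ∧
          (∀ f ∈ A₀, f.pred ∈ headPreds P) ∧ type A₀ = τ
      · obtain ⟨A₀, h1, h2, h3, h4⟩ := hA₀
        obtain ⟨η, hη, hηk, hηA⟩ := exists_isShift_of_partType hB hY hI hm
          (fun C' _ B' hB' A => hK C' B' hB' A) (Nat.lt_succ_self _) hT₀ le_rfl hb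
          (Nat.add_le_add_right (Nat.add_le_add_right hT₀l _) _) hg hgk h1 h2 h3
        refine ⟨η ∘ g, hη.isEndo.comp hg, hηk, fun A hAs hAX hAp hAt => ?_⟩
        rcases Finset.mem_insert.1 hAt with hAt | hAt
        · obtain ⟨σ, hσ1, hσ2, hσ3⟩ := hηA A hAs hAX (h4.trans hAt.symm)
          exact ⟨σ, hσ1, hσ2, fun f hf => ob_mono (Nat.le_mul_of_pos_left _ (Nat.succ_pos _))
            (hσ3 f hf)⟩
        · obtain ⟨σ, hσ1, hσ2, hσ3⟩ := hgA A hAs hAX hAp hAt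
          refine ⟨η ∘ σ, hη.1.comp hσ1, fun y hy => congrArg η (hσ2 y hy), fun f hf => ?_⟩
          rw [← PredAtom.map_map, Nat.succ_mul]
          exact hη.2 _ _ (hσ3 f hf)
      · refine ⟨g, hg, hgk, fun A hAs hAX hAp hAt => ?_⟩
        rcases Finset.mem_insert.1 hAt with hAt | hAt
        · exact absurd ⟨A, hAs, hAX, hAp, hAt⟩ hA₀
        · obtain ⟨σ, hσ1, hσ2, hσ3⟩ := hgA A hAs hAX hAp hAt
          exact ⟨σ, hσ1, hσ2, fun f hf =>
            ob_mono (Nat.mul_le_mul_right _ (Nat.le_succ _)) (hσ3 f hf)⟩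
  obtain ⟨g, hg, hgk, hgA⟩ := key hF.toFinset
  refine ⟨g, fun A hAs hAX => ?_, fun y hy => ⟨hgk y hy, hg.mem_terms (hY.subset (hI hy))⟩⟩
  let A' := A.filter fun f => f.pred ∈ headPreds P
  have hA's : A'.length ≤ s := (List.length_filter_le _ _).trans hAs
  have hA'X : ∀ f ∈ A', f ∈ obLim P B := fun f hf => hAX f (List.mem_filter.1 hf).1
  have hA'p : ∀ f ∈ A', f.pred ∈ headPreds P := fun f hf => by
    simpa using (List.mem_filter.1 hf).2
  obtain ⟨σ, hσ1, hσ2, hσ3⟩ := hgA A' hA's hA'X hA'p (hF.mem_toFinset.2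
    (hFmem C B _ A' hA's hA'p (by
      rw [List.length_append]
      exact Nat.add_le_add hT₀l
        (length_argList_le hA's fun f hf => arity_le_headArity (hA'p f hf)))
      fun y hy => List.mem_append_right _ hy))
  refine ⟨σ, hσ1, hσ2, fun f hf => ?_⟩
  by_cases hp : f.pred ∈ headPreds P
  · exact hσ3 f (List.mem_filter.2 ⟨hf, by simpa using hp⟩)
  · rcases obLim_cases (hAX f hf) with h | ⟨r, hr, h, _, rfl⟩
    · rw [PredAtom.map_eq_self fun i => ?_]
      · exact ob_mono (Nat.zero_le _) h
      · obtain ⟨c, hc⟩ := (hB.2 f h).2 i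
        rw [hc, hσ1]
    · exact absurd ⟨r, hr, rfl⟩ hp

end UniformRealization

section Ranks

variable {S : Signature.{u}} {C : Type v} {P : Program S} {B : Inst S C} {k : ℕ}
  {Y : Set (GTerm S C)} {ρ : GTerm S C → GTerm S C} {κ m s : ℕ}

theorem GTerm.parent_ne {r : Rule S} {h : {x : Var // x ∈ r.bodyVars} → GTerm S C}
    {z : Var} {y : GTerm S C} (hy : GTerm.null r h z ∈ y.subterms)
    (x : {x : Var // x ∈ r.bodyVars}) : h x ≠ y := by
  rintro rfl
  have h1 := GTerm.depth_le_of_mem_subterms hy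
  have h2 := GTerm.depth_lt_null h z x
  omega

/-- A core whose subsets of at most `m` terms are realized in the round `κ`. -/
structure HasRealizations (P : Program S) (B : Inst S C) (k : ℕ) (Y : Set (GTerm S C))
    (ρ : GTerm S C → GTerm S C) (κ m s : ℕ) : Prop where
  base : IsBaseInstance B
  core : IsCore P B k Y ρ
  real : ∀ I ⊆ Y, I.ncard ≤ m → ∃ ζ, IsRealized P B s κ I ζ ∧
    ∀ y ∈ I, (ζ y).depth ≤ k ∧ ζ y ∈ terms (obLim P B)
  size : m * sizeBound P k + 1 ≤ s
  size_pos : 1 ≤ m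

theorem IsRealized.mem_terms {K : ℕ} {I : Set (GTerm S C)} {ζ : GTerm S C → GTerm S C}
    (h : IsRealized P B s K I ζ) (hs : 1 ≤ s) {y : GTerm S C} (hy : y ∈ I)
    (hyX : y ∈ terms (obLim P B)) : ζ y ∈ terms (ob P B K) := by
  obtain ⟨f, hf, i, rfl⟩ := hyX
  obtain ⟨σ, _, h2, h3⟩ := h [f] (by simpa using hs) (by simpa using hf)
  exact ⟨_, h3 f (by simp), i, h2 _ hy⟩

namespace HasRealizations

theorem finite (h : HasRealizations P B k Y ρ κ m s) {I : Set (GTerm S C)} (hI : I ⊆ Y) :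
    I.Finite := h.core.finite.subset hI

theorem exists_isShift (h : HasRealizations P B k Y ρ κ m s) {K : ℕ} {I : Set (GTerm S C)}
    {ζ : GTerm S C → GTerm S C} (hζ : IsRealized P B s K I ζ) (hI : I ⊆ Y) (hm : I.ncard ≤ m) :
    ∃ g, IsShift P B K g ∧ ∀ y ∈ I, g y = ζ y :=
  hζ.exists_isShift h.base (h.finite hI) (hI.trans h.core.subset)
    (fun y hy => h.core.depth_le y (hI hy))
    ((Nat.mul_le_mul_right _ hm).trans ((Nat.le_succ _).trans h.size))

theorem mem_terms (h : HasRealizations P B k Y ρ κ m s) {K : ℕ} {I : Set (GTerm S C)}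
    {ζ : GTerm S C → GTerm S C} (hζ : IsRealized P B s K I ζ) (hI : I ⊆ Y) {y : GTerm S C}
    (hy : y ∈ I) : ζ y ∈ terms (obLim P B) :=
  terms_mono (ob_subset_obLim _)
    (hζ.mem_terms ((Nat.le_add_left _ _).trans h.size) hy (h.core.subset (hI hy)))

theorem exists_inverse (h : HasRealizations P B k Y ρ κ m s) {g : GTerm S C → GTerm S C}
    (hg : IsEndo P B g) : ∃ e, IsEndo P B e ∧ (∀ y ∈ terms (obLim P B), e y ∈ Y) ∧
      (∀ y ∈ Y, e (ρ (g y)) = y) ∧ ∀ y ∈ Y, ρ (g (e y)) = y := by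
  obtain ⟨e, h1, h2, h3⟩ := h.core.exists_inverse _ (h.core.isEndo.comp hg)
  refine ⟨e, h1, h2, h3, fun y hy => ?_⟩
  have hmaps : Set.MapsTo (ρ ∘ g) Y Y := fun y hy =>
    h.core.mapsTo _ (hg.mem_terms (h.core.subset hy))
  have hinj : Set.InjOn (ρ ∘ g) Y := fun y hy y' hy' e' => by
    rw [← h3 y hy, e', h3 y' hy']
  have himage : (ρ ∘ g) '' Y = Y :=
    Set.eq_of_subset_of_ncard_le hmaps.image_subset hinj.ncard_image.ge h.core.finite
  obtain ⟨x, hx, rfl⟩ := himage.ge hy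
  have h4 : e ((ρ ∘ g) x) = x := h3 x hx
  rw [h4]; rfl

/-- The realizations of a subset can be moved to given ones. -/
theorem exists_moved (h : HasRealizations P B k Y ρ κ m s) {I U : Set (GTerm S C)} (hI : I ⊆ Y)
    (hm : I.ncard ≤ m) (hU : U ⊆ I) {ζ : GTerm S C → GTerm S C} (hζ : IsRealized P B s κ U ζ) :
    ∃ ξ, IsRealized P B s (2 * κ) I ξ ∧ ∀ y ∈ U, ξ y = ζ y := by
  obtain ⟨ξ, hξ, hξk⟩ := h.real I hI hm
  obtain ⟨g, hg, hgI⟩ := h.exists_isShift hξ hI hm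
  obtain ⟨e, he, _, he2, _⟩ := h.exists_inverse hg.isEndo
  obtain ⟨μ, hμ, hμU⟩ := hζ.exists_isShift_comp h.base (ζ := ξ) (k := k) (e := e ∘ ρ)
    (h.finite (hU.trans hI)) (fun y hy => (hξk y (hU hy)).2) (fun y hy => (hξk y (hU hy)).1)
    (he.comp h.core.isEndo) (fun y hy => by
      rw [Function.comp, ← hgI y (hU hy)]; exact he2 y (hI (hU hy)))
    ((Nat.mul_le_mul_right _ ((Set.ncard_le_ncard hU (h.finite hI)).trans hm)).trans
      ((Nat.le_succ _).trans h.size))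
  refine ⟨μ ∘ ξ, ?_, hμU⟩
  rw [Nat.two_mul]
  exact hξ.comp_isShift hμ

end HasRealizations

/-- The term `y` has rank at least `n`: it is no constant and, if `0 < n`, it has a realization with
a proper subterm of rank at least `n - 1`. -/
def RankGe (P : Program S) (B : Inst S C) (ρ : GTerm S C → GTerm S C) (s T : ℕ) :
    ℕ → GTerm S C → Prop
  | 0, y => ∀ c, y ≠ .const c
  | n + 1, y => ∃ w, IsRealized P B s T {y} (fun _ => w) ∧
    ∃ u ∈ w.subterms, u ≠ w ∧ RankGe P B ρ s T n (ρ u)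

variable {T : ℕ}

theorem not_rankGe_const (n : ℕ) (c : C) : ¬ RankGe P B ρ s T n (.const c) := by
  cases n with
  | zero => exact fun h => h c rfl
  | succ n =>
    rintro ⟨w, hw, u, hu, hne, _⟩
    obtain ⟨σ, h1, h2, _⟩ := hw [] (Nat.zero_le _) (by simp)
    have : w = .const c := by rw [← h1 c, h2 _ rfl]
    subst this
    exact hne (GTerm.mem_subterms_const.1 hu)

theorem RankGe.of_succ {n : ℕ} {y : GTerm S C} (h : RankGe P B ρ s T (n + 1) y) :
    RankGe P B ρ s T n y := by
  induction n generalizing y with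
  | zero => rintro c rfl; exact not_rankGe_const _ c h
  | succ n ih =>
    obtain ⟨w, hw, u, hu, hne, h⟩ := h
    exact ⟨w, hw, u, hu, hne, ih h⟩

theorem RankGe.of_endo {n : ℕ} {y : GTerm S C} {e : GTerm S C → GTerm S C} (he : IsEndo P B e)
    (h : RankGe P B ρ s T n (e y)) : RankGe P B ρ s T n y := by
  cases n with
  | zero => rintro c rfl; exact h c (he.1 c)
  | succ n =>
    obtain ⟨w, hw, h⟩ := h
    exact ⟨w, hw.precomp he (by rintro _ rfl; rfl), h⟩

/-- The core terms of rank less than `d`. -/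
def level (P : Program S) (B : Inst S C) (Y : Set (GTerm S C)) (ρ : GTerm S C → GTerm S C)
    (s T d : ℕ) : Set (GTerm S C) := {y ∈ Y | ¬ RankGe P B ρ s T d y}

theorem level_subset (d : ℕ) : level P B Y ρ s T d ⊆ Y := fun _ h => h.1

theorem level_subset_succ (d : ℕ) : level P B Y ρ s T d ⊆ level P B Y ρ s T (d + 1) :=
  fun _ h => ⟨h.1, fun h' => h.2 h'.of_succ⟩

theorem mem_level_of_endo {d : ℕ} {y : GTerm S C} (hy : y ∈ level P B Y ρ s T d)
    {e : GTerm S C → GTerm S C} (he : IsEndo P B e) (hey : e y ∈ Y) :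
    e y ∈ level P B Y ρ s T d :=
  ⟨hey, fun h => hy.2 (h.of_endo he)⟩

theorem exists_const_of_mem_level_zero {y : GTerm S C} (hy : y ∈ level P B Y ρ s T 0) :
    ∃ c, y = .const c := by
  by_contra! h
  exact hy.2 h

/-- The proper subterms of the realizations of a term have smaller rank. -/
theorem HasRealizations.subterm_mem_level (h : HasRealizations P B k Y ρ κ m s) {d : ℕ}
    {y w u : GTerm S C} (hy : y ∈ level P B Y ρ s T (d + 1))
    (hw : IsRealized P B s T {y} (fun _ => w)) (hu : u ∈ w.subterms) (hne : u ≠ w) :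
    ρ u ∈ level P B Y ρ s T d := by
  have hwX : w ∈ terms (obLim P B) :=
    h.mem_terms hw (Set.singleton_subset_iff.2 hy.1) (Set.mem_singleton y)
  exact ⟨h.core.mapsTo _ (subterm_mem_terms h.base hwX hu), fun hr => hy.2 ⟨w, hw, u, hu, hne, hr⟩⟩

/-- A term of large rank has an early realization of large depth. -/
theorem HasRealizations.exists_depth_ge (h : HasRealizations P B k Y ρ κ m s) (hκ : κ ≤ T)
    (hT : ∀ y ∈ terms (ob P B T), y.depth ≤ k) {n : ℕ} {y : GTerm S C} (hy : y ∈ Y)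
    (hr : RankGe P B ρ s T n y) :
    ∃ w, IsRealized P B s ((n + 1) * T) {y} (fun _ => w) ∧ n + 1 ≤ w.depth := by
  have hs1 : 1 ≤ s := (Nat.le_add_left _ _).trans h.size
  induction n generalizing y with
  | zero =>
    obtain ⟨ζ, hζ, _⟩ := h.real {y} (Set.singleton_subset_iff.2 hy)
      (by rw [Set.ncard_singleton]; exact h.size_pos)
    refine ⟨ζ y, (hζ.congr ?_).mono le_rfl (by omega) subset_rfl, GTerm.depth_pos _⟩
    rintro _ rfl; rfl
  | succ n ih =>
    obtain ⟨w, hw, u, hu, hne, hr⟩ := hr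
    have hwT : w ∈ terms (ob P B T) := hw.mem_terms hs1 (Set.mem_singleton y) (h.core.subset hy)
    have hwX := terms_mono (ob_subset_obLim _) hwT
    have huX := subterm_mem_terms h.base hwX hu
    obtain ⟨w', hw', hd⟩ := ih (h.core.mapsTo _ huX) hr
    have hlen : u.creation.length ≤ s := by
      have h1 := length_creation_le h.base huX
        ((GTerm.depth_le_of_mem_subterms hu).trans (hT w hwT))
      have h2 := h.size
      have h3 := Nat.mul_le_mul_right (sizeBound P k) h.size_pos
      omega
    obtain ⟨σ, hσ1, hσ2, hσ3⟩ := (hw'.precomp h.core.isEndo (I' := {u}) (by rintro _ rfl; rfl))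
      u.creation hlen fun f hf => creation_subset h.base huX hf
    obtain ⟨g, hg, hgu, hgn⟩ := exists_isShift_extension h.base (W := {v | v ∈ u.subterms}) hσ1
      (fun r t z hz => subterm_mem_terms h.base huX hz)
      (fun r t z x hz => GTerm.parent_mem_subterms hz x)
      (fun r t z hz => ⟨σ, hσ1, fun _ _ _ => rfl, hσ3 _ (GTerm.headFact_mem_creation hz)⟩)
    have hgu' : g u = w' := (hgu u u.self_mem_subterms).trans (hσ2 u rfl)
    have key : ∀ v : GTerm S C, u ∈ v.subterms → u ≠ v → (g u).depth < (g v).depth := by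
      intro v
      induction v with
      | const c => exact fun h1 h2 => absurd (GTerm.mem_subterms_const.1 h1) h2
      | null r t z ihv =>
        intro h1 h2
        rcases GTerm.mem_subterms_null.1 h1 with h3 | ⟨x, hx⟩
        · exact absurd h3 h2
        rw [hgn r t z fun z' hz' => by
          have h4 := GTerm.depth_le_of_mem_subterms hz'
          have h5 := GTerm.depth_le_of_mem_subterms hx
          have h6 := GTerm.depth_lt_null t z' x
          omega]
        have h7 := GTerm.depth_lt_null (fun x => g (t x)) z x
        by_cases hux : u = t x
        · rw [hux]; exact h7
        · exact (ihv x hx hux).trans h7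
    refine ⟨g w, ?_, ?_⟩
    · have := hw.comp_isShift hg
      rwa [show T + (n + 1) * T = (n + 1 + 1) * T by ring] at this
    · have := key w hu hne
      rw [hgu'] at this
      omega

theorem HasRealizations.level_eq (h : HasRealizations P B k Y ρ κ m s) (hκ : κ ≤ T)
    (hT : ∀ y ∈ terms (ob P B ((k + 1) * T)), y.depth ≤ k) : level P B Y ρ s T k = Y := by
  refine Set.Subset.antisymm (level_subset k) fun y hy => ⟨hy, fun hr => ?_⟩
  obtain ⟨w, hw, hd⟩ := h.exists_depth_ge hκ
    (fun y hy => hT y (terms_mono (ob_mono (Nat.le_mul_of_pos_left _ (Nat.succ_pos _))) hy)) hy hr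
  have := hT _ (hw.mem_terms ((Nat.le_add_left _ _).trans h.size) (Set.mem_singleton y)
    (h.core.subset hy))
  omega

end Ranks

section Counting

theorem exists_mem_of_many {α ι : Type*} [DecidableEq α] {O : Finset α} {K : Finset ι}
    {F : ι → Finset α} {N a : ℕ} (hF : ∀ i ∈ K, F i ⊆ O) (hK : a * N < K.card)
    (h : ∀ i ∈ K, O.card ≤ N * (F i).card) (hO : O.Nonempty) :
    ∃ x ∈ O, a < (K.filter fun i => x ∈ F i).card := by
  by_contra! hx
  have h1 : ∑ i ∈ K, (F i).card = ∑ x ∈ O, (K.filter fun i => x ∈ F i).card := by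
    refine Eq.trans ?_ (Finset.sum_card_bipartiteAbove_eq_sum_card_bipartiteBelow (s := K) (t := O)
      (fun i x => x ∈ F i))
    refine Finset.sum_congr rfl fun i hi => ?_
    congr 1
    ext x
    simp only [Finset.mem_bipartiteAbove]
    exact ⟨fun hx => ⟨hF i hi hx, hx⟩, fun hx => hx.2⟩
  have h2 : ∑ x ∈ O, (K.filter fun i => x ∈ F i).card ≤ O.card * a := by
    refine (Finset.sum_le_sum hx).trans ?_
    simp
  have h3 : K.card * O.card ≤ N * ∑ i ∈ K, (F i).card := by
    rw [Finset.mul_sum, ← smul_eq_mul, ← Finset.sum_const]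
    exact Finset.sum_le_sum h
  have h4 : 0 < O.card := hO.card_pos
  have h5 : K.card * O.card ≤ (a * N) * O.card :=
    h3.trans (((Nat.mul_le_mul_left N (h1.trans_le h2))).trans (by ring_nf; exact le_rfl))
  exact absurd (Nat.le_of_mul_le_mul_right h5 h4) (by omega)

end Counting

section Blocks

variable {S : Signature.{u}} {C : Type v} {P : Program S} {B : Inst S C}

/-- The trigger that creates a null. -/
def GTerm.block : GTerm S C → Option (Σ r : Rule S, {x : Var // x ∈ r.bodyVars} → GTerm S C)
  | .const _ => none
  | .null r h _ => some ⟨r, h⟩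

theorem ncard_range_args_le {r : Rule S} (hr : r ∈ P) {f : GroundFact S C}
    (hf : f.pred = r.head.pred) : (Set.range f.args).ncard ≤ headArity P := by
  rw [← Set.image_univ]
  refine (Set.ncard_image_le Set.finite_univ).trans ?_
  rw [Set.ncard_univ, Nat.card_fin, hf]
  exact arity_le_headArity ⟨r, hr, rfl⟩

/-- A block of nulls is not larger than the arity of a head predicate. -/
theorem ncard_le_of_block_eq (hB : IsBaseInstance B) {Z : Set (GTerm S C)}
    (hZ : Z ⊆ terms (obLim P B)) (hnull : ∀ y ∈ Z, ∀ c, y ≠ .const c)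
    (h : ∀ y ∈ Z, ∀ y' ∈ Z, y.block = y'.block) : Z.ncard ≤ headArity P := by
  rcases Z.eq_empty_or_nonempty with rfl | ⟨y, hy⟩
  · simp
  · cases y with
    | const c => exact absurd rfl (hnull _ hy c)
    | null r t z =>
      have hr := (null_mem_terms_obLim hB (hZ hy)).1
      have hf : (r.headFact t).pred = r.head.pred := rfl
      refine (Set.ncard_le_ncard ?_ (Set.finite_range (r.headFact t).args)).trans
        (ncard_range_args_le hr hf)
      intro y' hy'
      have hb := h _ hy _ hy'
      cases y' with
      | const c => exact absurd rfl (hnull _ hy' c)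
      | null r' t' z' =>
        simp only [GTerm.block, Option.some.injEq, Sigma.mk.injEq] at hb
        obtain ⟨rfl, hb⟩ := hb
        cases hb
        obtain ⟨_, hz, ⟨i, hi⟩, _⟩ := null_mem_terms_obLim hB (hZ hy')
        refine ⟨i, ?_⟩
        change r.skolemExt t (r.head.args i) = _
        rw [hi, Rule.skolemExt_of_notMem hz]

/-- A term of a head fact is a parent of the nulls of the block or belongs to the block. -/
theorem headFact_args_cases (r : Rule S) (t : {x : Var // x ∈ r.bodyVars} → GTerm S C)
    (i : Fin (S.arity (r.headFact t).pred)) :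
    (∃ x, (r.headFact t).args i = t x) ∨ ∃ z, (r.headFact t).args i = .null r t z := by
  change (∃ x, r.skolemExt t (r.head.args i) = t x) ∨ ∃ z, r.skolemExt t (r.head.args i) = _
  by_cases hx : r.head.args i ∈ r.bodyVars
  · exact Or.inl ⟨_, Rule.skolemExt_of_mem hx⟩
  · exact Or.inr ⟨_, Rule.skolemExt_of_notMem hx⟩

end Blocks

section LevelForms

variable {S : Signature.{u}} {C : Type v} {P : Program S} {B : Inst S C} {k : ℕ}
  {Y : Set (GTerm S C)} {ρ : GTerm S C → GTerm S C} {κ m s : ℕ}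

/-- The map `t` on `Z` is compatible with each single fact of the chase. -/
def LevelForm (P : Program S) (B : Inst S C) (Z : Set (GTerm S C)) (K : ℕ)
    (t : GTerm S C → GTerm S C) : Prop :=
  FixesConst t ∧ ∀ J ⊆ Z, J.ncard ≤ headArity P → ∀ f ∈ obLim P B,
    ∃ σ, FixesConst σ ∧ (∀ y ∈ J, σ y = t y) ∧ f.map σ ∈ ob P B K

/-- The orbit of a core term. -/
def orbit (P : Program S) (B : Inst S C) (ρ : GTerm S C → GTerm S C) (y : GTerm S C) :
    Set (GTerm S C) := {x | ∃ g, IsEndo P B g ∧ x = ρ (g y)}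

variable {d K M : ℕ} {t : GTerm S C → GTerm S C}

namespace HasRealizations

theorem orbit_subset (h : HasRealizations P B k Y ρ κ m s) {y : GTerm S C} (hy : y ∈ Y) :
    orbit P B ρ y ⊆ Y := by
  rintro _ ⟨g, hg, rfl⟩
  exact h.core.mapsTo _ (hg.mem_terms (h.core.subset hy))

theorem self_mem_orbit (h : HasRealizations P B k Y ρ κ m s) {y : GTerm S C} (hy : y ∈ Y) :
    y ∈ orbit P B ρ y := ⟨id, IsEndo.id, (h.core.eq_self y hy).symm⟩

theorem orbit_subset_level (h : HasRealizations P B k Y ρ κ m s) {T : ℕ} {y : GTerm S C}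
    (hy : y ∈ level P B Y ρ s T d) : orbit P B ρ y ⊆ level P B Y ρ s T d := by
  rintro _ ⟨g, hg, rfl⟩
  exact mem_level_of_endo hy (h.core.isEndo.comp hg)
    (h.core.mapsTo _ (hg.mem_terms (h.core.subset hy.1)))

theorem levelForm_zero (h : HasRealizations P B k Y ρ κ m s) {T : ℕ} :
    LevelForm P B (level P B Y ρ s T 0) κ id := by
  refine ⟨FixesConst.id, fun J hJ _ f hf => ?_⟩
  obtain ⟨ζ, hζ, _⟩ := h.real ∅ (Set.empty_subset _) (by simp)
  obtain ⟨σ, h1, _, h3⟩ := hζ [f] (by simpa using (Nat.le_add_left _ _).trans h.size)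
    (by simpa using hf)
  refine ⟨σ, h1, fun y hy => ?_, h3 f (by simp)⟩
  obtain ⟨c, rfl⟩ := exists_const_of_mem_level_zero (hJ hy)
  exact h1 c

/-- The map `t` extends to the terms whose subterms all belong to the domain of `t`. -/
theorem exists_levelMap (hB : IsBaseInstance B) {Z : Set (GTerm S C)}
    (ht : LevelForm P B Z K t) {e : GTerm S C → GTerm S C} (he : IsEndo P B e) :
    ∃ θ, IsShift P B K θ ∧ ∀ u ∈ terms (obLim P B), (∀ v ∈ u.subterms, e v ∈ Z) →
      θ u = t (e u) := by
  obtain ⟨θ, hθ, hθW, _⟩ := exists_isShift_extension hB (K := K) (τ := t ∘ e)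
    (W := {u | u ∈ terms (obLim P B) ∧ ∀ v ∈ u.subterms, e v ∈ Z}) (ht.1.comp he.1)
    (fun r q z hz => hz.1)
    (fun r q z x hz => ⟨subterm_mem_terms hB hz.1 (GTerm.parent_mem_subterms
      (GTerm.self_mem_subterms _) x), fun v hv => hz.2 v (GTerm.subterms_trans hv
        (GTerm.parent_mem_subterms (GTerm.self_mem_subterms _) x))⟩)
    (fun r q z hz => by
      obtain ⟨hr, _, _, htr⟩ := null_mem_terms_obLim hB hz.1
      have hf := headFact_mem_obLim hr htr
      obtain ⟨σ, h1, h2, h3⟩ := ht.2 (e '' (Set.range (r.headFact q).args ∩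
          {u | u ∈ terms (obLim P B) ∧ ∀ v ∈ u.subterms, e v ∈ Z}))
        (by rintro _ ⟨v, ⟨_, hv⟩, rfl⟩; exact hv.2 v v.self_mem_subterms)
        ((Set.ncard_image_le ((Set.finite_range _).inter_of_left _)).trans
          ((Set.ncard_le_ncard Set.inter_subset_left (Set.finite_range _)).trans
            (ncard_range_args_le hr rfl))) _ (he.2 _ hf)
      exact ⟨σ ∘ e, h1.comp he.1, fun w hw ⟨i, hi⟩ => h2 _ ⟨w, ⟨⟨i, hi⟩, hw⟩, rfl⟩, h3⟩)
  exact ⟨θ, hθ, fun u hu hv => hθW u ⟨hu, hv⟩⟩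

/-- A small set `U` of core terms has images that are compatible with each single fact and the
map `t` on the level `d`. -/
theorem exists_relative_form (h : HasRealizations P B k Y ρ κ m s)
    (ht : LevelForm P B (level P B Y ρ s (2 * κ) d) K t)
    (hM : ∀ y ∈ level P B Y ρ s (2 * κ) d, (orbit P B ρ y).ncard ≤ M)
    (hm : headArity P + headArity P * M ≤ m) {U : Set (GTerm S C)} (hU : U ⊆ Y)
    (hUa : U.ncard ≤ headArity P) :
    ∃ tU : GTerm S C → GTerm S C, ∀ J ⊆ level P B Y ρ s (2 * κ) d, J.ncard ≤ headArity P →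
      ∀ f ∈ obLim P B, ∃ σ, FixesConst σ ∧ (∀ y ∈ U, σ y = tU y) ∧ (∀ y ∈ J, σ y = t y) ∧
        f.map σ ∈ ob P B (2 * κ + K) := by
  have hUm : U.ncard ≤ m := by omega
  obtain ⟨ζ, hζ, hζk⟩ := h.real U hU hUm
  obtain ⟨g₀, hg₀, hg₀U⟩ := h.exists_isShift hζ hU hUm
  obtain ⟨a₀, ha₀, ha₀Y, ha₀g, _⟩ := h.exists_inverse hg₀.isEndo
  obtain ⟨θ, hθ, hθt⟩ := exists_levelMap h.base ht (ha₀.comp h.core.isEndo)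
  refine ⟨θ ∘ ζ, fun J hJ hJa f hf => ?_⟩
  have hJfin : J.Finite := h.finite (hJ.trans (level_subset _))
  let O : Set (GTerm S C) := ⋃ y ∈ J, orbit P B ρ y
  have hOL : O ⊆ level P B Y ρ s (2 * κ) d :=
    Set.iUnion₂_subset fun y hy => h.orbit_subset_level (hJ hy)
  have hOY : U ∪ O ⊆ Y := Set.union_subset hU (hOL.trans (level_subset _))
  have hOcard : O.ncard ≤ headArity P * M := by
    have h1 : O = ⋃ y ∈ hJfin.toFinset, orbit P B ρ y := by simp [O]
    rw [h1]
    refine (Finset.set_ncard_biUnion_le _ _).trans ((Finset.sum_le_card_nsmul _ _ M fun y hy =>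
      hM y (hJ (by simpa using hy))).trans ?_)
    rw [← Set.ncard_eq_toFinset_card J hJfin, smul_eq_mul]
    exact Nat.mul_le_mul_right _ hJa
  have hUOm : (U ∪ O).ncard ≤ m := (Set.ncard_union_le _ _).trans (by omega)
  obtain ⟨ξ, hξ, hξU⟩ := h.exists_moved hOY hUOm Set.subset_union_left hζ
  obtain ⟨g₁, hg₁, hg₁ξ⟩ := h.exists_isShift hξ hOY hUOm
  obtain ⟨a, ha, haY, hag, hga⟩ := h.exists_inverse
    ((ha₀.comp h.core.isEndo).comp hg₁.isEndo)
  have hmem : ∀ y ∈ terms (obLim P B), a₀ (ρ y) ∈ Y := fun y hy =>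
    ha₀Y _ (h.core.isEndo.mem_terms hy)
  have hag' : ∀ y ∈ Y, a (a₀ (ρ (g₁ y))) = y := fun y hy => by
    have := hag y hy
    rwa [Function.comp, Function.comp,
      h.core.eq_self _ (hmem _ (hg₁.isEndo.mem_terms (h.core.subset hy)))] at this
  have hga' : ∀ y ∈ Y, a₀ (ρ (g₁ (a y))) = y := fun y hy => by
    have := hga y hy
    rwa [Function.comp, Function.comp, h.core.eq_self _ (hmem _ (hg₁.isEndo.mem_terms
      (h.core.subset (haY _ (h.core.subset hy)))))] at this
  have haU : ∀ y ∈ U, a y = y := fun y hy => by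
    have h1 := hag' y (hU hy)
    rw [hg₁ξ y (Or.inl hy), hξU y hy, ← hg₀U y hy, ha₀g y (hU hy)] at h1
    exact h1
  have haJ : ∀ y ∈ J, a y ∈ O := fun y hy => Set.mem_biUnion hy
    ⟨a, ha, (h.core.eq_self _ (haY _ (h.core.subset (hJ hy).1))).symm⟩
  obtain ⟨σ, h1, h2, h3⟩ := hξ [f.map a] (by simpa using (Nat.le_add_left _ _).trans h.size)
    (by simpa using ha.2 f hf)
  refine ⟨θ ∘ σ ∘ a, hθ.1.comp (h1.comp ha.1), fun y hy => ?_, fun y hy => ?_, ?_⟩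
  · simp only [Function.comp]
    rw [haU y hy, h2 y (Or.inl hy), hξU y hy]
  · simp only [Function.comp]
    have hay := haJ y hy
    have hreal : IsRealized P B s (2 * κ) {a y} (fun _ => ξ (a y)) :=
      (hξ.mono le_rfl le_rfl (Set.singleton_subset_iff.2 (Or.inr hay))).congr
        (by rintro _ rfl; rfl)
    have hfix : a₀ (ρ (ξ (a y))) = y := by
      rw [← hg₁ξ _ (Or.inr hay)]; exact hga' y (hJ hy).1
    have hξX := h.mem_terms hξ hOY (Or.inr hay)
    rw [h2 _ (Or.inr hay), hθt _ hξX]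
    · simp only [Function.comp]; rw [hfix]
    · intro v hv
      by_cases hve : v = ξ (a y)
      · rw [hve, Function.comp, hfix]; exact hJ hy
      · refine mem_level_of_endo (h.subterm_mem_level (level_subset_succ _ (hOL hay)) hreal hv hve)
          ha₀ (ha₀Y _ (h.core.isEndo.mem_terms (subterm_mem_terms h.base hξX hv)))
  · have h4 := hθ.2 _ _ (h3 _ (List.mem_singleton.2 rfl))
    exact h4

/-- Two core terms of the same level have no common image under the stabilizers of the small terms
of their blocks, unless their realizations belong to the same block. -/
theorem exists_collision (h : HasRealizations P B k Y ρ κ m s)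
    (ht : LevelForm P B (level P B Y ρ s (2 * κ) d) K t)
    (hM : ∀ y ∈ level P B Y ρ s (2 * κ) d, (orbit P B ρ y).ncard ≤ M)
    (hm : headArity P + headArity P * M ≤ m) {x : GTerm S C} (hx : x ∈ Y)
    {Z : Set (GTerm S C)} (hZX : Z ⊆ terms (obLim P B)) (hnull : ∀ z ∈ Z, ∀ c, z ≠ .const c)
    (hblock : ∀ z ∈ Z, ∀ z' ∈ Z, z.block = z'.block → z = z')
    (hZ : ∀ z ∈ Z, ρ z ∉ level P B Y ρ s (2 * κ) d)
    (hsub : ∀ z ∈ Z, ∀ u ∈ z.subterms, u ≠ z → ρ u ∈ level P B Y ρ s (2 * κ) d)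
    (he : ∀ r q z, GTerm.null r q z ∈ Z → ∃ e, IsEndo P B e ∧ ρ (e (ρ (.null r q z))) = x ∧
      ∀ i, ρ ((Rule.headFact r q).args i) ∈ level P B Y ρ s (2 * κ) d →
        ρ (e (ρ ((Rule.headFact r q).args i))) = ρ ((Rule.headFact r q).args i)) :
    ∃ g, IsEndo P B g ∧ ∀ z ∈ Z, ∀ z' ∈ Z, g z = g z' := by
  classical
  rcases Z.eq_empty_or_nonempty with rfl | ⟨z₀, hz₀⟩
  · exact ⟨id, IsEndo.id, by simp⟩
  have ha1 : 1 ≤ headArity P := by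
    cases z₀ with
    | const c => exact absurd rfl (hnull _ hz₀ c)
    | null r q z =>
      obtain ⟨hr, _, ⟨i, _⟩, _⟩ := null_mem_terms_obLim h.base (hZX hz₀)
      exact (Nat.succ_le_of_lt (Nat.pos_of_ne_zero fun h0 => by
        have := i.2; omega)).trans (arity_le_headArity ⟨r, hr, rfl⟩)
  obtain ⟨tU, htU⟩ := h.exists_relative_form ht hM hm (Set.singleton_subset_iff.2 hx)
    (by rwa [Set.ncard_singleton])
  let τ : GTerm S C → GTerm S C := fun w => if w ∈ Z then tU x else t (ρ w)
  have hτ : FixesConst τ := fun c => by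
    simp only [τ]
    rw [if_neg fun hc => hnull _ hc c rfl, h.core.isEndo.1, ht.1]
  let W : Set (GTerm S C) := {w | ∃ z ∈ Z, w ∈ z.subterms}
  have hWX : W ⊆ terms (obLim P B) := fun w ⟨z, hz, hw⟩ => subterm_mem_terms h.base (hZX hz) hw
  have hWL : ∀ w ∈ W, w ∉ Z → ρ w ∈ level P B Y ρ s (2 * κ) d := fun w ⟨z, hz, hw⟩ hwZ =>
    hsub z hz w hw fun e => hwZ (e ▸ hz)
  have hparent : ∀ r q z x, GTerm.null r q z ∈ W → q x ∉ Z := fun r q z x ⟨z', hz', hw⟩ hq =>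
    hZ _ hq (hsub z' hz' _ (GTerm.parent_mem_subterms hw x) (GTerm.parent_ne hw x))
  obtain ⟨g, hg, hgW, _⟩ := exists_isShift_extension h.base (W := W) (K := 2 * κ + K) hτ
    (fun r q z hz => hWX hz)
    (fun r q z x ⟨z', hz', hw⟩ => ⟨z', hz', GTerm.parent_mem_subterms hw x⟩)
    (fun r q z hz => by
      obtain ⟨hr, _, _, htr⟩ := null_mem_terms_obLim h.base (hWX hz)
      have hf := headFact_mem_obLim hr htr
      let J : Set (GTerm S C) :=
        ρ '' {w ∈ Set.range (r.headFact q).args | ρ w ∈ level P B Y ρ s (2 * κ) d}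
      have hJ : J ⊆ level P B Y ρ s (2 * κ) d := by rintro _ ⟨w, hw, rfl⟩; exact hw.2
      have hJa : J.ncard ≤ headArity P :=
        (Set.ncard_image_le ((Set.finite_range _).subset (Set.sep_subset _ _))).trans
          ((Set.ncard_le_ncard (Set.sep_subset _ _) (Set.finite_range _)).trans
            (ncard_range_args_le hr rfl))
      by_cases hzZ : ∃ z', GTerm.null r q z' ∈ Z
      · obtain ⟨z', hz'⟩ := hzZ
        obtain ⟨e, he1, he2, he3⟩ := he r q z' hz'
        have hE : IsEndo P B (ρ ∘ e ∘ ρ) := h.core.isEndo.comp (he1.comp h.core.isEndo)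
        obtain ⟨σ, h1, h2, h3, h4⟩ := htU J hJ hJa _ (hE.2 _ hf)
        refine ⟨σ ∘ ρ ∘ e ∘ ρ, h1.comp hE.1, fun w hw ⟨i, hi⟩ => ?_,
          ob_mono (by omega) h4⟩
        simp only [Function.comp, τ]
        by_cases hwZ : w ∈ Z
        · rw [if_pos hwZ]
          rcases headFact_args_cases r q i with ⟨x', hx'⟩ | ⟨z'', hz''⟩
          · exact absurd (by rwa [← hx', hi]) (hparent r q z x' hz)
          · rw [hi] at hz''
            rw [hblock w hwZ _ hz' (by rw [hz'']; rfl), he2, h2 _ rfl]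
        · rw [if_neg hwZ]
          have hwL := hWL w hw hwZ
          have h5 := he3 i (by rwa [hi])
          rw [hi] at h5
          rw [h5]
          exact h3 _ ⟨w, ⟨⟨i, hi⟩, hwL⟩, rfl⟩
      · obtain ⟨σ, h1, h2, h3⟩ := ht.2 J hJ hJa _ (h.core.isEndo.2 _ hf)
        refine ⟨σ ∘ ρ, h1.comp h.core.isEndo.1, fun w hw ⟨i, hi⟩ => ?_, ob_mono (by omega) h3⟩
        have hwZ : w ∉ Z := fun hwZ => by
          rcases headFact_args_cases r q i with ⟨x', hx'⟩ | ⟨z'', hz''⟩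
          · exact hparent r q z x' hz (by rwa [← hx', hi])
          · exact hzZ ⟨z'', by rwa [← hz'', hi]⟩
        simp only [Function.comp, τ]
        rw [if_neg hwZ]
        exact h2 _ ⟨w, ⟨⟨i, hi⟩, hWL w hw hwZ⟩, rfl⟩)
  refine ⟨g, hg.isEndo, fun z hz z' hz' => ?_⟩
  rw [hgW z ⟨z, hz, z.self_mem_subterms⟩, hgW z' ⟨z', hz', z'.self_mem_subterms⟩]
  simp only [τ]
  rw [if_pos hz, if_pos hz']

end HasRealizations

end LevelForms

section Orbits

variable {S : Signature.{u}} {C : Type v} {P : Program S} {B : Inst S C} {k : ℕ}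
  {Y : Set (GTerm S C)} {ρ : GTerm S C → GTerm S C} {κ m s d K M : ℕ} {t : GTerm S C → GTerm S C}

namespace HasRealizations

theorem orbit_subset_orbit (h : HasRealizations P B k Y ρ κ m s) {x y : GTerm S C}
    (hx : x ∈ orbit P B ρ y) : orbit P B ρ x ⊆ orbit P B ρ y := by
  obtain ⟨g, hg, rfl⟩ := hx
  rintro _ ⟨g', hg', rfl⟩
  exact ⟨g' ∘ ρ ∘ g, hg'.comp (h.core.isEndo.comp hg), rfl⟩

theorem mem_orbit_symm (h : HasRealizations P B k Y ρ κ m s) {x y : GTerm S C} (hy : y ∈ Y)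
    (hx : x ∈ orbit P B ρ y) : y ∈ orbit P B ρ x := by
  obtain ⟨g, hg, rfl⟩ := hx
  obtain ⟨e, he, _, heg, _⟩ := h.exists_inverse hg
  exact ⟨e, he, by rw [heg y hy, h.core.eq_self y hy]⟩

theorem orbit_eq (h : HasRealizations P B k Y ρ κ m s) {x y : GTerm S C} (hy : y ∈ Y)
    (hx : x ∈ orbit P B ρ y) : orbit P B ρ x = orbit P B ρ y :=
  (h.orbit_subset_orbit hx).antisymm (h.orbit_subset_orbit (h.mem_orbit_symm hy hx))

/-- The orbit of a core term is bounded by its orbit under the stabilizer of few terms with small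
orbits. -/
theorem ncard_orbit_le_mul (h : HasRealizations P B k Y ρ κ m s) {x₀ : GTerm S C} (hx₀ : x₀ ∈ Y)
    {b : Set (GTerm S C)} (hb : b ⊆ Y) (hM : ∀ y ∈ b, (orbit P B ρ y).ncard ≤ M) (hM1 : 1 ≤ M)
    {a : ℕ} (hba : b.ncard ≤ a) :
    (orbit P B ρ x₀).ncard ≤ M ^ a * {x ∈ orbit P B ρ x₀ | ∃ e, IsEndo P B e ∧ ρ (e x₀) = x ∧
      ∀ y ∈ b, ρ (e y) = y}.ncard := by
  classical
  set O := orbit P B ρ x₀ with hO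
  set O' := {x ∈ O | ∃ e, IsEndo P B e ∧ ρ (e x₀) = x ∧ ∀ y ∈ b, ρ (e y) = y} with hO'
  have hOY : O ⊆ Y := h.orbit_subset hx₀
  have hOfin : O.Finite := h.finite hOY
  have hO'fin : O'.Finite := hOfin.subset (Set.sep_subset _ _)
  have hbfin : b.Finite := h.finite hb
  have hex : ∀ x ∈ O, ∃ g, IsEndo P B g ∧ x = ρ (g x₀) := fun x hx => hx
  choose! e he1 he2 using hex
  let F : GTerm S C → (hbfin.toFinset → GTerm S C) := fun x y => ρ (e x y)
  have horb : ∀ y : hbfin.toFinset, (orbit P B ρ y).Finite := fun y =>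
    h.finite (h.orbit_subset (hb (hbfin.mem_toFinset.1 y.2)))
  have h1 := Finset.card_le_mul_card_image_of_maps_to (f := F) (s := hOfin.toFinset)
    (t := Fintype.piFinset fun y : hbfin.toFinset => (horb y).toFinset)
    (fun x hx => by
      rw [Fintype.mem_piFinset]
      intro y
      rw [Set.Finite.mem_toFinset]
      exact ⟨e x, he1 x (by simpa using hx), rfl⟩) O'.ncard (fun τ _ => by
      rcases (Finset.filter (fun x => F x = τ) hOfin.toFinset).eq_empty_or_nonempty with h0 | h0
      · rw [h0]; exact Nat.zero_le _
      · obtain ⟨x₁, hx₁⟩ := h0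
        rw [Finset.mem_filter, Set.Finite.mem_toFinset] at hx₁
        obtain ⟨e', he', he'Y, hl, hr⟩ := h.exists_inverse (he1 x₁ hx₁.1)
        rw [Set.ncard_eq_toFinset_card O' hO'fin]
        refine Finset.card_le_card_of_injOn e' (fun x hx => ?_) (fun x hx x' hx' hxx => ?_)
        · rw [Finset.mem_coe, Finset.mem_filter, Set.Finite.mem_toFinset] at hx
          rw [Finset.mem_coe, Set.Finite.mem_toFinset]
          have hE : IsEndo P B (e' ∘ ρ ∘ e x) := he'.comp (h.core.isEndo.comp (he1 x hx.1))
          have hρ : ρ (e' x) = e' x := h.core.eq_self _ (he'Y _ (h.core.subset (hOY hx.1)))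
          have hρe : ρ ((e' ∘ ρ ∘ e x) x₀) = e' x := by
            simp only [Function.comp]
            rw [← he2 x hx.1, hρ]
          refine ⟨⟨_, hE, hρe.symm⟩, _, hE, hρe, fun y hy => ?_⟩
          have h2 : ρ (e x y) = ρ (e x₁ y) :=
            congrFun (hx.2.trans hx₁.2.symm) ⟨y, by simpa using hy⟩
          simp only [Function.comp]
          rw [h2, hl y (hb hy), h.core.eq_self y (hb hy)]
        · rw [Finset.mem_coe, Finset.mem_filter, Set.Finite.mem_toFinset] at hx hx'
          rw [← hr x (hOY hx.1), ← hr x' (hOY hx'.1), hxx])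
  rw [Set.ncard_eq_toFinset_card O hOfin, Nat.mul_comm]
  refine h1.trans (Nat.mul_le_mul_left _ ?_)
  rw [Fintype.card_piFinset]
  refine (Finset.prod_le_pow_card _ _ M fun y _ => ?_).trans ?_
  · rw [← Set.ncard_eq_toFinset_card _ (horb y)]
    exact hM y (hbfin.mem_toFinset.1 y.2)
  · refine Nat.pow_le_pow_right hM1 ?_
    rw [Finset.card_univ, Fintype.card_coe, ← Set.ncard_eq_toFinset_card b hbfin]
    exact hba

theorem ne_const_of_notMem_level (h : HasRealizations P B k Y ρ κ m s) {T : ℕ} {y : GTerm S C}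
    (hy : y ∈ Y) (hyd : y ∉ level P B Y ρ s T d) {g : GTerm S C → GTerm S C} (hg : IsEndo P B g)
    (c : C) : g y ≠ .const c := by
  intro hc
  obtain ⟨e, he, _, heg, _⟩ := h.exists_inverse hg
  have h1 := heg y hy
  rw [hc, h.core.isEndo.1, he.1] at h1
  exact hyd ⟨hy, h1 ▸ not_rankGe_const _ c⟩

/-- The orbits of the next level are bounded. -/
theorem ncard_orbit_le (h : HasRealizations P B k Y ρ κ m s)
    (ht : LevelForm P B (level P B Y ρ s (2 * κ) d) K t)
    (hM : ∀ y ∈ level P B Y ρ s (2 * κ) d, (orbit P B ρ y).ncard ≤ M) (hM1 : 1 ≤ M)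
    (hm : headArity P + headArity P * M ≤ m) (hm' : headArity P * M ^ headArity P + 1 ≤ m)
    {y : GTerm S C} (hy : y ∈ level P B Y ρ s (2 * κ) (d + 1)) :
    (orbit P B ρ y).ncard ≤ max M (headArity P * M ^ headArity P) := by
  classical
  by_cases hyd : y ∈ level P B Y ρ s (2 * κ) d
  · exact (hM y hyd).trans (le_max_left _ _)
  refine le_trans ?_ (le_max_right _ _)
  by_contra! hlt
  set O := orbit P B ρ y with hO
  set L := level P B Y ρ s (2 * κ) d with hL
  have hOL : O ⊆ level P B Y ρ s (2 * κ) (d + 1) := h.orbit_subset_level hy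
  have hOY : O ⊆ Y := hOL.trans (level_subset _)
  have hOfin : O.Finite := h.finite hOY
  have hOd : ∀ x ∈ O, x ∉ L := fun x hx hxd =>
    hyd (h.orbit_subset_level hxd (h.mem_orbit_symm hy.1 hx))
  rw [Set.ncard_eq_toFinset_card O hOfin] at hlt
  obtain ⟨I, hIsub, hIcard⟩ := Finset.exists_subset_card_eq hlt
  have hImem : ∀ i ∈ I, i ∈ O := fun i hi => by simpa using hIsub hi
  have hIY : (I : Set (GTerm S C)) ⊆ Y := fun i hi => hOY (hImem i hi)
  have hIm : (I : Set (GTerm S C)).ncard ≤ m := by rw [Set.ncard_coe_finset, hIcard]; exact hm'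
  obtain ⟨ξ, hξ, hξk⟩ := h.real I hIY hIm
  obtain ⟨g, hg, hgξ⟩ := h.exists_isShift hξ hIY hIm
  have hgX : ∀ i ∈ I, g i ∈ terms (obLim P B) := fun i hi =>
    hg.isEndo.mem_terms (h.core.subset (hIY hi))
  have hρg : ∀ i ∈ I, ρ (g i) ∈ O := fun i hi =>
    h.orbit_subset_orbit (hImem i hi) ⟨g, hg.isEndo, rfl⟩
  have hginj : Set.InjOn g I := fun i hi j hj hij => by
    obtain ⟨e, _, _, heg, _⟩ := h.exists_inverse hg.isEndo
    rw [← heg i (hIY hi), hij, heg j (hIY hj)]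
  have hsub : ∀ i ∈ I, ∀ u ∈ (g i).subterms, u ≠ g i → ρ u ∈ L := fun i hi u hu hne => by
    refine h.subterm_mem_level (hOL (hImem i hi)) (w := g i) ?_ hu hne
    refine (hξ.mono le_rfl (by omega) (Set.singleton_subset_iff.2 hi)).congr ?_
    rintro _ rfl
    exact (hgξ _ hi).symm
  let b : GTerm S C → Set (GTerm S C) := fun z => {w ∈ L | ∃ r q z' i,
    z = GTerm.null r q z' ∧ w = ρ ((Rule.headFact r q).args i)}
  have hb : ∀ z ∈ terms (obLim P B), (b z).ncard ≤ headArity P := fun z hz => by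
    cases z with
    | const c =>
      have : b (.const c) = ∅ := by
        ext w
        simp [b]
      rw [this]; simp
    | null r q z' =>
      have hr := (null_mem_terms_obLim h.base hz).1
      have hbs : b (.null r q z') ⊆ ρ '' Set.range (r.headFact q).args := by
        rintro w ⟨_, r', q', z'', i, e, rfl⟩
        cases e
        exact ⟨_, ⟨i, rfl⟩, rfl⟩
      exact (Set.ncard_le_ncard hbs ((Set.finite_range _).image _)).trans
        ((Set.ncard_image_le (Set.finite_range _)).trans (ncard_range_args_le hr rfl))
  have hSfin : ∀ i, {x ∈ O | ∃ e, IsEndo P B e ∧ ρ (e (ρ (g i))) = x ∧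
      ∀ y ∈ b (g i), ρ (e y) = y}.Finite := fun i => hOfin.subset (Set.sep_subset _ _)
  obtain ⟨x, hxO, hxI⟩ := exists_mem_of_many (O := hOfin.toFinset) (K := I)
    (F := fun i => (hSfin i).toFinset) (N := M ^ headArity P) (a := headArity P)
    (fun i _ x hx => by
      rw [Set.Finite.mem_toFinset] at hx ⊢
      exact hx.1)
    (by rw [hIcard]; exact Nat.lt_succ_self _)
    (fun i hi => by
      rw [← Set.ncard_eq_toFinset_card _ (hSfin i), ← Set.ncard_eq_toFinset_card O hOfin]
      have h1 := h.ncard_orbit_le_mul (hOY (hρg i hi)) (b := b (g i))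
        (fun w hw => hw.1.1) (fun w hw => hM w hw.1) hM1 (hb _ (hgX i hi))
      rwa [h.orbit_eq hy.1 (hρg i hi)] at h1)
    ⟨y, by simpa using h.self_mem_orbit hy.1⟩
  rw [Set.Finite.mem_toFinset] at hxO
  set I' := I.filter fun i => x ∈ (hSfin i).toFinset with hI'
  have hI'I : ∀ i ∈ I', i ∈ I := fun i hi => (Finset.mem_filter.1 hi).1
  have hI'S : ∀ i ∈ I', ∃ e, IsEndo P B e ∧ ρ (e (ρ (g i))) = x ∧
      ∀ y ∈ b (g i), ρ (e y) = y := fun i hi => by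
    have h1 := (Finset.mem_filter.1 hi).2
    rw [Set.Finite.mem_toFinset] at h1
    exact h1.2
  have hnull : ∀ i ∈ I, ∀ c, g i ≠ .const c := fun i hi =>
    h.ne_const_of_notMem_level (hIY hi) (hOd i (hImem i hi)) hg.isEndo
  obtain ⟨i, hi, j, hj, hij⟩ : ∃ i ∈ I', ∃ j ∈ I', (g i).block ≠ (g j).block := by
    by_contra! hall
    have h1 := ncard_le_of_block_eq (P := P) h.base (Z := g '' (I' : Set (GTerm S C)))
      (by rintro _ ⟨i, hi, rfl⟩; exact hgX i (hI'I i hi))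
      (by rintro _ ⟨i, hi, rfl⟩; exact hnull i (hI'I i hi))
      (by rintro _ ⟨i, hi, rfl⟩ _ ⟨j, hj, rfl⟩; exact hall i hi j hj)
    rw [(hginj.mono fun i hi => hI'I i hi).ncard_image, Set.ncard_coe_finset] at h1
    omega
  obtain ⟨μ, hμ, hμZ⟩ := h.exists_collision ht hM hm (hOY hxO) (Z := {g i, g j})
    (by rintro _ (rfl | rfl); exacts [hgX i (hI'I i hi), hgX j (hI'I j hj)])
    (by rintro _ (rfl | rfl); exacts [hnull i (hI'I i hi), hnull j (hI'I j hj)])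
    (by
      rintro _ (rfl | rfl) _ (rfl | rfl) hb
      exacts [rfl, absurd hb hij, absurd hb.symm hij, rfl])
    (by
      rintro _ (rfl | rfl)
      exacts [hOd _ (hρg i (hI'I i hi)), hOd _ (hρg j (hI'I j hj))])
    (by rintro _ (rfl | rfl); exacts [hsub i (hI'I i hi), hsub j (hI'I j hj)])
    (by
      intro r q z hz
      obtain ⟨l, hl, hlz⟩ : ∃ l ∈ I', GTerm.null r q z = g l := by
        rcases hz with hz | hz
        exacts [⟨i, hi, hz⟩, ⟨j, hj, hz⟩]
      obtain ⟨e, he1, he2, he3⟩ := hI'S l hl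
      exact ⟨e, he1, by rw [hlz]; exact he2, fun i' hi' =>
        he3 _ ⟨hi', r, q, z, i', hlz.symm, rfl⟩⟩)
  have h1 := hμZ (g i) (Or.inl rfl) (g j) (Or.inr rfl)
  obtain ⟨e, _, _, heg, _⟩ := h.exists_inverse (hμ.comp hg.isEndo)
  have h2 := heg i (hIY (hI'I i hi))
  rw [Function.comp, h1] at h2
  have h3 := heg j (hIY (hI'I j hj))
  rw [Function.comp, h2] at h3
  exact hij (by rw [h3])

end HasRealizations

end Orbits

section Units

variable {S : Signature.{u}} {C : Type v} {P : Program S} {B : Inst S C} {k : ℕ}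
  {Y : Set (GTerm S C)} {ρ : GTerm S C → GTerm S C} {κ m s d K M : ℕ} {t : GTerm S C → GTerm S C}
  {D : Set (GTerm S C)}

/-- Bounds for the orbits of the levels. -/
def orbitBound (a : ℕ) : ℕ → ℕ
  | 0 => 1
  | d + 1 => max (orbitBound a d) (a * orbitBound a d ^ a)

theorem one_le_orbitBound (a d : ℕ) : 1 ≤ orbitBound a d := by
  induction d with
  | zero => exact le_rfl
  | succ d ih => exact ih.trans (le_max_left _ _)

theorem orbitBound_mono (a : ℕ) {d d' : ℕ} (h : d ≤ d') :
    orbitBound a d ≤ orbitBound a d' :=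
  monotone_nat_of_le_succ (f := orbitBound a) (fun _ => le_max_left _ _) h

/-- Two terms of `D` are tied if their joint realizations always belong to a single block. -/
def Tied (P : Program S) (B : Inst S C) (s κ : ℕ) (D : Set (GTerm S C)) (x y : GTerm S C) : Prop :=
  x ∈ D ∧ y ∈ D ∧ ∀ ζ, IsRealized P B s κ {x, y} ζ → (ζ x).block = (ζ y).block

theorem Tied.symm {x y : GTerm S C} (h : Tied P B s κ D x y) : Tied P B s κ D y x :=
  ⟨h.2.1, h.1, fun ζ hζ => (h.2.2 ζ (by rwa [Set.pair_comm])).symm⟩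

/-- The terms of `D` that are connected to `x` by tied pairs. -/
def tiedClass (P : Program S) (B : Inst S C) (s κ : ℕ) (D : Set (GTerm S C)) (x : GTerm S C) :
    Set (GTerm S C) := {y ∈ D | Relation.EqvGen (Tied P B s κ D) x y}

theorem tiedClass_eq {x y : GTerm S C} (h : Relation.EqvGen (Tied P B s κ D) x y) :
    tiedClass P B s κ D x = tiedClass P B s κ D y := by
  ext z
  exact ⟨fun hz => ⟨hz.1, (h.symm _ _).trans _ _ _ hz.2⟩, fun hz => ⟨hz.1, h.trans _ _ _ hz.2⟩⟩

theorem self_mem_tiedClass {x : GTerm S C} (h : x ∈ D) : x ∈ tiedClass P B s κ D x :=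
  ⟨h, Relation.EqvGen.refl _⟩

theorem exists_tied_subset {x : GTerm S C} (hD : D.Finite) (hx : x ∈ D) (n : ℕ)
    (hn : n < (tiedClass P B s κ D x).ncard) : ∃ Z ⊆ tiedClass P B s κ D x, x ∈ Z ∧
      Z.ncard = n + 1 ∧ ∀ ζ, IsRealized P B s κ Z ζ → ∀ z ∈ Z, (ζ z).block = (ζ x).block := by
  have hUfin : (tiedClass P B s κ D x).Finite := hD.subset (Set.sep_subset _ _)
  induction n with
  | zero =>
    refine ⟨{x}, Set.singleton_subset_iff.2 (self_mem_tiedClass hx), rfl, Set.ncard_singleton x, ?_⟩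
    rintro ζ _ _ rfl; rfl
  | succ n ih =>
    obtain ⟨Z, hZU, hxZ, hZn, hZb⟩ := ih (by omega)
    have hZfin : Z.Finite := hUfin.subset hZU
    obtain ⟨y, hyZ, y', hy', hyy'⟩ : ∃ y ∈ Z, ∃ y', y' ∉ Z ∧ Tied P B s κ D y y' := by
      by_contra! hno
      have key : ∀ u v, Relation.EqvGen (Tied P B s κ D) u v → (u ∈ Z ↔ v ∈ Z) := by
        intro u v huv
        induction huv with
        | rel u v h =>
          exact ⟨fun hu => by_contra fun hv => hno u hu v hv h,
            fun hv => by_contra fun hu => hno v hv u hu h.symm⟩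
        | refl u => rfl
        | symm u v _ ih => exact ih.symm
        | trans u v w _ _ ih1 ih2 => exact ih1.trans ih2
      have : tiedClass P B s κ D x ⊆ Z := fun u hu => (key x u hu.2).1 hxZ
      have := Set.ncard_le_ncard this hZfin
      omega
    have hy'U : y' ∈ tiedClass P B s κ D x :=
      ⟨hyy'.2.1, (hZU hyZ).2.trans _ _ _ (Relation.EqvGen.rel _ _ hyy')⟩
    refine ⟨insert y' Z, Set.insert_subset hy'U hZU, Or.inr hxZ, ?_, fun ζ hζ => ?_⟩
    · rw [Set.ncard_insert_of_notMem hy' hZfin, hZn]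
    · have h1 := hZb ζ (hζ.mono le_rfl le_rfl (Set.subset_insert _ _))
      rintro z (rfl | hz)
      · rw [← h1 y hyZ]
        refine (hyy'.2.2 ζ (hζ.mono le_rfl le_rfl ?_)).symm
        rintro _ (rfl | rfl)
        exacts [Or.inr hyZ, Or.inl rfl]
      · exact h1 z hz

namespace HasRealizations

theorem ncard_tiedClass_le (h : HasRealizations P B k Y ρ κ m s) {T : ℕ}
    (hm : headArity P + 1 ≤ m) (hD : D ⊆ Y) (hDL : ∀ y ∈ D, y ∉ level P B Y ρ s T d)
    {x : GTerm S C} (hx : x ∈ D) : (tiedClass P B s κ D x).ncard ≤ headArity P := by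
  by_contra! hlt
  obtain ⟨Z, hZU, hxZ, hZn, hZb⟩ := exists_tied_subset (h.finite hD) hx _ hlt
  have hZD : Z ⊆ D := hZU.trans (Set.sep_subset _ _)
  have hZY : Z ⊆ Y := hZD.trans hD
  obtain ⟨ζ, hζ, hζk⟩ := h.real Z hZY (by omega)
  obtain ⟨g, hg, hgζ⟩ := h.exists_isShift hζ hZY (by omega)
  have hinj : Set.InjOn ζ Z := fun i hi j hj hij => by
    obtain ⟨e, _, _, heg, _⟩ := h.exists_inverse hg.isEndo
    rw [← hgζ i hi, ← hgζ j hj] at hij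
    rw [← heg i (hZY hi), hij, heg j (hZY hj)]
  have h1 := ncard_le_of_block_eq (P := P) h.base (Z := ζ '' Z)
    (by rintro _ ⟨z, hz, rfl⟩; exact (hζk z hz).2)
    (by
      rintro _ ⟨z, hz, rfl⟩ c
      rw [← hgζ z hz]
      exact h.ne_const_of_notMem_level (hZY hz) (hDL z (hZD hz)) hg.isEndo c)
    (by
      rintro _ ⟨z, hz, rfl⟩ _ ⟨z', hz', rfl⟩
      rw [hZb ζ hζ z hz, hZb ζ hζ z' hz'])
  rw [hinj.ncard_image] at h1
  omega

/-- The maps on the classes of tied terms assemble to a map on the next level. -/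
theorem levelForm_succ (h : HasRealizations P B k Y ρ κ m s)
    (ht : LevelForm P B (level P B Y ρ s (2 * κ) d) K t)
    (hM : ∀ y ∈ level P B Y ρ s (2 * κ) d, (orbit P B ρ y).ncard ≤ M)
    (hm : headArity P + headArity P * M ≤ m) (hm' : headArity P + 1 ≤ m) :
    ∃ t', LevelForm P B (level P B Y ρ s (2 * κ) (d + 1)) (K + 2 * κ * (headArity P + 1)) t' := by
  classical
  set L := level P B Y ρ s (2 * κ) d with hL
  set L' := level P B Y ρ s (2 * κ) (d + 1) with hL'
  have hLL' : L ⊆ L' := level_subset_succ d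
  have hL'Y : L' ⊆ Y := level_subset (d + 1)
  set D := L' \ L with hD
  have hDY : D ⊆ Y := Set.sdiff_subset.trans hL'Y
  have hRT : ∀ U : Set (GTerm S C), ∃ tU : GTerm S C → GTerm S C, U ⊆ Y → U.ncard ≤ headArity P →
      ∀ J ⊆ L, J.ncard ≤ headArity P →
      ∀ f ∈ obLim P B, ∃ σ, FixesConst σ ∧ (∀ y ∈ U, σ y = tU y) ∧ (∀ y ∈ J, σ y = t y) ∧
        f.map σ ∈ ob P B (2 * κ + K) := fun U => by
    by_cases hU : U ⊆ Y ∧ U.ncard ≤ headArity P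
    · obtain ⟨tU, htU⟩ := h.exists_relative_form ht hM hm hU.1 hU.2
      exact ⟨tU, fun _ _ => htU⟩
    · exact ⟨id, fun h1 h2 => absurd ⟨h1, h2⟩ hU⟩
  choose tU htU using hRT
  let t' : GTerm S C → GTerm S C := fun y => if y ∈ D then tU (tiedClass P B s κ D y) y else t y
  have hconst : ∀ c : C, GTerm.const c ∉ D := fun c hc =>
    hc.2 ⟨hDY hc, not_rankGe_const _ c⟩
  have ht'c : FixesConst t' := fun c => by
    simp only [t']
    rw [if_neg (hconst c), ht.1]
  refine ⟨t', ht'c, ?_⟩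
  have key : ∀ n, ∀ J ⊆ L', J.ncard ≤ headArity P → (J ∩ D).ncard ≤ n → ∀ f ∈ obLim P B,
      ∃ σ, FixesConst σ ∧ (∀ y ∈ J, σ y = t' y) ∧ f.map σ ∈ ob P B (K + 2 * κ * (n + 1)) := by
    intro n
    induction n using Nat.strong_induction_on with
    | _ n ih =>
    intro J hJ hJa hJn f hf
    have hJY : J ⊆ Y := hJ.trans hL'Y
    have hJfin : J.Finite := h.finite hJY
    by_cases hone : ∀ x ∈ J ∩ D, ∀ y ∈ J ∩ D, Relation.EqvGen (Tied P B s κ D) x y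
    · obtain ⟨U, hUY, hUa, hU1, hU2⟩ : ∃ U : Set (GTerm S C), U ⊆ Y ∧ U.ncard ≤ headArity P ∧
          J ∩ D ⊆ U ∧ ∀ y ∈ J ∩ D, tiedClass P B s κ D y = U := by
        rcases (J ∩ D).eq_empty_or_nonempty with h0 | ⟨x, hx⟩
        · exact ⟨∅, Set.empty_subset _, by simp, h0.subset, by rw [h0]; simp⟩
        · exact ⟨tiedClass P B s κ D x, (Set.sep_subset _ _).trans hDY,
            h.ncard_tiedClass_le hm' hDY (fun y hy => hy.2) hx.2,
            fun y hy => ⟨hy.2, hone x hx y hy⟩,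
            fun y hy => tiedClass_eq (hone y hy x hx)⟩
      obtain ⟨σ, h1, h2, h3, h4⟩ := htU U hUY hUa (J ∩ L) Set.inter_subset_right
        ((Set.ncard_le_ncard Set.inter_subset_left hJfin).trans hJa) f hf
      refine ⟨σ, h1, fun y hy => ?_, ob_mono (by ring_nf; omega) h4⟩
      simp only [t']
      by_cases hyD : y ∈ D
      · rw [if_pos hyD, hU2 y ⟨hy, hyD⟩]
        exact h2 y (hU1 ⟨hy, hyD⟩)
      · rw [if_neg hyD]
        exact h3 y ⟨hy, by_contra fun hyL => hyD ⟨hJ hy, hyL⟩⟩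
    · push Not at hone
      obtain ⟨x, hx, x', hx', hxx'⟩ := hone
      obtain ⟨ζ, hζ, hζb⟩ : ∃ ζ, IsRealized P B s κ {x, x'} ζ ∧ (ζ x).block ≠ (ζ x').block := by
        by_contra! hall
        exact hxx' (Relation.EqvGen.rel _ _ ⟨hx.2, hx'.2, hall⟩)
      have hJm : J.ncard ≤ m := by omega
      obtain ⟨ξ, hξ, hξζ⟩ := h.exists_moved hJY hJm (U := {x, x'})
        (by rintro _ (rfl | rfl); exacts [hx.1, hx'.1]) hζ
      obtain ⟨g, hg, hgξ⟩ := h.exists_isShift hξ hJY hJm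
      obtain ⟨a, ha, haY, hag, _⟩ := h.exists_inverse hg.isEndo
      have hE : IsEndo P B (a ∘ ρ) := ha.comp h.core.isEndo
      have haξ : ∀ y ∈ J, a (ρ (ξ y)) = y := fun y hy => by
        rw [← hgξ y hy]; exact hag y (hJY hy)
      have hξX : ∀ y ∈ J, ξ y ∈ terms (obLim P B) := fun y hy => h.mem_terms hξ hJY hy
      have hstrict : ∀ y ∈ J, ∀ w ∈ (ξ y).subterms, w ≠ ξ y → a (ρ w) ∈ L := fun y hy w hw hne => by
        refine mem_level_of_endo (h.subterm_mem_level (hJ hy) (w := ξ y) ?_ hw hne) ha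
          (haY _ (h.core.isEndo.mem_terms (subterm_mem_terms h.base (hξX y hy) hw)))
        refine (hξ.mono le_rfl le_rfl (Set.singleton_subset_iff.2 hy)).congr ?_
        rintro _ rfl; rfl
      let W : Set (GTerm S C) := {w | ∃ y ∈ J, w ∈ (ξ y).subterms}
      have hWX : W ⊆ terms (obLim P B) := fun w ⟨y, hy, hw⟩ =>
        subterm_mem_terms h.base (hξX y hy) hw
      have hWL : ∀ w ∈ W, a (ρ w) ∈ L' := fun w ⟨y, hy, hw⟩ => by
        by_cases hne : w = ξ y
        · rw [hne, haξ y hy]; exact hJ hy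
        · exact hLL' (hstrict y hy w hw hne)
      have hWD : ∀ w ∈ W, a (ρ w) ∈ D → a (ρ w) ∈ J ∧ w = ξ (a (ρ w)) := fun w ⟨y, hy, hw⟩ hwD => by
        have hne : w = ξ y := by_contra fun hne => hwD.2 (hstrict y hy w hw hne)
        subst hne
        rw [haξ y hy]; exact ⟨hy, rfl⟩
      obtain ⟨n, rfl⟩ : ∃ n', n = n' + 1 := by
        have h1 : 0 < (J ∩ D).ncard :=
          (Set.ncard_pos (hJfin.subset Set.inter_subset_left)).2 ⟨x, hx⟩
        exact ⟨n - 1, by omega⟩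
      obtain ⟨μ, hμ, hμW, _⟩ := exists_isShift_extension h.base (W := W)
        (K := K + 2 * κ * (n + 1)) (τ := t' ∘ a ∘ ρ) (ht'c.comp hE.1)
        (fun r q z hz => hWX hz)
        (fun r q z x ⟨y, hy, hw⟩ => ⟨y, hy, GTerm.parent_mem_subterms hw x⟩)
        (fun r q z hz => by
          obtain ⟨hr, _, _, htr⟩ := null_mem_terms_obLim h.base (hWX hz)
          have hf' := hE.2 _ (headFact_mem_obLim hr htr)
          let J' : Set (GTerm S C) := (a ∘ ρ) '' (Set.range (r.headFact q).args ∩ W)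
          have hJ'L : J' ⊆ L' := by rintro _ ⟨w, hw, rfl⟩; exact hWL w hw.2
          have hJ'a : J'.ncard ≤ headArity P :=
            (Set.ncard_image_le ((Set.finite_range _).inter_of_left _)).trans
              ((Set.ncard_le_ncard Set.inter_subset_left (Set.finite_range _)).trans
                (ncard_range_args_le hr rfl))
          have hblock : ∀ y ∈ J' ∩ D, y ∈ J ∧ (ξ y).block = some ⟨r, q⟩ := by
            rintro _ ⟨⟨w, ⟨⟨i, hi⟩, hw⟩, rfl⟩, hwD⟩
            obtain ⟨h1, h2⟩ := hWD w hw hwD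
            refine ⟨h1, ?_⟩
            simp only [Function.comp]
            rw [← h2]
            rcases headFact_args_cases r q i with ⟨x', hx'⟩ | ⟨z'', hz''⟩
            · exfalso
              obtain ⟨y, hy, hzy⟩ := hz
              refine hwD.2 (hstrict y hy w ?_ ?_)
              · rw [← hi, hx']; exact GTerm.parent_mem_subterms hzy x'
              · rw [← hi, hx']; exact GTerm.parent_ne hzy x'
            · rw [← hi, hz'']; rfl
          have hssub : J' ∩ D ⊂ J ∩ D := by
            refine ⟨fun y hy => ⟨(hblock y hy).1, hy.2⟩, fun hsub => hζb ?_⟩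
            rw [← hξζ x (Or.inl rfl), ← hξζ x' (Or.inr rfl), (hblock x (hsub hx)).2,
              (hblock x' (hsub hx')).2]
          have hlt := Set.ncard_lt_ncard hssub (hJfin.subset Set.inter_subset_left)
          obtain ⟨σ, h1, h2, h3⟩ := ih n (Nat.lt_succ_self n) J' hJ'L hJ'a (by omega) _ hf'
          exact ⟨σ ∘ a ∘ ρ, h1.comp hE.1, fun w hw ⟨i, hi⟩ => h2 _ ⟨w, ⟨⟨i, hi⟩, hw⟩, rfl⟩, h3⟩)
      obtain ⟨σ, h1, h2, h3⟩ := hξ [f] (by simpa using (Nat.le_add_left _ _).trans h.size)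
        (by simpa using hf)
      refine ⟨μ ∘ σ, hμ.1.comp h1, fun y hy => ?_, ?_⟩
      · rw [Function.comp, h2 y hy, hμW _ ⟨y, hy, GTerm.self_mem_subterms _⟩]
        simp only [Function.comp]
        rw [haξ y hy]
      · rw [← PredAtom.map_map]
        have h4 := hμ.2 _ _ (h3 f (by simp))
        exact ob_mono (by ring_nf; omega) h4
  intro J hJ hJa f hf
  exact key _ J hJ hJa ((Set.ncard_le_ncard Set.inter_subset_left (h.finite (hJ.trans hL'Y))).trans
    hJa) f hf

theorem exists_levelForm (h : HasRealizations P B k Y ρ κ m s)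
    (hm : headArity P + headArity P * orbitBound (headArity P) k + 1 +
      headArity P * orbitBound (headArity P) k ^ headArity P ≤ m) {d : ℕ} (hd : d ≤ k) :
    (∃ t, LevelForm P B (level P B Y ρ s (2 * κ) d)
      (κ + d * (2 * κ * (headArity P + 1))) t) ∧
    ∀ y ∈ level P B Y ρ s (2 * κ) d, (orbit P B ρ y).ncard ≤ orbitBound (headArity P) d := by
  induction d with
  | zero =>
    refine ⟨⟨id, ?_⟩, fun y hy => ?_⟩
    · rw [Nat.zero_mul, Nat.add_zero]; exact h.levelForm_zero
    · obtain ⟨c, rfl⟩ := exists_const_of_mem_level_zero hy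
      have : orbit P B ρ (.const c) ⊆ {.const c} := by
        rintro _ ⟨g, hg, rfl⟩
        rw [hg.1, h.core.isEndo.1]; rfl
      exact (Set.ncard_le_ncard this (Set.finite_singleton _)).trans
        (Set.ncard_singleton _).le
  | succ d ih =>
    obtain ⟨⟨t, ht⟩, hM⟩ := ih (by omega)
    have h1 := orbitBound_mono (headArity P) (show d ≤ k by omega)
    have h2 := Nat.mul_le_mul_left (headArity P) h1
    have h3 := Nat.mul_le_mul_left (headArity P) (Nat.pow_le_pow_left h1 (headArity P))
    refine ⟨?_, fun y hy => h.ncard_orbit_le ht hM (one_le_orbitBound _ _)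
      (by omega) (by omega) hy⟩
    obtain ⟨t', ht'⟩ := h.levelForm_succ ht hM (by omega) (by omega)
    refine ⟨t', ?_⟩
    rwa [show κ + (d + 1) * (2 * κ * (headArity P + 1)) =
      κ + d * (2 * κ * (headArity P + 1)) + 2 * κ * (headArity P + 1) by ring]

/-- If the early terms of the chase have bounded depth, then the limit maps into a round that does
not depend on the base instance. -/
theorem exists_hom (h : HasRealizations P B k Y ρ κ m s)
    (hm : headArity P + headArity P * orbitBound (headArity P) k + 1 +
      headArity P * orbitBound (headArity P) k ^ headArity P ≤ m)
    (hT : ∀ y ∈ terms (ob P B ((k + 1) * (2 * κ))), y.depth ≤ k) :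
    ∃ g, FixesConst g ∧ ∀ f ∈ obLim P B,
      f.map g ∈ ob P B (κ + k * (2 * κ * (headArity P + 1))) := by
  obtain ⟨⟨t, ht⟩, _⟩ := h.exists_levelForm hm le_rfl
  rw [h.level_eq (by omega) hT] at ht
  refine ⟨t ∘ ρ, ht.1.comp h.core.isEndo.1, fun f hf => ?_⟩
  rcases obLim_cases hf with hfB | ⟨r, hr, q, _, rfl⟩
  · rw [PredAtom.map_eq_self fun i => ?_]
    · exact ob_mono (Nat.zero_le _) hfB
    · obtain ⟨c, hc⟩ := (h.base.2 f hfB).2 i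
      rw [hc, ht.1.comp h.core.isEndo.1]
  · obtain ⟨σ, _, h2, h3⟩ := ht.2 (ρ '' Set.range (r.headFact q).args)
      (by
        rintro _ ⟨_, ⟨i, rfl⟩, rfl⟩
        exact h.core.mapsTo _ ⟨_, hf, i, rfl⟩)
      ((Set.ncard_image_le (Set.finite_range _)).trans (ncard_range_args_le hr rfl)) _
      (h.core.isEndo.2 _ hf)
    rw [PredAtom.map_map] at h3
    convert h3 using 1
    exact PredAtom.map_congr fun i => (h2 _ ⟨_, ⟨i, rfl⟩, rfl⟩).symm

end HasRealizations

theorem isBDD_of_isTDB_of_isFUS [Infinite C] (hT : IsTDB C P) (hF : IsFUS C P) : IsBDD C P := by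
  obtain ⟨k₀, hk₀⟩ := hT
  let k := k₀ + 1
  have hk : ∀ B : Inst S C, IsBaseInstance B → ∀ i, ∀ f ∈ chaseStep P B i, ∀ j,
      (f.args j).depth ≤ k := fun B hB i f hf j => (hk₀ B hB i f hf j).trans (Nat.le_succ _)
  have hR : FinitelyRealizable.{u, v} P k := finitelyRealizable_of_tdb_fus (by omega) hk hF
  let m := headArity P + headArity P * orbitBound (headArity P) k + 1 +
    headArity P * orbitBound (headArity P) k ^ headArity P
  obtain ⟨κ, hκ⟩ := exists_isRealized (C := C) hR m (m * sizeBound P k + 1)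
  refine isBDD_iff.2 ⟨max (κ + k * (2 * κ * (headArity P + 1))) ((k + 1) * (2 * κ)),
    fun B hB => ?_⟩
  obtain ⟨n, _, hent, hdepth, hg⟩ := exists_hom_of_chaseStep_depth_le (P := P) hB (hk B hB)
  obtain ⟨Y, ρ, hY⟩ := exists_isCore (P := P) hB hdepth hg
  by_cases hn : n ≤ (k + 1) * (2 * κ)
  · exact entails_succ_mono hB hent (hn.trans (le_max_right _ _))
  · have h : HasRealizations P B k Y ρ κ m (m * sizeBound P k + 1) :=
      ⟨hB, hY, fun I hI hIm => hκ B hB Y ρ hY I hI hIm, le_rfl, by simp only [m]; omega⟩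
    exact entails_succ_of_hom (h.exists_hom le_rfl fun y hy =>
      hdepth y (terms_mono (ob_mono (by omega)) hy)) (le_max_left _ _)

end Units

section EasyDirections

variable {S : Signature.{u}} {C : Type v} {P : Program S} {B : Inst S C}

theorem isTDB_of_isBDD (h : IsBDD C P) : IsTDB C P := by
  obtain ⟨k, hk⟩ := isBDD_iff.1 h
  refine ⟨k + 2, fun B hB i f hf j => ?_⟩
  rcases chaseStep_cases (P := P) (B := B) i with ⟨h1, _, h2⟩ | ⟨m, _, h1, _, _, h2⟩
  · have hi : i ≤ k := by
      by_contra! hlt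
      exact h2 k hlt (hk B hB)
    have := depth_ob hB ⟨f, h1 ▸ hf, j, rfl⟩
    omega
  · have hm : m ≤ k := by
      by_contra! hlt
      exact h2 k hlt (hk B hB)
    have := depth_ob hB ⟨f, h1 ▸ hf, j, rfl⟩
    omega

theorem isFUS_of_isBDD [Infinite C] (h : IsBDD C P) : IsFUS C P := by
  classical
  obtain ⟨k, hk⟩ := isBDD_iff.1 h
  intro Q
  let qc : Set C := {c : C | ∃ A ∈ Q, ∃ i, A.args i = Sum.inl c}
  let F : Set S.Pred := bodyPreds P ∪ PredAtom.pred '' {A | A ∈ Q}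
  have hF : F.Finite := (bodyPreds_finite P).union ((List.finite_toSet Q).image _)
  obtain ⟨b, hb⟩ := exists_uniform_bound hF (p := fun p b => S.arity p ≤ b)
    (fun p m n hmn h => h.trans hmn) (fun p _ => ⟨_, le_rfl⟩)
  let N := Q.length * bodyBound P ^ k
  let G : Set (C ⊕ Var) := Sum.inl '' qc ∪ Sum.inr '' Set.Iio (N * b)
  have hG : G.Finite := ((finite_consts_bcq Q).image _).union ((Set.finite_Iio _).image _)
  have hfin : {q : BCQ S C | (q.length ≤ N ∧ ∀ a ∈ q, a ∈ {A : PredAtom S (C ⊕ Var) | A.pred ∈ F ∧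
      ∀ i, A.args i ∈ G}) ∧ ∀ B : Inst S C, IsBaseInstance B → q.TrueIn B →
      KBEntails P B Q}.Finite :=
    (finite_list_of_mem (finite_predAtom hF hG) N).subset fun q hq => hq.1
  refine ⟨hfin.toFinset.toList, fun B hB => ⟨fun hQ => ?_, ?_⟩⟩
  swap
  · rintro ⟨q, hq, hqB⟩
    rw [Finset.mem_toList, Set.Finite.mem_toFinset] at hq
    exact hq.2 B hB hqB
  obtain ⟨g, hg, hgk⟩ := exists_hom_of_entails_succ hB (hk B hB)
  obtain ⟨σ, hσ⟩ := ((kbEntails_iff hB).1 hQ).map hg hgk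
  obtain ⟨L, hL1, hL2, hL3⟩ := exists_support_list
    (A := Q.map fun A => A.map (Sum.elim GTerm.const σ)) (P := P) (B := B) (t := k)
    (s := Q.length) (by simp) (by
      intro f hf
      obtain ⟨A, hA, rfl⟩ := List.mem_map.1 hf
      exact hσ A hA)
  have hLF : ∀ f ∈ L, f.pred ∈ F := fun f hf => by
    rcases (hL2 f hf).2 with h | h
    · exact Or.inl h
    · obtain ⟨A, hA, rfl⟩ := List.mem_map.1 h
      exact Or.inr ⟨A, hA, rfl⟩
  let code : GTerm S C → C ⊕ Var := fun y => match y with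
    | .const c => if c ∈ qc then Sum.inl c else Sum.inr (termCode (argList L) (.const c))
    | .null _ _ _ => Sum.inr 0
  let q : BCQ S C := L.map fun f => f.map code
  have hqB : q.TrueIn B := by
    refine ⟨fun n => (argList L).getD n (.const (Classical.arbitrary C)), fun a ha => ?_⟩
    obtain ⟨f, hf, rfl⟩ := List.mem_map.1 ha
    rw [PredAtom.map_map, PredAtom.map_eq_self fun i => ?_]
    · exact (hL2 f hf).1
    · have hm := mem_argList hf i
      obtain ⟨c, hc⟩ := (hB.2 f (hL2 f hf).1).2 i
      rw [hc] at hm ⊢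
      simp only [Function.comp, code]
      split
      · rfl
      · rw [Sum.elim_inr, List.getD_eq_getElem?_getD, getElem?_termCode hm]; rfl
  refine ⟨q, ?_, hqB⟩
  rw [Finset.mem_toList, Set.Finite.mem_toFinset]
  refine ⟨⟨by simpa [q] using hL1, fun a ha => ?_⟩, fun B₁ hB₁ ⟨ν, hν⟩ => ?_⟩
  · obtain ⟨f, hf, rfl⟩ := List.mem_map.1 ha
    refine ⟨hLF f hf, fun i => ?_⟩
    have hm := mem_argList hf i
    obtain ⟨c, hc⟩ := (hB.2 f (hL2 f hf).1).2 i
    change code (f.args i) ∈ G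
    rw [hc] at hm ⊢
    simp only [code]
    split
    · exact Or.inl ⟨c, ‹_›, rfl⟩
    · exact Or.inr ⟨_, (termCode_lt_length hm).trans_le
        (length_argList_le hL1 fun f hf => hb _ (hLF f hf)), rfl⟩
  · let cst : GTerm S C → C := fun y => match y with
      | .const c => c
      | .null _ _ _ => Classical.arbitrary C
    let e : C → C := fun c =>
      if c ∈ qc then c else cst (ν (termCode (argList L) (.const c)))
    have heL : ∀ f ∈ {f | f ∈ L}, f.map (GTerm.mapC e) ∈ B₁ := fun f hf => by
      have h1 := hν _ (List.mem_map.2 ⟨f, hf, rfl⟩)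
      rw [PredAtom.map_map] at h1
      convert h1 using 1
      refine PredAtom.map_congr fun i => ?_
      obtain ⟨c, hc⟩ := (hB.2 f (hL2 f hf).1).2 i
      obtain ⟨c', hc'⟩ := (hB₁.2 _ h1).2 i
      change Sum.elim GTerm.const ν (code (f.args i)) = _ at hc'
      rw [hc] at hc' ⊢
      simp only [Function.comp, GTerm.mapC, e]
      simp only [code] at hc' ⊢
      split
      · rfl
      · rename_i hcq
        rw [if_neg hcq, Sum.elim_inr] at hc'
        rw [Sum.elim_inr, hc']
    rw [kbEntails_iff hB₁]
    refine ⟨fun x => (σ x).mapC e, fun A hA => ⟨k, ?_⟩⟩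
    have h1 := ob_mapC e heL (hL3 _ (List.mem_map.2 ⟨A, hA, rfl⟩))
    rw [PredAtom.map_map] at h1
    convert h1 using 1
    refine PredAtom.map_congr fun i => ?_
    cases hi : A.args i with
    | inl c =>
      have hc : c ∈ qc := ⟨A, hA, i, hi⟩
      simp only [Function.comp, Sum.elim_inl, GTerm.mapC, e]
      rw [if_pos hc]
    | inr x => rfl

/-- If each query that holds in a finite instance `J` also holds in `I`, then `I` entails `J`. -/
theorem entails_of_forall_trueIn [Nonempty C] {I J : Inst S C} (hJ : J.Finite)
    (h : ∀ Q : BCQ S C, Q.TrueIn J → Q.TrueIn I) : Entails I J := by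
  classical
  let L := hJ.toFinset.toList
  have hL : ∀ f, f ∈ L ↔ f ∈ J := fun f => by simp [L]
  let code : GTerm S C → C ⊕ Var := fun y => match y with
    | .const c => Sum.inl c
    | .null r h z => Sum.inr (termCode (argList L) (.null r h z))
  obtain ⟨σ, hσ⟩ := h (L.map fun f => f.map code) ⟨fun n => (argList L).getD n (.const (Classical.arbitrary C)), fun a ha => by
    obtain ⟨f, hf, rfl⟩ := List.mem_map.1 ha
    rw [PredAtom.map_map, PredAtom.map_eq_self fun i => ?_]
    · exact (hL f).1 hf
    · have hm := mem_argList hf i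
      cases hy : f.args i with
      | const c => rfl
      | null r t z =>
        rw [hy] at hm
        simp only [Function.comp, code]
        rw [Sum.elim_inr, List.getD_eq_getElem?_getD, getElem?_termCode hm]; rfl⟩
  refine ⟨fun y => Sum.elim GTerm.const σ (code y), fun c => rfl, fun f hf => ?_⟩
  have := hσ _ (List.mem_map.2 ⟨f, (hL f).2 hf, rfl⟩)
  rwa [PredAtom.map_map] at this

end EasyDirections

section Graphs

variable {S : Signature.{u}} {C : Type v} {P : Program S} {B : Inst S C}

/-- The number of proper ancestors of a node. -/
noncomputable def ExecutionGraph.height {V : Type} (G : ExecutionGraph P V) (v : V) : ℕ :=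
  {w | Relation.TransGen (fun a b => ∃ j, G.edge a b j) w v}.ncard

theorem ExecutionGraph.height_lt {V : Type} [Finite V] (G : ExecutionGraph P V) {w v : V}
    {j : Fin (G.rule v).body.length} (h : G.edge w v j) : G.height w < G.height v := by
  refine Set.ncard_lt_ncard ⟨fun x hx => hx.tail ⟨j, h⟩, fun hsub => ?_⟩ (Set.toFinite _)
  exact G.acyclic w (hsub (Relation.TransGen.single ⟨j, h⟩))

theorem ExecutionGraph.nodeFact_mem_ob {V : Type} [Finite V] (G : ExecutionGraph P V) {v : V}
    {f : GroundFact S C} (h : G.NodeFact B v f) : f ∈ ob P B (G.height v + 1) := by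
  induction h with
  | extensional v hv h hB =>
    exact ob_mono (by omega) (headFact_mem_ob (t := 0) (G.rule_mem v) hB)
  | intensional v hv h parent hparent hfact ih =>
    refine headFact_mem_ob (G.rule_mem v) fun A hA => ?_
    obtain ⟨j, hj, rfl⟩ := List.getElem_of_mem hA
    exact ob_mono (G.height_lt (hparent ⟨j, hj⟩)) (ih ⟨j, hj⟩)

theorem ExecutionGraph.eval_subset_ob {V : Type} [Finite V] (G : ExecutionGraph P V) :
    G.eval B ⊆ ob P B (Nat.card V + 1) := by
  rintro f (hf | ⟨v, hv⟩)
  · exact ob_mono (Nat.zero_le _) hf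
  · refine ob_mono (Nat.succ_le_succ ?_) (G.nodeFact_mem_ob hv)
    exact (Set.ncard_le_ncard (Set.subset_univ _) (Set.toFinite _)).trans
      (Set.ncard_univ V).le

theorem isBDD_of_isFTG [Infinite C] (h : IsFTG C P) : IsBDD C P := by
  obtain ⟨V, _, G, hG⟩ := h
  refine isBDD_iff.2 ⟨Nat.card V + 1, fun B hB => ?_⟩
  refine entails_of_forall_trueIn (ob_finite hB.1 _) fun Q hQ => ?_
  exact ((hG B hB Q).1 ((kbEntails_iff hB).2 (hQ.mono (ob_subset_obLim _)))).mono G.eval_subset_ob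

/-- Trees of rule applications; a node of the rule `i` has `len i` children. -/
inductive RuleTree {n : ℕ} (len : Fin n → ℕ) : Type
  | leaf (i : Fin n) : RuleTree len
  | node (i : Fin n) (c : Fin (len i) → RuleTree len) : RuleTree len

namespace RuleTree

variable {n : ℕ} {len : Fin n → ℕ}

/-- The rule at the root. -/
def root : RuleTree len → Fin n
  | leaf i => i
  | node i _ => i

/-- The depth of a tree of rule applications. -/
def depth : RuleTree len → ℕ
  | leaf _ => 1
  | node _ c => Finset.univ.sup (fun j => (c j).depth) + 1

/-- The child relation. -/
def IsChild (u : RuleTree len) : (v : RuleTree len) → Fin (len v.root) → Prop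
  | leaf _, _ => False
  | node _ c, j => c j = u

theorem depth_lt_of_isChild {w v : RuleTree len} {j : Fin (len v.root)} (h : IsChild w v j) :
    w.depth < v.depth := by
  cases v with
  | leaf i => exact h.elim
  | node i c =>
    obtain rfl : c j = w := h
    rw [depth]
    exact Nat.lt_succ_of_le (Finset.le_sup (f := fun j => (c j).depth) (Finset.mem_univ j))

theorem finite_depth_le (k : ℕ) : {v : RuleTree len | v.depth ≤ k}.Finite := by
  induction k with
  | zero =>
    refine Set.Finite.subset Set.finite_empty fun v hv => ?_
    cases v <;> simp [depth] at hv
  | succ k ih =>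
    have hfin : (Set.range (leaf : Fin n → RuleTree len) ∪
        ⋃ i, node i '' {c : Fin (len i) → RuleTree len | ∀ j, c j ∈ {v | v.depth ≤ k}}).Finite :=
      (Set.finite_range _).union (Set.finite_iUnion fun i => (Set.Finite.pi' fun _ => ih).image _)
    refine hfin.subset fun v hv => ?_
    cases v with
    | leaf i => exact Or.inl ⟨i, rfl⟩
    | node i c =>
      refine Or.inr (Set.mem_iUnion.2 ⟨i, c, fun j => ?_, rfl⟩)
      have h1 := depth_lt_of_isChild (v := node i c) (j := j) (rfl : IsChild (c j) (node i c) j)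
      exact Nat.le_of_lt_succ (h1.trans_le hv)

/-- The leaves have extensional rules, and the other nodes have intensional rules and children
whose head predicates fit. -/
def Fits (rl : Fin n → Rule S) : RuleTree (fun i => (rl i).body.length) → Prop
  | leaf i => (rl i).IsExtensional
  | node i c => ¬ (rl i).IsExtensional ∧
      ∀ j, ((rl i).body.get j).pred = (rl (c j).root).head.pred ∧ Fits rl (c j)

end RuleTree

/-- The execution graph of all fitting trees of depth at most `k`. -/
def treeGraph {n : ℕ} (rl : Fin n → Rule S) (hrl : ∀ i, rl i ∈ P) (k : ℕ) : ExecutionGraph P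
    {v : RuleTree (fun i => (rl i).body.length) // v.Fits rl ∧ v.depth ≤ k} where
  rule v := rl v.1.root
  rule_mem v := hrl _
  edge u v j := RuleTree.IsChild u.1 v.1 j
  edge_pred := by
    rintro ⟨u, hu⟩ ⟨v, hv⟩ j h
    cases v with
    | leaf i => exact h.elim
    | node i c =>
      obtain rfl : c j = u := h
      exact (hv.1.2 j).1
  edge_unique := by
    rintro ⟨u, hu⟩ ⟨u', hu'⟩ ⟨v, hv⟩ j h h'
    cases v with
    | leaf i => exact h.elim
    | node i c => exact Subtype.ext ((h : c j = u).symm.trans h')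
  edge_extensional := by
    rintro ⟨u, hu⟩ ⟨v, hv⟩ j h
    cases v with
    | leaf i => exact h.elim
    | node i c => exact hv.1.1
  edge_complete := by
    rintro ⟨v, hv⟩ hext j
    cases v with
    | leaf i => exact absurd hv.1 hext
    | node i c =>
      have h : RuleTree.IsChild (len := fun i => (rl i).body.length) (c j) (RuleTree.node i c) j :=
        rfl
      exact ⟨⟨c j, (hv.1.2 j).2, (RuleTree.depth_lt_of_isChild h).le.trans hv.2⟩, rfl⟩
  acyclic := by
    intro v h
    have key : ∀ w, Relation.TransGen (fun a b : {v : RuleTree (fun i => (rl i).body.length) //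
        v.Fits rl ∧ v.depth ≤ k} => ∃ j, RuleTree.IsChild a.1 b.1 j) v w →
        v.1.depth < w.1.depth := by
      intro w hw
      induction hw with
      | single h => obtain ⟨j, h⟩ := h; exact RuleTree.depth_lt_of_isChild h
      | tail _ h ih => obtain ⟨j, h⟩ := h; exact ih.trans (RuleTree.depth_lt_of_isChild h)
    exact lt_irrefl _ (key v h)

theorem ExecutionGraph.NodeFact.pred_eq {V : Type} {G : ExecutionGraph P V} {v : V}
    {f : GroundFact S C} (h : G.NodeFact B v f) : f.pred = (G.rule v).head.pred := by
  cases h <;> rfl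

/-- The trees of depth at most `k` derive the facts of the first `k` rounds of the chase. -/
theorem exists_tree_of_mem_ob (hB : IsBaseInstance B) {n : ℕ} {rl : Fin n → Rule S}
    (hrl : ∀ i, rl i ∈ P) (hsurj : ∀ r ∈ P, ∃ i, rl i = r) {k t : ℕ} (ht : t ≤ k)
    {f : GroundFact S C} (hf : f ∈ ob P B t) :
    f ∈ B ∨ ∃ v, v.1.depth ≤ t ∧ (treeGraph rl hrl k).NodeFact B v f := by
  induction t generalizing f with
  | zero => exact Or.inl hf
  | succ t ih =>
    rcases mem_ob_succ.1 hf with hf | ⟨r, hr, h, htr, rfl⟩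
    · rcases ih (by omega) hf with h | ⟨v, hv, h⟩
      · exact Or.inl h
      · exact Or.inr ⟨v, by omega, h⟩
    · right
      obtain ⟨i, rfl⟩ := hsurj r hr
      by_cases hext : (rl i).IsExtensional
      · refine ⟨⟨.leaf i, hext, by rw [RuleTree.depth]; omega⟩, by rw [RuleTree.depth]; omega, ?_⟩
        exact ExecutionGraph.NodeFact.extensional (G := treeGraph rl hrl k)
          ⟨.leaf i, hext, by rw [RuleTree.depth]; omega⟩ hext h
          fun A hA => extensional_mem_base hB (htr A hA) (hext A hA)
      · have hint : ∀ A ∈ (rl i).body, A.pred ∈ S.intensional :=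
          (rl i).body_uniform.resolve_left hext
        have hv : ∀ j : Fin (rl i).body.length, ∃ v, v.1.depth ≤ t ∧
            (treeGraph rl hrl k).NodeFact B v
              (((rl i).body.get j).map ((rl i).skolemExt h)) := fun j => by
          have hj : (rl i).body.get j ∈ (rl i).body := List.get_mem _ _
          rcases ih (by omega) (htr _ hj) with h1 | h1
          · exact absurd (hint _ hj) (Set.disjoint_left.1 S.disjoint (hB.2 _ h1).1)
          · exact h1
        choose v hv1 hv2 using hv
        have hfits : (RuleTree.node i fun j => (v j).1).Fits rl :=
          ⟨hext, fun j => ⟨(hv2 j).pred_eq, (v j).2.1⟩⟩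
        have hdepth : (RuleTree.node i fun j => (v j).1).depth ≤ t + 1 := by
          rw [RuleTree.depth]
          exact Nat.succ_le_succ (Finset.sup_le fun j _ => hv1 j)
        exact ⟨⟨.node i fun j => (v j).1, hfits, hdepth.trans ht⟩, hdepth,
          ExecutionGraph.NodeFact.intensional (G := treeGraph rl hrl k)
            ⟨.node i fun j => (v j).1, hfits, hdepth.trans ht⟩ hext h v (fun j => rfl) hv2⟩

theorem isFTG_of_isBDD (h : IsBDD C P) : IsFTG C P := by
  classical
  obtain ⟨k, hk⟩ := isBDD_iff.1 h
  let rl : Fin P.card → Rule S := fun i => (P.equivFin.symm i).1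
  have hrl : ∀ i, rl i ∈ P := fun i => (P.equivFin.symm i).2
  have hfin : Finite {v : RuleTree (fun i => (rl i).body.length) // v.Fits rl ∧ v.depth ≤ k} :=
    (RuleTree.finite_depth_le k).subset fun v hv => hv.2
  refine ⟨_, hfin, treeGraph rl hrl k, fun B hB Q => ⟨fun hQ => ?_, fun hQ => ?_⟩⟩
  · obtain ⟨g, hg, hgk⟩ := exists_hom_of_entails_succ hB (hk B hB)
    refine (((kbEntails_iff hB).1 hQ).map hg hgk).mono fun f hf => ?_
    rcases exists_tree_of_mem_ob hB hrl
      (fun r hr => ⟨P.equivFin ⟨r, hr⟩, by simp [rl]⟩) le_rfl hf with h | ⟨v, _, h⟩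
    · exact Or.inl h
    · exact Or.inr ⟨v, h⟩
  · exact (kbEntails_iff hB).2
      (hQ.mono ((treeGraph rl hrl k).eval_subset_ob.trans (ob_subset_obLim _)))

end Graphs

/-- For a program `P` over an infinite set `C` of constants: FTG holds iff BDD does, and TDB together
with FUS holds iff BDD does. -/
theorem theorem1 {S : Signature} {C : Type*} [Infinite C] (P : Program S) :
    (IsFTG C P ↔ IsBDD C P) ∧ ((IsTDB C P ∧ IsFUS C P) ↔ IsBDD C P) :=
  ⟨⟨isBDD_of_isFTG, isFTG_of_isBDD⟩,
    ⟨fun h => isBDD_of_isTDB_of_isFUS h.1 h.2, fun h => ⟨isTDB_of_isBDD h, isFUS_of_isBDD h⟩⟩⟩
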